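/- Let $(M,\omega)$ be a smooth symplectic manifold of dimension $2n$, let $\nabla$ be a symplectic connection on $M$ (a smooth, torsion free linear connection on $TM$ with $\nabla\omega=0$), and let $t>0$. Let $\pi:\mathcal Z^0_M\to M$ be the bundle whose fibre over $x\in M$ consists of all $j\in\mathrm{End}(T_xM)$ with $j^2=-\mathrm{Id}$, $\omega(j\cdot,j\cdot)=\omega$ and $\omega(\cdot,j\cdot)$ positive definite. It is a smooth manifold of dimension $2n+n(n+1)$, an embedded submanifold of the total space of $\mathrm{End}(TM)$. Let $\Phi$ be the canonical section of $\mathrm{End}(\pi^*TM)$, $\Phi_j=j$. The vertical tangent space $\mathcal V_j=\ker d\pi_j$ is identified with $\mathfrak m_j=\{A\in\mathfrak{sp}(T_{\pi(j)}M,\omega): Aj=-jA\}$, where $A$ stands for the vertical vector $[A,j]$. Let $P:T\mathcal Z^0_M\to\mathcal V$ be the projection whose kernel is the horizontal distribution $\mathcal H^\nabla=\{X:(\pi^*\nabla)_X\Phi=0\}$, so that $(\pi^*\nabla)_X\Phi=[PX,\Phi]$. Let $\mathcal J^\nabla$ be the almost complex structure on $\mathcal Z^0_M$ that preserves $\mathcal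 H^\nabla\oplus\mathcal V$, equals $j$ on $\mathcal H^\nabla_j\cong T_{\pi(j)}M$ (through $d\pi$), and is left multiplication by $j$ on $\mathcal V_j$. Put $$\Omega^\nabla=t\,\pi^*\omega-\tau,\qquad \tau(X,Y)=\tfrac12\operatorname{Tr}\big((PX)\,\Phi\,(PY)\big).$$ Then $\Omega^\nabla$ is a smooth 2-form on $\mathcal Z^0_M$, and $\Omega^\nabla$ is closed if and only if $\nabla$ is flat, i.e. has vanishing curvature. If $\nabla$ is flat, then $(\mathcal Z^0_M,\mathcal J^\nabla,\Omega^\nabla)$ is a Kähler manifold: $\mathcal J^\nabla$ is integrable (it comes from holomorphic charts), and $\Omega^\nabla$ is a closed $\mathcal J^\nabla$-invariant 2-form with $\Omega^\nabla(X,\mathcal J^\nabla X)>0$ for all $X\neq0$. -/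

import Mathlib

open Bundle Manifold
open scoped ContDiff Topology

noncomputable section

namespace SympTwistor

/-! ### Two-forms, almost complex structures and Kähler structures on a manifold -/

section General

variable {F : Type*} [NormedAddCommGroup F] [NormedSpace ℝ F]
  {N : Type*} [TopologicalSpace N] [ChartedSpace F N]

variable (F N) in
/-- A field of bilinear forms on the tangent spaces of a manifold `N` modelled on `F`. -/
abbrev BilinField : Type _ :=
  Π x : N, TangentSpace 𝓘(ℝ, F) x →L[ℝ] TangentSpace 𝓘(ℝ, F) x →L[ℝ] ℝ

variable (F N) in
/-- A field of endomorphisms of the tangent spaces of `N`. -/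
abbrev EndField : Type _ :=
  Π x : N, TangentSpace 𝓘(ℝ, F) x →L[ℝ] TangentSpace 𝓘(ℝ, F) x

/-- A smooth differential 2-form: a smooth alternating field of bilinear forms. -/
structure IsTwoForm [IsManifold 𝓘(ℝ, F) ∞ N] (Ω : BilinField F N) : Prop where
  smooth : ContMDiff 𝓘(ℝ, F) (𝓘(ℝ, F).prod 𝓘(ℝ, F →L[ℝ] F →L[ℝ] ℝ)) ∞
    (fun x ↦ (TotalSpace.mk' (F →L[ℝ] F →L[ℝ] ℝ) x (Ω x) :
      TotalSpace (F →L[ℝ] F →L[ℝ] ℝ)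
        (fun x : N ↦ TangentSpace 𝓘(ℝ, F) x →L[ℝ] TangentSpace 𝓘(ℝ, F) x →L[ℝ] ℝ)))
  alternating : ∀ (x : N) (u : TangentSpace 𝓘(ℝ, F) x), Ω x u u = 0

/-- The expression of `Ω` in the preferred chart `φ` at `x₀`, i.e. the pullback of `Ω` by `φ⁻¹`,
as a map from the model space to bilinear forms on it. -/
def inChart (Ω : BilinField F N) (x₀ : N) (y : F) : F →L[ℝ] F →L[ℝ] ℝ :=
  let D : F →L[ℝ] TangentSpace 𝓘(ℝ, F) ((extChartAt 𝓘(ℝ, F) x₀).symm y) :=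
    mfderiv 𝓘(ℝ, F) 𝓘(ℝ, F) (extChartAt 𝓘(ℝ, F) x₀).symm y
  (ContinuousLinearMap.precomp ℝ D).comp ((Ω ((extChartAt 𝓘(ℝ, F) x₀).symm y)).comp D)

/-- `dΩ = 0`: in the charts, the exterior derivative
`dΩ(u,v,w) = D_u Ω(v,w) + D_v Ω(w,u) + D_w Ω(u,v)` of the 2-form `Ω` vanishes. -/
def IsClosedForm (Ω : BilinField F N) : Prop :=
  ∀ (x₀ : N), ∀ y ∈ (extChartAt 𝓘(ℝ, F) x₀).target, ∀ u v w : F,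
    fderiv ℝ (inChart Ω x₀) y u v w + fderiv ℝ (inChart Ω x₀) y v w u
      + fderiv ℝ (inChart Ω x₀) y w u v = 0

/-- A symplectic form: a smooth, closed, non-degenerate 2-form. -/
structure IsSymplecticForm [IsManifold 𝓘(ℝ, F) ∞ N] (σ : BilinField F N) : Prop where
  isTwoForm : IsTwoForm σ
  closed : IsClosedForm σ
  nondegenerate : ∀ (x : N) (u : TangentSpace 𝓘(ℝ, F) x), (∀ v, σ x u v = 0) → u = 0

/-- A smooth almost complex structure on `N`. -/
structure IsAlmostComplex [IsManifold 𝓘(ℝ, F) ∞ N] (J : EndField F N) : Prop where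
  smooth : ContMDiff 𝓘(ℝ, F) (𝓘(ℝ, F).prod 𝓘(ℝ, F →L[ℝ] F)) ∞
    (fun x ↦ (TotalSpace.mk' (F →L[ℝ] F) x (J x) :
      TotalSpace (F →L[ℝ] F)
        (fun x : N ↦ TangentSpace 𝓘(ℝ, F) x →L[ℝ] TangentSpace 𝓘(ℝ, F) x)))
  sq : ∀ (x : N) (u : TangentSpace 𝓘(ℝ, F) x), J x (J x u) = -u

/-- `J` comes from a complex manifold structure: around every point there is a smooth chart with
values in some `ℂᵐ` whose differential is complex linear with respect to `J`. -/
def IsIntegrable (J : EndField F N) : Prop :=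
  ∀ x₀ : N, ∃ (m : ℕ) (e : OpenPartialHomeomorph N (EuclideanSpace ℂ (Fin m))),
    x₀ ∈ e.source ∧
    ContMDiffOn 𝓘(ℝ, F) 𝓘(ℝ, EuclideanSpace ℂ (Fin m)) ∞ e e.source ∧
    ContMDiffOn 𝓘(ℝ, EuclideanSpace ℂ (Fin m)) 𝓘(ℝ, F) ∞ e.symm e.target ∧
    ∀ x ∈ e.source, ∀ u : TangentSpace 𝓘(ℝ, F) x,
      (show EuclideanSpace ℂ (Fin m) from
        mfderiv 𝓘(ℝ, F) 𝓘(ℝ, EuclideanSpace ℂ (Fin m)) e x (J x u)) =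
      Complex.I • (show EuclideanSpace ℂ (Fin m) from
        mfderiv 𝓘(ℝ, F) 𝓘(ℝ, EuclideanSpace ℂ (Fin m)) e x u)

/-- `(N, J, Ω)` is a Kähler manifold with Kähler form `Ω`: the almost complex structure `J` is
integrable, and `Ω` is a closed 2-form such that `(u, v) ↦ Ω(u, Jv)` is a `J`-Hermitian
Riemannian metric. -/
structure IsKahler [IsManifold 𝓘(ℝ, F) ∞ N] (J : EndField F N) (Ω : BilinField F N) :
    Prop where
  isAlmostComplex : IsAlmostComplex J
  isIntegrable : IsIntegrable J
  isTwoForm : IsTwoForm Ω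
  closed : IsClosedForm Ω
  compatible : ∀ (x : N) (u v : TangentSpace 𝓘(ℝ, F) x), Ω x (J x u) (J x v) = Ω x u v
  positive : ∀ (x : N) (u : TangentSpace 𝓘(ℝ, F) x), u ≠ 0 → 0 < Ω x u (J x u)

end General

/-! ### Symplectic connections -/

section Base

variable {n : ℕ} {M : Type*} [TopologicalSpace M]
  [ChartedSpace (EuclideanSpace ℝ (Fin (2 * n))) M]

variable (n) in
/-- The model space of the `2n`-dimensional manifold `M`. -/
abbrev Model : Type := EuclideanSpace ℝ (Fin (2 * n))

variable (n M) in
/-- Linear connections on the tangent bundle of `M`; `∇ Y x v` is `(∇_v Y)(x)`. -/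
abbrev LinearConnection [IsManifold 𝓘(ℝ, Model n) ∞ M] : Type _ :=
  CovariantDerivative 𝓘(ℝ, Model n) (Model n)
    (TangentSpace 𝓘(ℝ, Model n) : M → Type _)

variable [IsManifold 𝓘(ℝ, Model n) ∞ M]

/-- The vector field `X` is differentiable at `x`. -/
def DiffFieldAt (X : Π x : M, TangentSpace 𝓘(ℝ, Model n) x) (x : M) : Prop :=
  MDifferentiableAt 𝓘(ℝ, Model n) (𝓘(ℝ, Model n).prod 𝓘(ℝ, Model n))
    (fun y ↦ (TotalSpace.mk' (Model n) y (X y) : TangentBundle 𝓘(ℝ, Model n) M)) x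

/-- A symplectic connection: a smooth, torsion free linear connection with `∇σ = 0`. -/
structure IsSymplecticConnection (σ : BilinField (Model n) M) (cov : LinearConnection n M) :
    Prop where
  smooth : CovariantDerivative.ContMDiffCovariantDerivative cov ∞
  torsionFree : cov.torsion = 0
  parallel : ∀ (Y Z : Π x : M, TangentSpace 𝓘(ℝ, Model n) x) (x : M),
    DiffFieldAt Y x → DiffFieldAt Z x → ∀ v : TangentSpace 𝓘(ℝ, Model n) x,
      mvfderiv 𝓘(ℝ, Model n) (fun y ↦ σ y (Y y) (Z y)) x v =
        σ x (cov Y x v) (Z x) + σ x (Y x) (cov Z x v)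

/-- The curvature `R(X,Y)Z = ∇_X ∇_Y Z - ∇_Y ∇_X Z - ∇_[X,Y] Z`. -/
def curvature (cov : LinearConnection n M) (X Y Z : Π x : M, TangentSpace 𝓘(ℝ, Model n) x)
    (x : M) : TangentSpace 𝓘(ℝ, Model n) x :=
  cov (fun y ↦ cov Z y (Y y)) x (X x) - cov (fun y ↦ cov Z y (X y)) x (Y x)
    - cov Z x (VectorField.mlieBracket 𝓘(ℝ, Model n) X Y x)

/-- The vector field `X` is smooth. -/
def SmoothField (X : Π x : M, TangentSpace 𝓘(ℝ, Model n) x) : Prop :=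
  ContMDiff 𝓘(ℝ, Model n) (𝓘(ℝ, Model n).prod 𝓘(ℝ, Model n)) ∞
    (fun x ↦ (TotalSpace.mk' (Model n) x (X x) : TangentBundle 𝓘(ℝ, Model n) M))

/-- The connection is flat: its curvature vanishes. -/
def IsFlat (cov : LinearConnection n M) : Prop :=
  ∀ X Y Z : Π x : M, TangentSpace 𝓘(ℝ, Model n) x,
    SmoothField X → SmoothField Y → SmoothField Z → ∀ x, curvature cov X Y Z x = 0

/-- The local section of `TM` near `x` with constant coefficients `w` in the frame induced by the
preferred trivialization at `x` (extended by zero). -/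
def frameSection (x : M) (w : Model n) (y : M) : TangentSpace 𝓘(ℝ, Model n) y :=
  (trivializationAt (Model n) (TangentSpace 𝓘(ℝ, Model n) : M → Type _) x).symmL ℝ y w

lemma mdifferentiableAt_frameSection (x : M) (w : Model n) :
    DiffFieldAt (frameSection x w) x := by
  rw [DiffFieldAt, mdifferentiableAt_section]
  have h : MDifferentiableAt 𝓘(ℝ, Model n) 𝓘(ℝ, Model n) (fun _ : M ↦ w) x :=
    mdifferentiableAt_const
  refine h.congr_of_eventuallyEq ?_
  filter_upwards [(trivializationAt (Model n)
    (TangentSpace 𝓘(ℝ, Model n) : M → Type _) x).open_baseSet.mem_nhds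
      (FiberBundle.mem_baseSet_trivializationAt' x)] with y hy
  simp only [frameSection, Trivialization.symmL_apply _ hy]
  exact congrArg Prod.snd (Trivialization.apply_mk_symm _ hy w)

instance (x : M) : FiniteDimensional ℝ (TangentSpace 𝓘(ℝ, Model n) x) :=
  inferInstanceAs (FiniteDimensional ℝ (Model n))

instance (x : M) : T2Space (TangentSpace 𝓘(ℝ, Model n) x) :=
  inferInstanceAs (T2Space (Model n))

/-- The connection form at `x` in the frame of `TM` induced by the preferred trivialization at `x`:
`christoffel cov x v u = (∇_v ũ)(x)`, where `ũ` is the local section through `u ∈ T_x M` with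
constant coefficients in that frame. -/
def christoffel (cov : LinearConnection n M) (x : M) :
    TangentSpace 𝓘(ℝ, Model n) x →L[ℝ]
      TangentSpace 𝓘(ℝ, Model n) x →L[ℝ] TangentSpace 𝓘(ℝ, Model n) x :=
  let e := trivializationAt (Model n) (TangentSpace 𝓘(ℝ, Model n) : M → Type _) x
  LinearMap.toContinuousBilinearMap <| LinearMap.mk₂ ℝ
    (fun v u ↦ cov (frameSection x (e.continuousLinearMapAt ℝ x u)) x v)
    (fun v v' u ↦ map_add _ _ _)
    (fun c v u ↦ map_smul _ _ _)
    (fun v u u' ↦ by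
      have h : frameSection x (e.continuousLinearMapAt ℝ x (u + u')) =
          frameSection x (e.continuousLinearMapAt ℝ x u) +
            frameSection x (e.continuousLinearMapAt ℝ x u') := by
        funext y; simp only [frameSection, map_add, Pi.add_apply]
      rw [h, cov.isCovariantDerivativeOnUniv.add (mdifferentiableAt_frameSection x _)
        (mdifferentiableAt_frameSection x _)]
      rfl)
    (fun c v u ↦ by
      have h : frameSection x (e.continuousLinearMapAt ℝ x (c • u)) =
          c • frameSection x (e.continuousLinearMapAt ℝ x u) := by
        funext y; simp only [frameSection, map_smul, Pi.smul_apply]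
      rw [h, cov.isCovariantDerivativeOnUniv.smul_const c (mdifferentiableAt_frameSection x _)]
      rfl)

/-! ### The twistor space -/

/-- `j` is a complex structure on `T_x M` for which `σ` is of type `(1,1)` and such that
`σ(·, j·)` is positive definite. -/
structure IsCompatible (σ : BilinField (Model n) M) (x : M)
    (j : TangentSpace 𝓘(ℝ, Model n) x →L[ℝ] TangentSpace 𝓘(ℝ, Model n) x) : Prop where
  sq : ∀ u, j (j u) = -u
  invariant : ∀ u v, σ x (j u) (j v) = σ x u v
  positive : ∀ u, u ≠ 0 → 0 < σ x u (j u)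

variable (n M) in
/-- The total space of the vector bundle `End(TM)`, with its canonical smooth structure. -/
abbrev EndTM : Type _ :=
  TotalSpace (Model n →L[ℝ] Model n)
    (fun x : M ↦ TangentSpace 𝓘(ℝ, Model n) x →L[ℝ] TangentSpace 𝓘(ℝ, Model n) x)

/-- The twistor space `𝒵⁰` of `(M, σ)`: the bundle of all compatible complex structures on the
tangent spaces of `M`, as a topological subspace of `End(TM)`. -/
abbrev TwistorSpace (σ : BilinField (Model n) M) : Type _ :=
  {p : EndTM n M // IsCompatible σ p.proj p.snd}

/-- The model space of `𝒵⁰`, of dimension `2n + n(n+1)`. -/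
abbrev TModel (n : ℕ) : Type := EuclideanSpace ℝ (Fin (2 * n + n * (n + 1)))

namespace TwistorSpace

variable {σ : BilinField (Model n) M}

/-- The projection `π : 𝒵⁰ → M`. -/
def proj (z : TwistorSpace σ) : M := z.1.proj

/-- The canonical section `Φ` of `End(π^*TM)`, `Φ_j = j`. -/
def Phi (z : TwistorSpace σ) :
    TangentSpace 𝓘(ℝ, Model n) z.proj →L[ℝ] TangentSpace 𝓘(ℝ, Model n) z.proj := z.1.snd

variable [ChartedSpace (TModel n) (TwistorSpace σ)]

/-- The differential of the projection. -/
def dproj (z : TwistorSpace σ) :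
    TangentSpace 𝓘(ℝ, TModel n) z →L[ℝ] TangentSpace 𝓘(ℝ, Model n) z.proj :=
  mfderiv 𝓘(ℝ, TModel n) 𝓘(ℝ, Model n) proj z

/-- The derivative of the components of `Φ` in the preferred trivialization of `End(TM)`
at `π(z)`, seen again as an endomorphism of `T_{π(z)}M`. -/
def dFibre (z : TwistorSpace σ) :
    TangentSpace 𝓘(ℝ, TModel n) z →L[ℝ]
      TangentSpace 𝓘(ℝ, Model n) z.proj →L[ℝ] TangentSpace 𝓘(ℝ, Model n) z.proj :=
  let e := trivializationAt (Model n →L[ℝ] Model n)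
    (fun x : M ↦ TangentSpace 𝓘(ℝ, Model n) x →L[ℝ] TangentSpace 𝓘(ℝ, Model n) x) z.proj
  let D : TangentSpace 𝓘(ℝ, TModel n) z →L[ℝ] (Model n →L[ℝ] Model n) :=
    mfderiv 𝓘(ℝ, TModel n) 𝓘(ℝ, Model n →L[ℝ] Model n)
      (fun z' : TwistorSpace σ ↦ (e z'.1).2) z
  (e.symmL ℝ z.proj).comp D

/-- The covariant derivative `X ↦ (π^*∇)_X Φ`. In the local frame of `TM` it is
`dΦ(X) + [Γ(dπ X), Φ]`, with `Γ` the connection form. -/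
def nablaPhi (cov : LinearConnection n M) (z : TwistorSpace σ) :
    TangentSpace 𝓘(ℝ, TModel n) z →L[ℝ]
      TangentSpace 𝓘(ℝ, Model n) z.proj →L[ℝ] TangentSpace 𝓘(ℝ, Model n) z.proj :=
  let Γ := (christoffel cov z.proj).comp z.dproj
  z.dFibre + ((ContinuousLinearMap.precomp _ z.Phi).comp Γ
    - (ContinuousLinearMap.postcomp _ z.Phi).comp Γ)

/-- The vertical projection `P` with kernel the horizontal distribution `{X : (π^*∇)_X Φ = 0}`.
The vertical space at `j` is identified with `𝔪_j = {A ∈ 𝔰𝔭(T_x M, σ) : Aj = -jA}`, where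
`A ∈ 𝔪_j` stands for the vertical vector `[A, j] = 2Aj`; thus `P X` is the element of `𝔪_j` with
`(π^*∇)_X Φ = [P X, Φ] = 2 (P X) Φ`, that is `P X = -½ ((π^*∇)_X Φ) Φ`. -/
def P (cov : LinearConnection n M) (z : TwistorSpace σ) :
    TangentSpace 𝓘(ℝ, TModel n) z →L[ℝ]
      TangentSpace 𝓘(ℝ, Model n) z.proj →L[ℝ] TangentSpace 𝓘(ℝ, Model n) z.proj :=
  (-(1 / 2 : ℝ)) • (ContinuousLinearMap.precomp _ z.Phi).comp (nablaPhi cov z)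

/-- The bilinear form `(A, B) ↦ ½ Tr(A j B)` on the endomorphisms of `T_x M`. -/
def traceForm {x : M} (j : TangentSpace 𝓘(ℝ, Model n) x →L[ℝ] TangentSpace 𝓘(ℝ, Model n) x) :
    (TangentSpace 𝓘(ℝ, Model n) x →L[ℝ] TangentSpace 𝓘(ℝ, Model n) x) →ₗ[ℝ]
      (TangentSpace 𝓘(ℝ, Model n) x →L[ℝ] TangentSpace 𝓘(ℝ, Model n) x) →ₗ[ℝ] ℝ :=
  LinearMap.mk₂ ℝ
    (fun A B ↦ (1 / 2 : ℝ) * LinearMap.trace ℝ (TangentSpace 𝓘(ℝ, Model n) x)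
      (A.toLinearMap ∘ₗ j.toLinearMap ∘ₗ B.toLinearMap))
    (fun A A' B ↦ by
      rw [ContinuousLinearMap.toLinearMap_add, LinearMap.add_comp, map_add, mul_add])
    (fun c A B ↦ by
      rw [ContinuousLinearMap.toLinearMap_smul, LinearMap.smul_comp, map_smul, smul_eq_mul,
        smul_eq_mul, mul_left_comm])
    (fun A B B' ↦ by
      rw [ContinuousLinearMap.toLinearMap_add, LinearMap.comp_add, LinearMap.comp_add, map_add,
        mul_add])
    (fun c A B ↦ by
      rw [ContinuousLinearMap.toLinearMap_smul, LinearMap.comp_smul, LinearMap.comp_smul, map_smul,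
        smul_eq_mul, smul_eq_mul, mul_left_comm])

instance (z : TwistorSpace σ) : FiniteDimensional ℝ (TangentSpace 𝓘(ℝ, TModel n) z) :=
  inferInstanceAs (FiniteDimensional ℝ (TModel n))

instance (z : TwistorSpace σ) : T2Space (TangentSpace 𝓘(ℝ, TModel n) z) :=
  inferInstanceAs (T2Space (TModel n))

/-- `τ(X, Y) = ½ Tr((P X) Φ (P Y))`. -/
def tau (cov : LinearConnection n M) : BilinField (TModel n) (TwistorSpace σ) := fun z ↦
  LinearMap.toContinuousBilinearMap <|
    (traceForm z.Phi).compl₁₂ (P cov z).toLinearMap (P cov z).toLinearMap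

/-- The 2-form `Ω^∇ = t π^*σ - τ`. -/
def Omega (cov : LinearConnection n M) (t : ℝ) : BilinField (TModel n) (TwistorSpace σ) := fun z ↦
  t • (ContinuousLinearMap.precomp ℝ z.dproj).comp ((σ z.proj).comp z.dproj) - tau cov z

/-- `J` is the twistor almost complex structure `𝒥^∇ = (J^h, J^v)`: it preserves the splitting of
`T𝒵⁰` into the horizontal and vertical distributions, it is `j` on the horizontal space at `j`,
identified with `T_{π(j)}M` by `dπ`, and it is left multiplication by `j` on the vertical space. -/
def IsTwistorStructure (cov : LinearConnection n M) (J : EndField (TModel n) (TwistorSpace σ)) :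
    Prop :=
  ∀ (z : TwistorSpace σ) (X : TangentSpace 𝓘(ℝ, TModel n) z),
    z.dproj (J z X) = z.Phi (z.dproj X) ∧ P cov z (J z X) = z.Phi.comp (P cov z X)

end TwistorSpace

end Base

end SympTwistor

end

/-! The question is local, and in suitable charts it becomes matrix calculus. Fix a Euclidean model
with an orthogonal complex structure j. In a local symplectic frame the Cayley transform identifies
a whole fibre of the twistor space with the Siegel disc: the symmetric endomorphisms X with Xj = -jX
and ‖X‖ < 1 (`isStdCompatible_cayleyInv`, `cayley_mem_of_isStdCompatible`). The twistor space is
thereby a linear slice in charts of End(TM), which gives its manifold structure and the embedding.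

In such a chart let A be the connection form, R its curvature and N = dΦ + [A, Φ] the covariant
derivative of Φ. Since P = -½NΦ, the form is Ω = tω + ⅛ tr(N N Φ), see `coordForm` and
`Omega_apply`. Now N anticommutes with Φ, so triple products of N are traceless, and the
antisymmetrised covariant derivative of N is [R, Φ]. With dω = 0 this gives dΩ(u,v,x) = ¼
(tr(R(u,v)N(x)) + cyclic), by `trace_covariant_identity` and `fderiv_coordForm_cyclic`. So flatness
implies closedness.

Conversely, for x vertical and u, v lifts of vectors of M, only tr(R(u,v)N(x)) = 0 remains, at every
point c of the fibre and for every N tangent to the fibre at c. Differences T_v - T_{cv} of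
transvections are tangent at c, so the quadratic form q(v) = ω(v, R(u,v')v) satisfies q(v) = q(cv)
for every compatible c. One c maps v to jv and another maps it to ½jv, hence q = 0. As R takes
values in the symplectic Lie algebra (`curvForm_skew`), R = 0; this is `eq_zero_of_trE_mul_eq_zero`.

A tangent vector of the twistor space amounts to its projection to M together with an arbitrary
tangent vector of the fibre, and tangent spaces of the fibre are stable under left multiplication by
c. So the almost complex structure exists and is unique, flat or not. Hermitian positivity is also
pointwise: a tangent vector Y of the fibre at c is symmetric for ω(·, c·), so tr(Y²) > 0 unless Y =
0.

If the connection is flat, there are affine coordinates ψ whose differential is a parallel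
symplectic frame (`exists_affine_coordinates`, `exists_affine_frame`). In that frame N = dΦ, so the
Cayley transform W of Φ is holomorphic. As 1 - W intertwines Φ with j, the pair ((1 - W)ψ, W) gives
explicit holomorphic coordinates (`holMap`), so integrability needs no Newlander–Nirenberg theorem.
-/

noncomputable section

namespace SympTwistor

/-! ### Linear symplectic bases. -/

section SymplecticBasis

variable {V : Type*} [AddCommGroup V] [Module ℝ V]

/-- The families `e`, `f` satisfy the relations of a symplectic basis for `ϖ`. -/
structure IsSymplecticFamily (ϖ : V →ₗ[ℝ] V →ₗ[ℝ] ℝ) {k : ℕ} (e f : Fin k → V) : Prop where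
  ef : ∀ i j, ϖ (e i) (f j) = if i = j then 1 else 0
  ee : ∀ i j, ϖ (e i) (e j) = 0
  ff : ∀ i j, ϖ (f i) (f j) = 0

lemma IsSymplecticFamily.fe {ϖ : V →ₗ[ℝ] V →ₗ[ℝ] ℝ} (hϖ : ϖ.IsAlt) {k : ℕ} {e f : Fin k → V}
    (h : IsSymplecticFamily ϖ e f) (i j : Fin k) : ϖ (f i) (e j) = if i = j then -1 else 0 := by
  rw [← hϖ.neg, h.ef]
  by_cases hij : i = j
  · simp [hij]
  · simp [hij, Ne.symm hij]

lemma IsSymplecticFamily.linearIndependent {ϖ : V →ₗ[ℝ] V →ₗ[ℝ] ℝ} (hϖ : ϖ.IsAlt) {k : ℕ}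
    {e f : Fin k → V} (h : IsSymplecticFamily ϖ e f) :
    LinearIndependent ℝ (Sum.elim e f) := by
  rw [Fintype.linearIndependent_iff]
  intro c hc
  simp only [Fintype.sum_sum_type, Sum.elim_inl, Sum.elim_inr] at hc
  rintro (i | i)
  · have := congrArg (fun v ↦ ϖ v (f i)) hc
    simpa [map_add, map_sum, h.ef, h.ff] using this
  · have := congrArg (fun v ↦ ϖ v (e i)) hc
    simpa [map_add, map_sum, h.fe hϖ, h.ee] using this

lemma exists_isSymplecticFamily [FiniteDimensional ℝ V] {ϖ : V →ₗ[ℝ] V →ₗ[ℝ] ℝ} (hϖ : ϖ.IsAlt)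
    (hnd : ∀ u, (∀ v, ϖ u v = 0) → u = 0) (k : ℕ) (hk : 2 * k ≤ Module.finrank ℝ V) :
    ∃ e f : Fin k → V, IsSymplecticFamily ϖ e f := by
  induction k with
  | zero => exact ⟨Fin.elim0, Fin.elim0, ⟨fun i ↦ i.elim0, fun i ↦ i.elim0, fun i ↦ i.elim0⟩⟩
  | succ k ih =>
    obtain ⟨e, f, h⟩ := ih (by omega)
    have hsp : Submodule.span ℝ (Set.range (Sum.elim e f)) ≠ ⊤ := by
      intro htop
      have h1 := finrank_range_le_card (R := ℝ) (Sum.elim e f)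
      rw [Set.finrank, htop, finrank_top] at h1
      simp at h1
      omega
    -- The projection onto the ϖ-orthogonal complement of the span of the `e i` and `f i`; the signs
    -- differ because ϖ(f i, e i) = -1.
    let pr : V → V := fun u ↦ u - ∑ i, ϖ u (f i) • e i + ∑ i, ϖ u (e i) • f i
    have pr_e (u : V) (j : Fin k) : ϖ (pr u) (e j) = 0 := by
      simp [pr, map_add, map_sub, map_sum, h.ee, h.fe hϖ]
    have pr_f (u : V) (j : Fin k) : ϖ (pr u) (f j) = 0 := by
      simp [pr, map_add, map_sub, map_sum, h.ff, h.ef]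
    obtain ⟨u, hu⟩ : ∃ u, u ∉ Submodule.span ℝ (Set.range (Sum.elim e f)) := by
      by_contra hcon
      push Not at hcon
      exact hsp (Submodule.eq_top_iff'.2 hcon)
    have he (i : Fin k) : e i ∈ Submodule.span ℝ (Set.range (Sum.elim e f)) :=
      Submodule.subset_span ⟨Sum.inl i, rfl⟩
    have hf (i : Fin k) : f i ∈ Submodule.span ℝ (Set.range (Sum.elim e f)) :=
      Submodule.subset_span ⟨Sum.inr i, rfl⟩
    have hpu : pr u ≠ 0 := by
      intro h0
      apply hu
      have : u = ∑ i, ϖ u (f i) • e i - ∑ i, ϖ u (e i) • f i := by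
        have h0' : u - ∑ i, ϖ u (f i) • e i + ∑ i, ϖ u (e i) • f i = 0 := h0
        rw [← sub_eq_zero, ← h0']; abel
      rw [this]
      exact Submodule.sub_mem _ (Submodule.sum_mem _ fun i _ ↦ Submodule.smul_mem _ _ (he i))
        (Submodule.sum_mem _ fun i _ ↦ Submodule.smul_mem _ _ (hf i))
    obtain ⟨w, hw⟩ : ∃ w, ϖ (pr u) w ≠ 0 := by
      by_contra hcon
      push Not at hcon
      exact hpu (hnd _ hcon)
    -- Projecting w does not change its pairing with `pr u`, so `pr u` and a multiple of `pr w`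
    -- extend the family.
    have hwp : ϖ (pr u) (pr w) = ϖ (pr u) w := by
      conv_lhs => rw [show pr w = w - ∑ i, ϖ w (f i) • e i + ∑ i, ϖ w (e i) • f i from rfl]
      simp [map_add, map_sub, map_sum, pr_e, pr_f]
    set a := pr u
    set b := (ϖ (pr u) w)⁻¹ • pr w
    have hab : ϖ a b = 1 := by simp [a, b, hwp, hw]
    have hba : ∀ x, ϖ x b = (ϖ (pr u) w)⁻¹ * ϖ x (pr w) := fun x ↦ by simp [b]
    have hpe (x : V) (j : Fin k) : ϖ (e j) (pr x) = 0 := by rw [← hϖ.neg, pr_e, neg_zero]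
    have hpf (x : V) (j : Fin k) : ϖ (f j) (pr x) = 0 := by rw [← hϖ.neg, pr_f, neg_zero]
    have hbe (j : Fin k) : ϖ b (e j) = 0 := by simp [b, pr_e]
    have hbf (j : Fin k) : ϖ b (f j) = 0 := by simp [b, pr_f]
    refine ⟨Fin.cons a e, Fin.cons b f, ⟨?_, ?_, ?_⟩⟩
    · intro i j
      refine Fin.cases ?_ (fun i ↦ ?_) i <;> refine Fin.cases ?_ (fun j ↦ ?_) j
      · simpa using hab
      · simp [a, pr_f, (Fin.succ_ne_zero j).symm]
      · simp [hba, hpe]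
      · simp [h.ef]
    · intro i j
      refine Fin.cases ?_ (fun i ↦ ?_) i <;> refine Fin.cases ?_ (fun j ↦ ?_) j
      · simpa using hϖ a
      · simp [a, pr_e]
      · simp [a, hpe]
      · simp [h.ee]
    · intro i j
      refine Fin.cases ?_ (fun i ↦ ?_) i <;> refine Fin.cases ?_ (fun j ↦ ?_) j
      · simpa using hϖ b
      · simp [hbf]
      · simp [hba, hpf]
      · simp [h.ff]

/-- Two symplectic vector spaces of the same dimension are isomorphic. -/
lemma exists_symplectic_equiv {V' : Type*} [AddCommGroup V'] [Module ℝ V']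
    {n : ℕ} (hV : Module.finrank ℝ V = 2 * n)
    (hV' : Module.finrank ℝ V' = 2 * n) [FiniteDimensional ℝ V] [FiniteDimensional ℝ V']
    {ϖ : V →ₗ[ℝ] V →ₗ[ℝ] ℝ} (hϖ : ϖ.IsAlt) (hnd : ∀ u, (∀ v, ϖ u v = 0) → u = 0)
    {ϖ' : V' →ₗ[ℝ] V' →ₗ[ℝ] ℝ} (hϖ' : ϖ'.IsAlt) (hnd' : ∀ u, (∀ v, ϖ' u v = 0) → u = 0) :
    ∃ L : V ≃ₗ[ℝ] V', ∀ u v, ϖ' (L u) (L v) = ϖ u v := by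
  obtain ⟨e, f, h⟩ := exists_isSymplecticFamily hϖ hnd n hV.ge
  obtain ⟨e', f', h'⟩ := exists_isSymplecticFamily hϖ' hnd' n hV'.ge
  have hc : Fintype.card (Fin n ⊕ Fin n) = 2 * n := by simp; ring
  have hB : ∃ B : Module.Basis (Fin n ⊕ Fin n) ℝ V, ⇑B = Sum.elim e f := by
    have hg := h.linearIndependent hϖ
    refine ⟨Module.Basis.mk hg ?_, Module.Basis.coe_mk _ _⟩
    rw [hg.span_eq_top_of_card_eq_finrank' (by rw [hc, hV])]
  obtain ⟨B, hB⟩ := hB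
  have hB' : ∃ B : Module.Basis (Fin n ⊕ Fin n) ℝ V', ⇑B = Sum.elim e' f' := by
    have hg := h'.linearIndependent hϖ'
    refine ⟨Module.Basis.mk hg ?_, Module.Basis.coe_mk _ _⟩
    rw [hg.span_eq_top_of_card_eq_finrank' (by rw [hc, hV'])]
  obtain ⟨B', hB'⟩ := hB'
  refine ⟨B.equiv B' (Equiv.refl _), ?_⟩
  suffices H : ϖ'.compl₁₂ (B.equiv B' (Equiv.refl _)).toLinearMap
      (B.equiv B' (Equiv.refl _)).toLinearMap = ϖ by
    intro u v
    rw [← H]; rfl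
  refine B.ext fun i ↦ B.ext fun j ↦ ?_
  have hL (i) : B.equiv B' (Equiv.refl _) (B i) = B' i := by simp
  simp only [LinearMap.compl₁₂_apply, LinearEquiv.coe_coe, hL]
  simp only [hB, hB']
  rcases i with i | i <;> rcases j with j | j <;>
    simp [h.ee, h'.ee, h.ff, h'.ff, h.ef, h'.ef, h.fe hϖ, h'.fe hϖ']

end SymplecticBasis

/-! ### Compatible complex structures, the Siegel disc and the Cayley transform. -/

section Siegel

variable {V : Type*} [NormedAddCommGroup V] [InnerProductSpace ℝ V]

/-- `j` is an orthogonal complex structure on the Euclidean space `V`. -/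
structure IsOrthComplex (j : V →L[ℝ] V) : Prop where
  sq : j * j = -1
  skew : ∀ u v, inner ℝ (j u) v = -inner ℝ u (j v)

namespace IsOrthComplex

variable {j : V →L[ℝ] V} (hj : IsOrthComplex j)
include hj

lemma apply_apply (u : V) : j (j u) = -u := congrArg (fun f : V →L[ℝ] V ↦ f u) hj.sq

lemma inner_apply_apply (u v : V) : inner ℝ (j u) (j v) = inner ℝ u v := by
  rw [hj.skew, hj.apply_apply, inner_neg_right, neg_neg]

lemma norm_apply (u : V) : ‖j u‖ = ‖u‖ := by
  have := hj.inner_apply_apply u u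
  rw [real_inner_self_eq_norm_sq, real_inner_self_eq_norm_sq] at this
  exact (sq_eq_sq₀ (norm_nonneg _) (norm_nonneg _)).1 this

lemma inner_apply_self (u : V) : inner ℝ (j u) u = 0 := by
  have := hj.skew u u
  rw [real_inner_comm] at this
  rw [real_inner_comm]
  linarith

end IsOrthComplex

/-- The symmetric endomorphisms that anticommute with `j`. -/
def symAnti (j : V →L[ℝ] V) : Submodule ℝ (V →L[ℝ] V) where
  carrier := {X | X * j = -(j * X) ∧ ∀ u v, inner ℝ (X u) v = inner ℝ u (X v)}
  add_mem' := by
    rintro X Y ⟨h1, h2⟩ ⟨h3, h4⟩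
    refine ⟨?_, fun u v ↦ ?_⟩
    · rw [add_mul, mul_add, h1, h3]; abel
    · simp [inner_add_left, inner_add_right, h2, h4]
  zero_mem' := ⟨by simp, by simp⟩
  smul_mem' := by
    rintro c X ⟨h1, h2⟩
    refine ⟨?_, fun u v ↦ ?_⟩
    · rw [smul_mul_assoc, h1, mul_smul_comm, smul_neg]
    · simp [inner_smul_left, inner_smul_right, h2]

/-- The complex structures compatible with the symplectic form `⟪j ·, ·⟫`. -/
structure IsStdCompatible (j c : V →L[ℝ] V) : Prop where
  sq : c * c = -1
  invariant : ∀ u v, inner ℝ (j (c u)) (c v) = inner ℝ (j u) v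
  positive : ∀ u, u ≠ 0 → 0 < inner ℝ (j u) (c u)

/-- The Cayley transform centred at `j`. -/
def cayley (j c : V →L[ℝ] V) : V →L[ℝ] V := (1 + j * c) * Ring.inverse (1 - j * c)

/-- The inverse of the Cayley transform centred at `j`. -/
def cayleyInv (j X : V →L[ℝ] V) : V →L[ℝ] V := j * (1 - X) * Ring.inverse (1 + X)

section Algebra

variable {j : V →L[ℝ] V} (hj : j * j = -1)

lemma cayley_mul {c : V →L[ℝ] V} (hc : IsUnit (1 - j * c)) :
    cayley j c * (1 - j * c) = 1 + j * c := by
  rw [cayley, mul_assoc, Ring.inverse_mul_cancel _ hc, mul_one]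

lemma cayleyInv_mul {X : V →L[ℝ] V} (hX : IsUnit (1 + X)) :
    cayleyInv j X * (1 + X) = j * (1 - X) := by
  rw [cayleyInv, mul_assoc, Ring.inverse_mul_cancel _ hX, mul_one]

/-- Both (1 + `cayley j c`)(1 - jc) and (1 - j `cayleyInv j X`)(1 + X) equal 2, a unit in a real
algebra, so invertibility passes from one Cayley denominator to the other. -/
lemma isUnit_of_mul_eq_two {R : Type*} [Ring R] [Algebra ℝ R] {a b : R} (h1 : a * b = 2)
    (hb : IsUnit b) : IsUnit a := by
  have h2 : IsUnit (2 : R) := by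
    have : (2 : R) = algebraMap ℝ R 2 := (map_ofNat (algebraMap ℝ R) 2).symm
    rw [this]
    exact (isUnit_iff_ne_zero.2 (by norm_num : (2 : ℝ) ≠ 0)).map _
  obtain ⟨u, rfl⟩ := hb
  rw [← h1] at h2
  simpa using h2

lemma isUnit_one_add_cayley {c : V →L[ℝ] V} (hc : IsUnit (1 - j * c)) :
    IsUnit (1 + cayley j c) := by
  refine isUnit_of_mul_eq_two (b := 1 - j * c) ?_ hc
  rw [add_mul, cayley_mul hc, one_mul, sub_add_add_cancel]
  exact one_add_one_eq_two

include hj in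
lemma mul_cayleyInv_mul {X : V →L[ℝ] V} (hX : IsUnit (1 + X)) :
    j * cayleyInv j X * (1 + X) = X - 1 := by
  rw [mul_assoc, cayleyInv_mul hX, ← mul_assoc, hj, neg_mul, one_mul, neg_sub]

include hj in
lemma isUnit_one_sub_cayleyInv {X : V →L[ℝ] V} (hX : IsUnit (1 + X)) :
    IsUnit (1 - j * cayleyInv j X) := by
  refine isUnit_of_mul_eq_two (b := 1 + X) ?_ hX
  rw [sub_mul, mul_cayleyInv_mul hj hX, one_mul, ← one_add_one_eq_two]
  abel

include hj in
lemma cayleyInv_cayley {c : V →L[ℝ] V} (hc : IsUnit (1 - j * c)) :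
    cayleyInv j (cayley j c) = c := by
  have h1 := isUnit_one_add_cayley hc
  have h2 := cayleyInv_mul (j := j) h1
  have h3 : (1 + cayley j c) * (1 - j * c) = 2 := by
    rw [add_mul, cayley_mul hc, one_mul, sub_add_add_cancel, one_add_one_eq_two]
  have h4 : j * (1 - cayley j c) * (1 - j * c) = 2 * c := by
    rw [mul_assoc, sub_mul, cayley_mul hc, one_mul,
      show (1 : V →L[ℝ] V) - j * c - (1 + j * c) = -(2 * (j * c)) by rw [two_mul]; abel]
    rw [mul_neg, two_mul, mul_add, ← mul_assoc, hj, two_mul]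
    simp
  have h5 := congrArg (· * (1 - j * c)) h2
  simp only [mul_assoc, h3] at h5
  rw [← mul_assoc, h4, mul_two, two_mul] at h5
  have : (2 : ℝ) • cayleyInv j (cayley j c) = (2 : ℝ) • c := by rw [two_smul, two_smul, h5]
  exact smul_right_injective _ (two_ne_zero) this

include hj in
lemma cayley_cayleyInv {X : V →L[ℝ] V} (hX : IsUnit (1 + X)) :
    cayley j (cayleyInv j X) = X := by
  have h1 := isUnit_one_sub_cayleyInv hj hX
  have h2 := cayley_mul h1
  have h5 := congrArg (· * (1 + X)) h2
  simp only [mul_assoc, sub_mul, add_mul, mul_cayleyInv_mul hj hX, one_mul] at h5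
  rw [show (1 : V →L[ℝ] V) + X - (X - 1) = 2 by rw [← one_add_one_eq_two]; abel,
    show (1 : V →L[ℝ] V) + X + (X - 1) = X + X by abel, mul_two] at h5
  have : (2 : ℝ) • cayley j (cayleyInv j X) = (2 : ℝ) • X := by rw [two_smul, two_smul, h5]
  exact smul_right_injective _ (two_ne_zero) this

/-- The inverse Cayley transform of an endomorphism anticommuting with `j`. -/
lemma cayleyInv_mul_of_anti {X : V →L[ℝ] V} (hX : IsUnit (1 + X)) (ha : X * j = -(j * X)) :
    cayleyInv j X * (1 + X) = (1 + X) * j := by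
  -- Anticommutation turns j(1 - X) into (1 + X)j. Thus the inverse Cayley transform is the
  -- conjugate of j by 1 + X, which is why it squares to -1.
  rw [cayleyInv_mul hX, mul_sub, add_mul, ha]; simp [sub_eq_add_neg]

end Algebra

section Norm

variable [FiniteDimensional ℝ V]

lemma isUnit_of_injective {f : V →L[ℝ] V} (hf : ∀ u, f u = 0 → u = 0) : IsUnit f := by
  have h1 : Function.Injective f.toLinearMap := by
    rw [← LinearMap.ker_eq_bot, LinearMap.ker_eq_bot']
    exact hf
  let e := LinearEquiv.ofInjectiveEndo f.toLinearMap h1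
  refine ⟨⟨f, e.symm.toContinuousLinearEquiv, ?_, ?_⟩, rfl⟩
  · ext u
    exact e.apply_symm_apply u
  · ext u
    exact e.symm_apply_apply u

/-- The maximum of ‖X u‖ on the compact unit sphere is attained, so the strict inequality survives;
in the zero space the sphere is empty and the claim is trivial. -/
lemma opNorm_lt_one_of_forall_lt {X : V →L[ℝ] V} (hX : ∀ u, u ≠ 0 → ‖X u‖ < ‖u‖) : ‖X‖ < 1 := by
  obtain hV | hV := subsingleton_or_nontrivial V
  · rw [show X = 0 from ContinuousLinearMap.ext fun u ↦ Subsingleton.elim _ _]; simp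
  obtain ⟨u, hu, hmax⟩ := (isCompact_sphere (0 : V) 1).exists_isMaxOn
    (NormedSpace.sphere_nonempty.2 zero_le_one) (f := fun u ↦ ‖X u‖) (by fun_prop)
  have hu1 : ‖u‖ = 1 := by simpa using hu
  have hu0 : u ≠ 0 := by rintro rfl; simp at hu1
  refine lt_of_le_of_lt ?_ (hu1 ▸ hX u hu0)
  refine X.opNorm_le_bound (norm_nonneg _) fun v ↦ ?_
  by_cases hv : v = 0
  · simp [hv]
  have h1 : ‖X (‖v‖⁻¹ • v)‖ ≤ ‖X u‖ :=
    hmax (show ‖v‖⁻¹ • v ∈ Metric.sphere (0 : V) 1 by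
      rw [mem_sphere_zero_iff_norm, norm_smul, norm_inv, norm_norm,
        inv_mul_cancel₀ (norm_ne_zero_iff.2 hv)])
  rw [map_smul, norm_smul, norm_inv, norm_norm, inv_mul_le_iff₀ (norm_pos_iff.2 hv)] at h1
  linarith

lemma isUnit_one_add_of_norm_lt_one {X : V →L[ℝ] V} (hX : ‖X‖ < 1) : IsUnit (1 + X) := by
  have := isUnit_one_sub_of_norm_lt_one (x := -X) (by rwa [norm_neg])
  rwa [sub_neg_eq_add] at this

end Norm

section Compatible

variable [FiniteDimensional ℝ V] {j : V →L[ℝ] V} (hj : IsOrthComplex j)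

lemma exists_apply_eq {f : V →L[ℝ] V} (hf : IsUnit f) (u : V) : ∃ a, f a = u := by
  obtain ⟨g, rfl⟩ := hf
  exact ⟨g⁻¹.1 u, congrArg (fun f : V →L[ℝ] V ↦ f u) g.mul_inv⟩

-- Write u = a + Xa; the conjugation formula gives cu = ja + Xja for the transform c. The conditions
-- become identities in a, and positivity reads ⟪ju, cu⟫ = ‖ja‖² - ‖Xja‖² > 0.
include hj in
lemma isStdCompatible_cayleyInv {X : V →L[ℝ] V} (hX : X ∈ symAnti j) (hn : ‖X‖ < 1) :
    IsStdCompatible j (cayleyInv j X) := by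
  have hu := isUnit_one_add_of_norm_lt_one hn
  obtain ⟨ha, hs⟩ := hX
  have h1 := cayleyInv_mul_of_anti hu ha
  have hc (a : V) : cayleyInv j X (a + X a) = j a + X (j a) :=
    congrArg (fun f : V →L[ℝ] V ↦ f a) h1
  have hXj (a : V) : j (X a) = -X (j a) := by
    have := congrArg (fun f : V →L[ℝ] V ↦ f a) ha
    simp only [mul_apply_eq_comp, neg_apply] at this
    rw [this, neg_neg]
  have hsurj (u : V) : ∃ a, u = a + X a := by
    obtain ⟨a, ha⟩ := exists_apply_eq hu u
    exact ⟨a, ha.symm⟩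
  refine ⟨?_, fun u v ↦ ?_, fun u h0 ↦ ?_⟩
  · ext u
    obtain ⟨a, rfl⟩ := hsurj u
    simp only [mul_apply_eq_comp, hc, hj.apply_apply, map_neg,
      neg_apply, one_apply_eq_self]
    abel
  · obtain ⟨a, rfl⟩ := hsurj u
    obtain ⟨b, rfl⟩ := hsurj v
    simp only [hc, map_add, hXj, hj.apply_apply, inner_add_left, inner_add_right, inner_neg_left,
      map_neg, hj.skew a, inner_neg_right, hs (j a), hj.skew a (X (X b)), hj.skew a (X b)]
    have e1 := hs a (j b)
    have e2 := hs a (X (j b))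
    have e3 := hj.skew a b
    have e4 : inner ℝ (j a) (X (X b)) = -inner ℝ a (X (X (j b))) := by
      rw [hj.skew, hXj, hXj, map_neg, neg_neg]
    simp only [hj.skew a, hXj, inner_neg_right, map_neg, neg_neg]
    rw [e1, e2]
    ring
  · obtain ⟨a, rfl⟩ := hsurj u
    have ha0 : a ≠ 0 := by rintro rfl; simp at h0
    have hja : ‖X (j a)‖ < ‖j a‖ := by
      have : j a ≠ 0 := by rwa [← norm_ne_zero_iff, hj.norm_apply, norm_ne_zero_iff]
      calc ‖X (j a)‖ ≤ ‖X‖ * ‖j a‖ := X.le_opNorm _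
        _ < 1 * ‖j a‖ := by gcongr
        _ = ‖j a‖ := one_mul _
    rw [hc, map_add, hXj, ← sub_eq_add_neg, inner_sub_left, inner_add_right, inner_add_right,
      real_inner_self_eq_norm_sq, real_inner_self_eq_norm_sq, hs (j a) (j a)]
    nlinarith [norm_nonneg (X (j a))]

-- If u = jcu then ju = -cu, and ⟪ju, cu⟫ = -‖cu‖² contradicts positivity. Hence a single Cayley
-- transform is defined on the whole fibre.
include hj in
lemma isUnit_one_sub_of_isStdCompatible {c : V →L[ℝ] V} (hc : IsStdCompatible j c) :
    IsUnit (1 - j * c) := by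
  refine isUnit_of_injective fun u hu ↦ ?_
  by_contra h0
  have h1 := hc.positive u h0
  have h2 : u = j (c u) := sub_eq_zero.1 hu
  rw [h2, hj.apply_apply, ← h2, inner_neg_left, real_inner_self_eq_norm_sq] at h1
  nlinarith [sq_nonneg ‖c u‖]

lemma IsStdCompatible.inner_symm (hj : IsOrthComplex j) {c : V →L[ℝ] V} (hc : IsStdCompatible j c)
    (u v : V) : inner ℝ (j (c u)) v = inner ℝ u (j (c v)) := by
  have hcc : c (c v) = -v := congrArg (fun f : V →L[ℝ] V ↦ f v) hc.sq
  have := hc.invariant u (c v)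
  rw [hcc, inner_neg_right] at this
  have h2 := hj.skew u (c v)
  linarith

-- Write u = a - jca, so that Xu = a + jca for the transform X. As jc is symmetric, ‖u‖² - ‖Xu‖² =
-- -4⟪a, jca⟫ = 4⟪ja, ca⟫ > 0.
include hj in
lemma cayley_mem_of_isStdCompatible {c : V →L[ℝ] V} (hc : IsStdCompatible j c) :
    cayley j c ∈ symAnti j ∧ ‖cayley j c‖ < 1 := by
  have hu := isUnit_one_sub_of_isStdCompatible hj hc
  have hX := cayley_mul hu
  set X := cayley j c
  have hXa (a : V) : X (a - j (c a)) = a + j (c a) := congrArg (fun f : V →L[ℝ] V ↦ f a) hX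
  have hsurj (u : V) : ∃ a, u = a - j (c a) := by
    obtain ⟨a, ha⟩ := exists_apply_eq hu u
    exact ⟨a, ha.symm⟩
  have hsym := hc.inner_symm hj
  refine ⟨⟨?_, fun u v ↦ ?_⟩, opNorm_lt_one_of_forall_lt fun u h0 ↦ ?_⟩
  · ext u
    obtain ⟨a, rfl⟩ := hsurj u
    have hcc (v) : c (c v) = -v := congrArg (fun f : V →L[ℝ] V ↦ f v) hc.sq
    have h3 := hXa (c (j (j a)))
    simp only [hj.apply_apply, map_neg, hcc, neg_neg] at h3
    have h4 : X (j (a - j (c a))) = -X (-c a - j a) := by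
      rw [← map_neg X, map_sub, hj.apply_apply]; congr 1; abel
    simp only [mul_apply_eq_comp, neg_apply]
    rw [h4, h3, hXa, map_add, hj.apply_apply]
    abel
  · obtain ⟨a, rfl⟩ := hsurj u
    obtain ⟨b, rfl⟩ := hsurj v
    simp only [hXa, inner_add_left, inner_add_right, inner_sub_left, inner_sub_right, hsym]
    ring
  · obtain ⟨a, rfl⟩ := hsurj u
    have ha0 : a ≠ 0 := by rintro rfl; simp at h0
    rw [hXa, ← sq_lt_sq₀ (norm_nonneg _) (norm_nonneg _), ← real_inner_self_eq_norm_sq,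
      ← real_inner_self_eq_norm_sq]
    simp only [inner_add_left, inner_add_right, inner_sub_left, inner_sub_right]
    have h1 := hc.positive a ha0
    have h2 := hj.skew a (c a)
    have h3 := real_inner_comm a (j (c a))
    linarith

/-- A compatible complex structure that stretches the vector `v`. -/
lemma exists_isStdCompatible_apply (hj : IsOrthComplex j) (v : V) :
    ∃ c, IsStdCompatible j c ∧ c v = (1 / 2 : ℝ) • j v := by
  obtain rfl | hv := eq_or_ne v 0
  · have h0 : (0 : V →L[ℝ] V) ∈ symAnti j := zero_mem _
    exact ⟨_, isStdCompatible_cayleyInv hj h0 (by simp), by simp⟩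
  -- Chosen so that Xv = v/3 and X(jv) = -jv/3: the inverse Cayley transform then sends v to (1 -
  -- 1/3)/(1 + 1/3) = 1/2 times jv.
  set r : ℝ := 3⁻¹ * (‖v‖ ^ 2)⁻¹
  have hv0 : ‖v‖ ≠ 0 := norm_ne_zero_iff.2 hv
  let X : V →L[ℝ] V := r • ((innerSL ℝ v).smulRight v - (innerSL ℝ (j v)).smulRight (j v))
  have hXu (u : V) : X u = r • (inner ℝ v u • v - inner ℝ (j v) u • j v) := rfl
  have hX : X ∈ symAnti j := by
    refine ⟨?_, fun u w ↦ ?_⟩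
    · ext u
      simp only [mul_apply_eq_comp, neg_apply, hXu, map_smul, map_sub,
        hj.apply_apply, hj.inner_apply_apply, hj.skew v u]
      rw [← smul_neg]
      congr 1
      simp
    · simp only [hXu, inner_smul_left, inner_smul_right, inner_sub_left, inner_sub_right]
      rw [real_inner_comm u v, real_inner_comm u (j v)]
      simp only [RCLike.conj_to_real]
      ring
  have hn : ‖X‖ < 1 := by
    refine lt_of_le_of_lt (X.opNorm_le_bound (M := 2 / 3) (by norm_num) fun u ↦ ?_) (by norm_num)
    rw [hXu, norm_smul]
    have h1 : ‖inner ℝ v u • v - inner ℝ (j v) u • j v‖ ≤ 2 * ‖v‖ ^ 2 * ‖u‖ := by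
      refine (norm_sub_le _ _).trans ?_
      rw [norm_smul, norm_smul, hj.norm_apply]
      have h1 := norm_inner_le_norm (𝕜 := ℝ) v u
      have h2 := norm_inner_le_norm (𝕜 := ℝ) (j v) u
      rw [hj.norm_apply] at h2
      nlinarith [norm_nonneg v]
    have hr : ‖r‖ = r := Real.norm_of_nonneg (by positivity)
    rw [hr]
    calc r * ‖inner ℝ v u • v - inner ℝ (j v) u • j v‖ ≤ r * (2 * ‖v‖ ^ 2 * ‖u‖) := by gcongr
      _ = 2 / 3 * ‖u‖ := by simp only [r]; field_simp
  refine ⟨_, isStdCompatible_cayleyInv hj hX hn, ?_⟩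
  have h1 := cayleyInv_mul (j := j) (isUnit_one_add_of_norm_lt_one hn)
  have hXv : X v = (1 / 3 : ℝ) • v := by
    rw [hXu, hj.inner_apply_self, zero_smul, sub_zero, real_inner_self_eq_norm_sq, smul_smul]
    congr 1
    simp only [r]; field_simp
  have h2 : cayleyInv j X (v + X v) = j (v - X v) := congrArg (fun f : V →L[ℝ] V ↦ f v) h1
  rw [hXv, map_add, map_sub, map_smul, map_smul] at h2
  have h3 : (4 / 3 : ℝ) • cayleyInv j X v = (2 / 3 : ℝ) • j v := by
    calc (4 / 3 : ℝ) • cayleyInv j X v = cayleyInv j X v + (1 / 3 : ℝ) • cayleyInv j X v := by module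
      _ = _ := by rw [h2]; module
  calc cayleyInv j X v = (3 / 4 : ℝ) • ((4 / 3 : ℝ) • cayleyInv j X v) := by module
    _ = _ := by rw [h3]; module

end Compatible

end Siegel

/-! ### Positivity of the trace of the square of a symmetric endomorphism. -/

section TracePos

variable {V : Type*} [AddCommGroup V] [Module ℝ V] [FiniteDimensional ℝ V]

/-- The square of a nonzero endomorphism that is symmetric for a positive definite form has
positive trace. -/
lemma trace_comp_self_pos {B : LinearMap.BilinForm ℝ V} (hs : ∀ u v, B u v = B v u)
    (hp : ∀ u, u ≠ 0 → 0 < B u u) {P : V →ₗ[ℝ] V} (hP : ∀ u v, B (P u) v = B u (P v))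
    (h0 : P ≠ 0) : 0 < LinearMap.trace ℝ V (P ∘ₗ P) := by
  classical
  obtain ⟨b, hb⟩ := LinearMap.BilinForm.exists_orthogonal_basis (B := B) ⟨fun u v ↦ by simpa using hs u v⟩
  have hB (v : V) (i) : B v (b i) = b.repr v i * B (b i) (b i) := by
    conv_lhs => rw [← b.sum_repr v]
    simp only [map_sum, map_smul, LinearMap.sum_apply, LinearMap.smul_apply, smul_eq_mul]
    rw [Finset.sum_eq_single i]
    · intro k _ hk
      rw [show B (b k) (b i) = 0 from hb hk, mul_zero]
    · simp
  have hpos (i) : 0 < B (b i) (b i) := hp _ (b.ne_zero i)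
  -- A diagonal entry of P² is B(P²bᵢ, bᵢ)/B(bᵢ, bᵢ), and symmetry moves one factor P to the other
  -- side.
  have htr : LinearMap.trace ℝ V (P ∘ₗ P) = ∑ i, B (P (b i)) (P (b i)) / B (b i) (b i) := by
    rw [LinearMap.trace_eq_matrix_trace ℝ b, Matrix.trace]
    refine Finset.sum_congr rfl fun i _ ↦ ?_
    rw [Matrix.diag_apply, LinearMap.toMatrix_apply, eq_div_iff (hpos i).ne', ← hB,
      LinearMap.comp_apply, hP]
  have hnn (v : V) : 0 ≤ B v v := by
    by_cases hv : v = 0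
    · simp [hv]
    · exact (hp v hv).le
  rw [htr]
  obtain ⟨i, hi⟩ : ∃ i, P (b i) ≠ 0 := by
    by_contra hcon
    push Not at hcon
    exact h0 (b.ext fun i ↦ by simp [hcon i])
  exact Finset.sum_pos' (fun i _ ↦ div_nonneg (hnn _) (hpos i).le)
    ⟨i, Finset.mem_univ _, div_pos (hp _ hi) (hpos i)⟩

end TracePos

/-! ### The standard model and the real dimension n(n+1) of the fibre. -/

section Standard

/-- The conjugate linear map with symmetric matrix `f`. -/
def conjMap {n : ℕ} (f : Sym2 (Fin n) → ℂ) :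
    EuclideanSpace ℂ (Fin n) →L[ℝ] EuclideanSpace ℂ (Fin n) :=
  LinearMap.toContinuousLinearMap
    { toFun := fun v ↦ WithLp.toLp 2 fun l ↦ ∑ k, f s(k, l) * (starRingEnd ℂ) (v k)
      map_add' := fun u v ↦ by
        ext l
        simp [mul_add, Finset.sum_add_distrib]
      map_smul' := fun c v ↦ by
        ext l
        simp [Finset.mul_sum, mul_left_comm] }

lemma conjMap_apply {n : ℕ} (f : Sym2 (Fin n) → ℂ) (v : EuclideanSpace ℂ (Fin n)) (l : Fin n) :
    conjMap f v l = ∑ k, f s(k, l) * (starRingEnd ℂ) (v k) := rfl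

lemma real_inner_complex {n : ℕ} (u v : EuclideanSpace ℂ (Fin n)) :
    inner ℝ u v = (∑ l, v l * (starRingEnd ℂ) (u l)).re := by
  rw [PiLp.inner_apply, Complex.re_sum]
  refine Finset.sum_congr rfl fun l _ ↦ ?_
  simp

/-- Multiplication by `i`. -/
def mulI (n : ℕ) : EuclideanSpace ℂ (Fin n) →L[ℝ] EuclideanSpace ℂ (Fin n) :=
  Complex.I • ContinuousLinearMap.id ℝ _

lemma mulI_apply {n : ℕ} (v : EuclideanSpace ℂ (Fin n)) : mulI n v = Complex.I • v := rfl

lemma isOrthComplex_mulI (n : ℕ) : IsOrthComplex (mulI n) := by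
  refine ⟨?_, fun u v ↦ ?_⟩
  · ext v l
    simp [mulI_apply, ← mul_assoc]
  · rw [real_inner_complex, real_inner_complex, ← Complex.neg_re, ← Finset.sum_neg_distrib]
    congr 1
    refine Finset.sum_congr rfl fun l _ ↦ ?_
    simp [mulI_apply]
    ring

lemma conjMap_mem {n : ℕ} (f : Sym2 (Fin n) → ℂ) : conjMap f ∈ symAnti (mulI n) := by
  refine ⟨?_, fun u v ↦ ?_⟩
  · ext v l
    simp only [mul_apply_eq_comp, neg_apply, mulI_apply, PiLp.neg_apply, PiLp.smul_apply,
      conjMap_apply, smul_eq_mul, map_mul, Complex.conj_I, Finset.mul_sum,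
      ← Finset.sum_neg_distrib]
    refine Finset.sum_congr rfl fun k _ ↦ ?_
    ring
  · rw [real_inner_complex, real_inner_complex]
    simp only [conjMap_apply, map_sum, map_mul, Finset.mul_sum, Finset.sum_mul, Complex.conj_conj]
    rw [Finset.sum_comm, Complex.re_sum, Complex.re_sum]
    refine Finset.sum_congr rfl fun k _ ↦ ?_
    rw [Complex.re_sum, Complex.re_sum]
    refine Finset.sum_congr rfl fun l _ ↦ ?_
    rw [← Complex.conj_re, Sym2.eq_swap]
    simp only [map_mul, Complex.conj_conj]
    congr 1
    ring

/-- The matrix of a symmetric conjugate linear map. -/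
def conjMatrix {n : ℕ} (X : symAnti (mulI n)) : Sym2 (Fin n) → ℂ :=
  Sym2.lift ⟨fun k l ↦ X.1 (EuclideanSpace.single k 1) l, fun k l ↦ by
    obtain ⟨X, ha, hs⟩ := X
    have hI (v) : X (Complex.I • v) = -(Complex.I • X v) :=
      congrArg (fun f : EuclideanSpace ℂ (Fin n) →L[ℝ] EuclideanSpace ℂ (Fin n) ↦ f v) ha
    have h1 := hs (EuclideanSpace.single k 1) (EuclideanSpace.single l 1)
    -- The real inner product sees only the real parts of the entries (`h1`); multiplying the first
    -- vector by i exposes the imaginary parts.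
    have h2 := hs (Complex.I • EuclideanSpace.single k 1) (EuclideanSpace.single l 1)
    rw [hI] at h2
    simp only [real_inner_complex] at h1 h2
    refine Complex.ext ?_ ?_
    · simpa [Pi.single_apply, apply_ite] using h1
    · simpa [Pi.single_apply, apply_ite] using h2⟩

/-- Symmetric conjugate linear maps of `ℂⁿ` correspond to symmetric matrices. -/
def conjEquiv (n : ℕ) : symAnti (mulI n) ≃ₗ[ℝ] (Sym2 (Fin n) → ℂ) where
  toFun := conjMatrix
  map_add' X Y := by
    ext s
    induction s with
    | h k l => simp [conjMatrix]
  map_smul' c X := by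
    ext s
    induction s with
    | h k l => simp [conjMatrix]
  invFun f := ⟨conjMap f, conjMap_mem f⟩
  left_inv X := by
    obtain ⟨X, ha, hs⟩ := X
    have hI (v) : X (Complex.I • v) = -(Complex.I • X v) :=
      congrArg (fun f : EuclideanSpace ℂ (Fin n) →L[ℝ] EuclideanSpace ℂ (Fin n) ↦ f v) ha
    have hc (c : ℂ) (v) : X (c • v) = (starRingEnd ℂ) c • X v := by
      have : c • v = c.re • v + c.im • (Complex.I • v) := by
        conv_lhs => rw [← Complex.re_add_im c]
        rw [add_smul, mul_smul]; rfl
      rw [this, map_add, map_smul, map_smul, hI]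
      ext l
      have : (starRingEnd ℂ) c = c.re - c.im * Complex.I := by
        apply Complex.ext <;> simp
      rw [this]
      simp
      ring
    refine Subtype.ext (ContinuousLinearMap.ext fun v ↦ ?_)
    have hv : v = ∑ k, v k • EuclideanSpace.single k (1 : ℂ) := by
      ext l
      simp [Pi.single_apply]
    conv_rhs => rw [hv]
    ext l
    simp [hc, conjMap_apply, conjMatrix, mul_comm]
  right_inv f := by
    ext s
    induction s with
    | h k l => simp [conjMatrix, conjMap_apply, Pi.single_apply, apply_ite]

/-- The model is isometric to ℂⁿ with j = i, where `symAnti` consists of the conjugate linear maps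
with symmetric matrix: n(n+1)/2 complex parameters, indexed by `Sym2 (Fin n)`. -/
lemma exists_standard (n : ℕ) : ∃ j : Model n →L[ℝ] Model n, IsOrthComplex j ∧
    Module.finrank ℝ (symAnti j) = n * (n + 1) := by
  have hfr : Module.finrank ℝ (Model n) = Module.finrank ℝ (EuclideanSpace ℂ (Fin n)) := by
    rw [← Module.finrank_mul_finrank ℝ ℂ (EuclideanSpace ℂ (Fin n))]
    simp
  let U : Model n ≃ₗᵢ[ℝ] EuclideanSpace ℂ (Fin n) :=
    (stdOrthonormalBasis ℝ (Model n)).equiv (stdOrthonormalBasis ℝ (EuclideanSpace ℂ (Fin n)))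
      (finCongr hfr)
  let u : Model n →L[ℝ] EuclideanSpace ℂ (Fin n) := U.toContinuousLinearEquiv
  let w : EuclideanSpace ℂ (Fin n) →L[ℝ] Model n := U.symm.toContinuousLinearEquiv
  have hwu (v) : w (u v) = v := U.symm_apply_apply v
  have huw (v) : u (w v) = v := U.apply_symm_apply v
  have hi (a : EuclideanSpace ℂ (Fin n)) (b : Model n) : inner ℝ (w a) b = inner ℝ a (u b) := by
    rw [← U.inner_map_map (w a) b]
    exact congrArg (fun x ↦ inner ℝ x (u b)) (huw a)
  have hi' (a : EuclideanSpace ℂ (Fin n)) (b : Model n) : inner ℝ b (w a) = inner ℝ (u b) a := by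
    rw [real_inner_comm, hi, real_inner_comm]
  have hI := isOrthComplex_mulI n
  refine ⟨w ∘L mulI n ∘L u, ⟨?_, fun a b ↦ ?_⟩, ?_⟩
  · ext1 v
    simp [huw, hI.apply_apply, hwu]
  · simp [hi, hi', hI.skew]
  · let e : symAnti (w ∘L mulI n ∘L u) ≃ₗ[ℝ] symAnti (mulI n) :=
      { toFun := fun X ↦ ⟨u ∘L X.1 ∘L w, by
          obtain ⟨X, ha, hs⟩ := X
          refine ⟨?_, fun a b ↦ ?_⟩
          · ext1 v
            have := congrArg (fun f : Model n →L[ℝ] Model n ↦ u (f (w v))) ha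
            simpa [huw, hwu] using this
          · simp only [ContinuousLinearMap.comp_apply]
            rw [← hi', hs, hi]⟩
        map_add' := fun X Y ↦ by ext1; ext1 v; simp
        map_smul' := fun c X ↦ by ext1; ext1 v; simp
        invFun := fun X ↦ ⟨w ∘L X.1 ∘L u, by
          obtain ⟨X, ha, hs⟩ := X
          refine ⟨?_, fun a b ↦ ?_⟩
          · ext1 v
            have := congrArg (fun f : EuclideanSpace ℂ (Fin n) →L[ℝ] EuclideanSpace ℂ (Fin n) ↦
              w (f (u v))) ha
            simpa [huw, hwu] using this
          · simp only [ContinuousLinearMap.comp_apply]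
            rw [hi', ← hs, ← hi]⟩
        left_inv := fun X ↦ by ext1; ext1 v; simp [hwu]
        right_inv := fun X ↦ by ext1; ext1 v; simp [huw] }
    rw [(e.trans (conjEquiv n)).finrank_eq, Module.finrank_pi_fintype]
    simp [Sym2.card, Nat.choose_two_right]
    have := Nat.div_mul_cancel (Nat.even_mul_succ_self n).two_dvd
    rw [mul_comm n]
    rw [mul_comm n] at this
    omega

end Standard

/-! ### Local symplectic frames. -/

section Frame

/-- A square root near the identity. -/
lemma exists_local_sqrt (V : Type*) [NormedAddCommGroup V] [InnerProductSpace ℝ V]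
    [FiniteDimensional ℝ V] : ∃ (r : (V →L[ℝ] V) → (V →L[ℝ] V)) (S : Set (V →L[ℝ] V)),
      IsOpen S ∧ 1 ∈ S ∧ r 1 = 1 ∧ (∀ᶠ B in 𝓝 1, r B * r B = B) ∧
      (∀ᶠ B in 𝓝 1, ContDiffAt ℝ ∞ r B) ∧ ∀ A ∈ S, ∀ A' ∈ S, A * A = A' * A' → A = A' := by
  let f : (V →L[ℝ] V) → (V →L[ℝ] V) := fun A ↦ A * A
  have hf : ContDiff ℝ ω f := by
    have : f = fun A ↦ A.comp A := rfl
    rw [this]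
    fun_prop
  -- The derivative of A ↦ A² at 1 is A ↦ 2A, so the inverse function theorem applies.
  let e : (V →L[ℝ] V) ≃L[ℝ] (V →L[ℝ] V) :=
    ContinuousLinearEquiv.smulLeft (Units.mk0 (2 : ℝ) two_ne_zero)
  have hd : HasFDerivAt f (e : (V →L[ℝ] V) →L[ℝ] (V →L[ℝ] V)) 1 := by
    have h := (hasFDerivAt_id (𝕜 := ℝ) (1 : V →L[ℝ] V)).clm_comp (hasFDerivAt_id (1 : V →L[ℝ] V))
    refine h.congr_fderiv ?_
    refine ContinuousLinearMap.ext fun A ↦ ContinuousLinearMap.ext fun v ↦ ?_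
    change A v + A v = (2 : ℝ) • A v
    rw [two_smul]
  have hfa : ContDiffAt ℝ ω f 1 := hf.contDiffAt
  let H := hfa.toOpenPartialHomeomorph f hd (by simp)
  have hH1 : (1 : V →L[ℝ] V) ∈ H.source := hfa.mem_toOpenPartialHomeomorph_source hd (by simp)
  have hf1 : f 1 = 1 := one_mul 1
  have hHf : ∀ A, H A = A * A := fun A ↦ rfl
  have hT : (1 : V →L[ℝ] V) ∈ H.target := by
    have := H.map_source hH1
    rwa [hHf, one_mul] at this
  refine ⟨H.symm, H.source, H.open_source, hH1, ?_, ?_, ?_, ?_⟩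
  · have := H.left_inv hH1
    rwa [hHf, one_mul] at this
  · filter_upwards [H.open_target.mem_nhds hT] with B hB
    rw [← hHf, H.right_inv hB]
  -- Analyticity is used because `ContDiffAt ℝ ω` at a point spreads to a neighbourhood, whereas
  -- order ∞ at a point gives only finite orders on neighbourhoods that may shrink.
  · have h1 : ContDiffAt ℝ ω H.symm 1 := by
      have := hfa.to_localInverse hd (by simp)
      rwa [hf1] at this
    filter_upwards [h1.eventually (by simp)] with B hB
    exact hB.of_le le_top
  · intro A hA A' hA' h
    exact H.injOn hA hA' h

/-- Local symplectic frames of a field of symplectic forms. -/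
lemma exists_symplectic_frame {n : ℕ} {j : Model n →L[ℝ] Model n} (hj : IsOrthComplex j)
    {U : Set (Model n)} (hU : IsOpen U) {w : Model n → Model n →L[ℝ] Model n →L[ℝ] ℝ}
    (hw : ContDiffOn ℝ ∞ w U) (halt : ∀ y ∈ U, ∀ u, w y u u = 0)
    (hnd : ∀ y ∈ U, ∀ u, (∀ v, w y u v = 0) → u = 0) {y₀ : Model n} (hy₀ : y₀ ∈ U) :
    ∃ (T : Set (Model n)) (g : Model n → Model n →L[ℝ] Model n), IsOpen T ∧ y₀ ∈ T ∧ T ⊆ U ∧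
      ContDiffOn ℝ ∞ g T ∧ ∀ y ∈ T, IsUnit (g y) ∧ ∀ u v, w y u v = inner ℝ (j (g y u)) (g y v) := by
  obtain ⟨r, S, hS, h1S, hr1, hrr, hrs, hinj⟩ := exists_local_sqrt (Model n)
  have hfin : Module.finrank ℝ (Model n) = 2 * n := by simp
  let bil (B : Model n →L[ℝ] Model n →L[ℝ] ℝ) : Model n →ₗ[ℝ] Model n →ₗ[ℝ] ℝ :=
    ContinuousLinearMap.coeLM ℝ ∘ₗ B.toLinearMap
  let w' : Model n →L[ℝ] Model n →L[ℝ] ℝ := (innerSL ℝ).comp j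
  have hw' (u v) : w' u v = inner ℝ (j u) v := rfl
  obtain ⟨L₀, hL₀⟩ := exists_symplectic_equiv (ϖ := bil (w y₀)) (ϖ' := bil w') hfin hfin
    (fun u ↦ halt y₀ hy₀ u) (hnd y₀ hy₀) (fun u ↦ hj.inner_apply_self u)
    (fun u hu ↦ by
      have h1 : w' u (j u) = 0 := hu (j u)
      rw [hw', real_inner_self_eq_norm_sq, hj.norm_apply] at h1
      simpa using h1)
  let L := L₀.toContinuousLinearEquiv
  have hL (u v) : inner ℝ (j (L u)) (L v) = w y₀ u v := hL₀ u v
  let sharp : (Model n →L[ℝ] ℝ) →L[ℝ] Model n := LinearMap.toContinuousLinearMap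
    { toFun := (InnerProductSpace.toDual ℝ (Model n)).symm
      map_add' := fun a b ↦ map_add _ a b
      map_smul' := fun c a ↦ by simp }
  have hsharp (l : Model n →L[ℝ] ℝ) (v) : inner ℝ (sharp l) v = l v :=
    InnerProductSpace.toDual_symm_apply
  let Li : Model n →L[ℝ] Model n := L.symm
  -- B y represents the form w y, transported by L, relative to the standard symplectic form ⟪j·,
  -- ·⟫; in particular B y₀ = 1.
  let B : Model n → Model n →L[ℝ] Model n := fun y ↦
    -(j ∘L sharp ∘L ((ContinuousLinearMap.precomp ℝ Li) ∘L (w y) ∘L Li))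
  have hB (y u v) : inner ℝ (j (B y u)) v = w y (Li u) (Li v) := by
    simp only [B, neg_apply, ContinuousLinearMap.comp_apply, map_neg, hj.apply_apply, neg_neg,
      hsharp]
    rfl
  have hnon (a b : Model n) (h : ∀ v, inner ℝ (j a) v = inner ℝ (j b) v) : a = b := by
    have h1 : j a = j b := ext_inner_right ℝ h
    have := congrArg j h1
    rw [hj.apply_apply, hj.apply_apply] at this
    exact neg_injective this
  have hB0 : B y₀ = 1 := by
    ext1 u
    refine hnon _ _ fun v ↦ ?_
    rw [hB, ← hL]
    simp [Li]
  have hBs : ContDiffOn ℝ ∞ B U := by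
    simp only [B]
    fun_prop
  -- The adjoint with respect to ⟪j·, ·⟫. That w y is alternating means that B y is self-adjoint for
  -- θ.
  let θ : (Model n →L[ℝ] Model n) → (Model n →L[ℝ] Model n) := fun A ↦
    -(j * ContinuousLinearMap.adjoint A * j)
  have hθ (A : Model n →L[ℝ] Model n) (u v) : inner ℝ (j (A u)) v = inner ℝ (j u) (θ A v) := by
    simp only [θ, neg_apply, mul_apply_eq_comp, inner_neg_right, hj.inner_apply_apply,
      ContinuousLinearMap.adjoint_inner_right, hj.skew (A u)]
  have hθc : Continuous θ := by
    simp only [θ]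
    fun_prop
  have hθu (A A' : Model n →L[ℝ] Model n)
      (h : ∀ u v, inner ℝ (j (A u)) v = inner ℝ (j u) (A' v)) : θ A = A' := by
    ext1 v
    refine ext_inner_left ℝ fun u ↦ ?_
    have h2 := h (j u) v
    rw [hθ, hj.apply_apply, inner_neg_left, inner_neg_left] at h2
    exact neg_injective h2
  have hθ1 : θ 1 = 1 := hθu _ _ fun u v ↦ rfl
  have hθsq (A) : θ A * θ A = θ (A * A) := by
    refine (hθu _ _ fun u v ↦ ?_).symm
    simp only [mul_apply_eq_comp]
    rw [hθ, hθ]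
  have hBU (y) (hy : y ∈ U) : θ (B y) = B y := by
    refine hθu _ _ fun u v ↦ ?_
    rw [hB, hj.skew u, real_inner_comm, hB]
    have h1 := halt y hy (Li u + Li v)
    simp only [map_add, add_apply, halt y hy] at h1
    linarith
  have hBt : Filter.Tendsto B (𝓝 y₀) (𝓝 1) := by
    rw [← hB0]
    exact (hBs.continuousOn.continuousAt (hU.mem_nhds hy₀)).tendsto
  have hrc : ContinuousAt r 1 := hrs.self_of_nhds.continuousAt
  have hrB : Filter.Tendsto (fun y ↦ r (B y)) (𝓝 y₀) (𝓝 1) := by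
    have := hrc.tendsto.comp hBt
    rwa [hr1] at this
  have hθB : Filter.Tendsto (fun y ↦ θ (r (B y))) (𝓝 y₀) (𝓝 1) := by
    have := (hθc.tendsto 1).comp hrB
    rwa [hθ1] at this
  have hev : ∀ᶠ y in 𝓝 y₀, y ∈ U ∧ r (B y) * r (B y) = B y ∧ ContDiffAt ℝ ∞ r (B y) ∧
      r (B y) ∈ S ∧ θ (r (B y)) ∈ S := by
    filter_upwards [hU.mem_nhds hy₀, hBt.eventually hrr, hBt.eventually hrs,
      hrB.eventually (hS.mem_nhds h1S), hθB.eventually (hS.mem_nhds h1S)] with y h1 h2 h3 h4 h5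
    exact ⟨h1, h2, h3, h4, h5⟩
  obtain ⟨T, hT, hTo, hyT⟩ := eventually_nhds_iff.1 hev
  have key (y) (hy : y ∈ T) (u v) :
      w y u v = inner ℝ (j (r (B y) (L u))) (r (B y) (L v)) := by
    obtain ⟨h1, h2, h3, h4, h5⟩ := hT y hy
    -- Both sides are square roots of B y close to 1, where square roots are unique. Hence ⟪j r²a,
    -- b⟫ = ⟪j ra, rb⟫ for r = r(B y), which makes r(B y) ∘ L a symplectic frame.
    have h6 : θ (r (B y)) = r (B y) := by
      refine hinj _ h5 _ h4 ?_
      rw [hθsq, h2, hBU y h1]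
    have h7 := hB y (L u) (L v)
    rw [← h2, mul_apply_eq_comp, hθ, h6] at h7
    simpa [Li] using h7.symm
  refine ⟨T, fun y ↦ r (B y) ∘L (L : Model n →L[ℝ] Model n), hTo, hyT, fun y hy ↦ (hT y hy).1, ?_,
    fun y hy ↦ ⟨?_, key y hy⟩⟩
  · intro y hy
    obtain ⟨h1, h2, h3, h4, h5⟩ := hT y hy
    have h8 : ContDiffAt ℝ ∞ (fun y ↦ r (B y)) y :=
      h3.comp y (hBs.contDiffAt (hU.mem_nhds h1))
    exact (h8.clm_comp contDiffAt_const).contDiffWithinAt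
  · refine isUnit_of_injective fun u hu ↦ hnd y (hT y hy).1 u fun v ↦ ?_
    have hu' : r (B y) (L u) = 0 := hu
    rw [key y hy, hu', map_zero, inner_zero_left]

end Frame

/-! ### Parallel frames of a flat connection form. -/

section Frobenius

variable {𝔸 : Type*} [NormedRing 𝔸] [NormedAlgebra ℝ 𝔸] [CompleteSpace 𝔸]

-- Picard–Lindelöf on the ball of radius 1 about 1: there the velocity is at most (‖1‖ + 1)κ ≤ 1, so
-- the solution does not leave the ball before time 1.
open Set in
lemma exists_linear_ode_solution {a : ℝ → 𝔸} (ha : ContinuousOn a (Icc 0 1)) {κ : ℝ} (h0 : 0 ≤ κ)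
    (hκ : ∀ s ∈ Icc (0 : ℝ) 1, ‖a s‖ ≤ κ) (hκ1 : κ * (‖(1 : 𝔸)‖ + 1) ≤ 1) :
    ∃ f : ℝ → 𝔸, f 0 = 1 ∧ ∀ t ∈ Icc (0 : ℝ) 1, HasDerivWithinAt f (f t * a t) (Icc 0 1) t := by
  have h : IsPicardLindelof (fun s f ↦ f * a s) (⟨0, by simp⟩ : Icc (0 : ℝ) 1) (1 : 𝔸) 1 0 1
      ⟨κ, h0⟩ := by
    refine ⟨fun t ht ↦ ?_, fun x _ ↦ continuousOn_const.mul ha, fun t ht x hx ↦ ?_, by simp⟩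
    · refine LipschitzOnWith.of_dist_le_mul fun x _ y _ ↦ ?_
      rw [dist_eq_norm, dist_eq_norm, ← sub_mul, mul_comm]
      exact (norm_mul_le _ _).trans (by gcongr; exact hκ t ht)
    · have hx' : ‖x‖ ≤ ‖(1 : 𝔸)‖ + 1 := by
        have h1 : ‖x - 1‖ ≤ 1 := by simpa [dist_eq_norm] using hx
        calc ‖x‖ = ‖(x - 1) + 1‖ := by rw [sub_add_cancel]
          _ ≤ _ := (norm_add_le _ _).trans (by linarith)
      calc ‖x * a t‖ ≤ ‖x‖ * ‖a t‖ := norm_mul_le _ _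
        _ ≤ (‖(1 : 𝔸)‖ + 1) * κ := by gcongr; exact hκ t ht
        _ ≤ 1 := by rw [mul_comm]; exact hκ1
  exact h.exists_eq_forall_mem_Icc_hasDerivWithinAt₀

lemma eventually_norm_lt {X G : Type*} [TopologicalSpace X] [SeminormedAddCommGroup G] {f : X → G}
    {x : X} (hf : ContinuousAt f x) : ∀ᶠ p in 𝓝 x, ‖f p‖ < ‖f x‖ + 1 :=
  hf.norm.eventually_lt continuousAt_const (lt_add_one _)

variable {E : Type*} [NormedAddCommGroup E] [NormedSpace ℝ E]

open Set in
set_option maxHeartbeats 1000000 in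
set_option synthInstance.maxHeartbeats 200000 in
/-- A flat connection form has a local parallel frame. -/
lemma exists_parallel_frame {A : E → E →L[ℝ] 𝔸} {U : Set E} (hU : IsOpen U)
    (hA : ContDiffOn ℝ ∞ A U) {x₀ : E} (hx₀ : x₀ ∈ U)
    (hflat : ∀ y ∈ U, ∀ u v, fderiv ℝ A y u v - fderiv ℝ A y v u + A y u * A y v - A y v * A y u = 0) :
    ∃ r > 0, ∃ F : E → 𝔸, Metric.ball x₀ r ⊆ U ∧ F x₀ = 1 ∧ ∀ p ∈ Metric.ball x₀ r,
      HasFDerivAt F ((ContinuousLinearMap.mul ℝ 𝔸 (F p)) ∘L A p) p := by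
  have hAx : ContDiffAt ℝ ∞ A x₀ := hA.contDiffAt (hU.mem_nhds hx₀)
  have hdA : ContDiffOn ℝ ∞ (fderiv ℝ A) U := hA.fderiv_of_isOpen hU (by simp)
  have hdAx : ContDiffAt ℝ ∞ (fderiv ℝ A) x₀ := hdA.contDiffAt (hU.mem_nhds hx₀)
  obtain ⟨C₂, t, ht, hLip⟩ := (hdAx.of_le (m := 1) (by simp)).exists_lipschitzOnWith
  set C₀ := ‖A x₀‖ + 1
  set C₁ := ‖fderiv ℝ A x₀‖ + 1
  have hC₀ : 0 < C₀ := by positivity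
  have hC₁ : 0 < C₁ := by positivity
  have hev : ∀ᶠ p in 𝓝 x₀, p ∈ U ∧ p ∈ t ∧ ‖A p‖ < C₀ ∧ ‖fderiv ℝ A p‖ < C₁ := by
    filter_upwards [hU.mem_nhds hx₀, ht, eventually_norm_lt (f := A) hAx.continuousAt,
      eventually_norm_lt (f := fderiv ℝ A) hdAx.continuousAt] with p h1 h2 h3 h4 using ⟨h1, h2, h3, h4⟩
  obtain ⟨r₀, hr₀, hball⟩ := Metric.eventually_nhds_iff_ball.1 hev
  -- The bound 1 controls ‖p - x₀‖, and the last bound makes κ = C₀ r admissible in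
  -- `exists_linear_ode_solution`.
  set r := min r₀ (min 1 (C₀ * (‖(1 : 𝔸)‖ + 1))⁻¹)
  have hr : 0 < r := by positivity
  have hr1 : r ≤ 1 := (min_le_right _ _).trans (min_le_left _ _)
  have hrr : r ≤ r₀ := min_le_left _ _
  have hrC : C₀ * r * (‖(1 : 𝔸)‖ + 1) ≤ 1 := by
    have h1 : r ≤ (C₀ * (‖(1 : 𝔸)‖ + 1))⁻¹ := (min_le_right _ _).trans (min_le_right _ _)
    have h2 : 0 < C₀ * (‖(1 : 𝔸)‖ + 1) := by positivity
    calc C₀ * r * (‖(1 : 𝔸)‖ + 1) = C₀ * (‖(1 : 𝔸)‖ + 1) * r := by ring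
      _ ≤ C₀ * (‖(1 : 𝔸)‖ + 1) * (C₀ * (‖(1 : 𝔸)‖ + 1))⁻¹ := by gcongr
      _ = 1 := mul_inv_cancel₀ h2.ne'
  have hb (p) (hp : p ∈ Metric.ball x₀ r) : p ∈ U ∧ p ∈ t ∧ ‖A p‖ < C₀ ∧ ‖fderiv ℝ A p‖ < C₁ :=
    hball p (Metric.ball_subset_ball hrr hp)
  have hseg (p) (hp : p ∈ Metric.ball x₀ r) (s : ℝ) (hs : s ∈ Icc (0 : ℝ) 1) :
      x₀ + s • (p - x₀) ∈ Metric.ball x₀ r := by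
    have := (convex_ball x₀ r).add_smul_sub_mem (Metric.mem_ball_self hr) hp hs
    exact this
  have hpn (p) (hp : p ∈ Metric.ball x₀ r) : ‖p - x₀‖ ≤ r := by
    rw [← dist_eq_norm]; exact (Metric.mem_ball.1 hp).le
  have hAc (p) (hp : p ∈ Metric.ball x₀ r) :
      ContinuousOn (fun s : ℝ ↦ A (x₀ + s • (p - x₀)) (p - x₀)) (Icc 0 1) := by
    have h1 : ContinuousOn (fun s : ℝ ↦ A (x₀ + s • (p - x₀))) (Icc 0 1) :=
      hA.continuousOn.comp (by fun_prop) fun s hs ↦ (hb _ (hseg p hp s hs)).1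
    exact h1.clm_apply continuousOn_const
  -- Parallel transport along the ray from x₀ to p; the frame at p is its value at time 1.
  have hex (p) (hp : p ∈ Metric.ball x₀ r) : ∃ f : ℝ → 𝔸, f 0 = 1 ∧ ∀ s ∈ Icc (0 : ℝ) 1,
      HasDerivWithinAt f (f s * A (x₀ + s • (p - x₀)) (p - x₀)) (Icc 0 1) s := by
    refine exists_linear_ode_solution (hAc p hp) (κ := C₀ * r) (by positivity) (fun s hs ↦ ?_) hrC
    refine ((A _).le_opNorm _).trans ?_
    gcongr
    · exact (hb _ (hseg p hp s hs)).2.2.1.le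
    · exact hpn p hp
  choose! f hf0 hf using hex
  have hfr (p) (hp : p ∈ Metric.ball x₀ r) (s) (hs : s ∈ Ico (0 : ℝ) 1) :
      HasDerivWithinAt (f p) (f p s * A (x₀ + s • (p - x₀)) (p - x₀)) (Ici s) s :=
    (hf p hp s (Ico_subset_Icc_self hs)).mono_of_mem_nhdsWithin (Icc_mem_nhdsGE_of_mem hs)
  have hfc (p) (hp : p ∈ Metric.ball x₀ r) : ContinuousOn (f p) (Icc 0 1) :=
    fun s hs ↦ (hf p hp s hs).continuousWithinAt
  refine ⟨r, hr, fun p ↦ f p 1, fun p hp ↦ (hb p hp).1, ?_, fun p hp ↦ ?_⟩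
  · have hx := Metric.mem_ball_self (x := x₀) hr
    have := constant_of_has_deriv_right_zero (hfc x₀ hx) (fun s hs ↦ by simpa using hfr x₀ hx s hs)
      1 (by simp)
    exact this.trans (hf0 x₀ hx)
  obtain ⟨N, hN⟩ := isCompact_Icc.exists_bound_of_continuousOn (hfc p hp)
  have hN0 : 0 ≤ N := (norm_nonneg _).trans (hN 0 (by simp))
  set y := p - x₀ with hy
  have hyn : ‖y‖ ≤ 1 := (hpn p hp).trans hr1
  set D := C₁ + C₂ * 2 + C₀ * (C₀ + C₁ * 2 + C₂ * 2)
  have hD : 0 ≤ D := by positivity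
  let K : NNReal := ⟨C₀ * 2, by positivity⟩
  have hK : (K : ℝ) ≠ 0 := by
    change C₀ * 2 ≠ 0
    positivity
  -- In place of smooth dependence on parameters: transport along the ray to p + h is compared with
  -- an explicit approximate solution, and Grönwall's inequality turns a defect of order ‖h‖² into
  -- differentiability at p.
  have main : ∀ᶠ h in 𝓝 (0 : E), ‖f (p + h) 1 - f p 1 - f p 1 * A p h‖ ≤
      N * D / K * (Real.exp (K * 1) - 1) * ‖‖h‖ ^ 2‖ := by
    have h1 : ∀ᶠ h in 𝓝 (0 : E), p + h ∈ Metric.ball x₀ r := by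
      have : ContinuousAt (fun h : E ↦ p + h) 0 := by fun_prop
      exact this.eventually (Metric.isOpen_ball.mem_nhds (by simpa using hp))
    have h2 : ∀ᶠ h in 𝓝 (0 : E), ‖h‖ < 1 := by
      have : ContinuousAt (fun h : E ↦ ‖h‖) 0 := by fun_prop
      exact this.eventually_lt continuousAt_const (by simp)
    filter_upwards [h1, h2] with h hh hh1
    have hyh : p + h - x₀ = y + h := by rw [hy]; abel
    -- Transport along the ray to p, corrected to first order by the connection form applied to the
    -- displacement s h between the two rays at time s.
    let g : ℝ → 𝔸 := fun s ↦ f p s * (1 + s • A (x₀ + s • y) h)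
    let g' : ℝ → 𝔸 := fun s ↦ f p s * A (x₀ + s • y) y * (1 + s • A (x₀ + s • y) h) +
      f p s * (A (x₀ + s • y) h + s • fderiv ℝ A (x₀ + s • y) y h)
    have hAd (s : ℝ) (hs : s ∈ Icc (0 : ℝ) 1) : HasFDerivAt A (fderiv ℝ A (x₀ + s • y)) (x₀ + s • y) :=
      ((hA.contDiffAt (hU.mem_nhds (hb _ (hseg p hp s hs)).1)).differentiableAt
        (by simp)).hasFDerivAt
    have hg (s) (hs : s ∈ Icc (0 : ℝ) 1) : HasDerivWithinAt g (g' s) (Icc 0 1) s := by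
      have e1 : HasDerivAt (fun s : ℝ ↦ x₀ + s • y) y s := by
        simpa using ((hasDerivAt_id s).smul_const y).const_add x₀
      have e2 : HasDerivAt (fun s : ℝ ↦ A (x₀ + s • y)) (fderiv ℝ A (x₀ + s • y) y) s :=
        (hAd s hs).comp_hasDerivAt s e1
      have e3 : HasDerivAt (fun s : ℝ ↦ A (x₀ + s • y) h) (fderiv ℝ A (x₀ + s • y) y h) s := by
        simpa using e2.clm_apply (hasDerivAt_const s h)
      have e4 := ((hasDerivAt_id s).smul e3).const_add (1 : 𝔸)
      have e5 := (hf p hp s hs).mul e4.hasDerivWithinAt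
      refine e5.congr_deriv ?_
      simp only [g', id_eq, one_smul]
      rw [add_comm (s • _)]
      rfl
    have hv (s) (hs : s ∈ Ico (0 : ℝ) 1) : LipschitzOnWith K
        (fun z : 𝔸 ↦ z * A (x₀ + s • (p + h - x₀)) (p + h - x₀)) univ := by
      refine LipschitzOnWith.of_dist_le_mul fun z _ w _ ↦ ?_
      rw [dist_eq_norm, dist_eq_norm, ← sub_mul, mul_comm]
      refine (norm_mul_le _ _).trans ?_
      gcongr
      refine ((A _).le_opNorm _).trans ?_
      have := (hb _ (hseg _ hh s (Ico_subset_Icc_self hs))).2.2.1.le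
      change _ ≤ C₀ * 2
      gcongr
      exact (hpn _ hh).trans (by linarith)
    have hgerr (s) (hs : s ∈ Ico (0 : ℝ) 1) :
        dist (g' s) (g s * A (x₀ + s • (p + h - x₀)) (p + h - x₀)) ≤ N * D * ‖h‖ ^ 2 := by
      have hs' := Ico_subset_Icc_self hs
      have hs0 : ‖s‖ ≤ 1 := by rw [Real.norm_of_nonneg hs'.1]; exact hs'.2
      set q := x₀ + s • y with hq
      have hqb : q ∈ Metric.ball x₀ r := hseg p hp s hs'
      set q' := x₀ + s • (p + h - x₀) with hq'
      have hqb' : q' ∈ Metric.ball x₀ r := hseg _ hh s hs'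
      have hqq : q' - q = s • h := by rw [hq, hq', hyh, smul_add]; abel
      -- The first order Taylor remainder of A, quadratic in h because the derivative of A is
      -- Lipschitz with constant C₂.
      set ρ := A q' - A q - fderiv ℝ A q (q' - q) with hρ
      have hρn : ‖ρ‖ ≤ C₂ * ‖h‖ ^ 2 := by
        have hsub : segment ℝ q q' ⊆ Metric.ball x₀ r := (convex_ball x₀ r).segment_subset hqb hqb'
        have := (convex_segment (𝕜 := ℝ) q q').norm_image_sub_le_of_norm_hasFDerivWithin_le'
          (f := A) (f' := fderiv ℝ A) (φ := fderiv ℝ A q) (C := C₂ * ‖h‖)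
          (fun z hz ↦ ((hA.contDiffAt (hU.mem_nhds (hb _ (hsub hz)).1)).differentiableAt
            (by simp)).hasFDerivAt.hasFDerivWithinAt)
          (fun z hz ↦ by
            rw [← dist_eq_norm]
            refine (hLip.dist_le_mul z (hb _ (hsub hz)).2.1 q (hb _ hqb).2.1).trans ?_
            gcongr
            have h3 : dist z q ≤ dist q' q := by
              rw [dist_comm z, dist_comm q', dist_eq_norm, dist_eq_norm, norm_sub_rev, norm_sub_rev q]
              obtain ⟨a, b, ha, hb, hab, rfl⟩ := hz
              have : a • q + b • q' - q = b • (q' - q) := by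
                rw [show a = 1 - b by linarith]; module
              rw [this, norm_smul, Real.norm_of_nonneg hb]
              exact mul_le_of_le_one_left (norm_nonneg _) (by linarith)
            refine h3.trans ?_
            rw [dist_eq_norm, hqq, norm_smul]
            exact mul_le_of_le_one_left (norm_nonneg _) hs0)
          (left_mem_segment ℝ q q') (right_mem_segment ℝ q q')
        refine this.trans ?_
        rw [hqq, norm_smul]
        calc C₂ * ‖h‖ * (‖s‖ * ‖h‖) ≤ C₂ * ‖h‖ * (1 * ‖h‖) := by gcongr
          _ = _ := by ring
      have hA' (w : E) : A q' w = A q w + s • fderiv ℝ A q h w + ρ w := by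
        rw [hρ, hqq]
        simp
      have hfl := hflat q (hb q hqb).1 h y
      -- The terms linear in h cancel exactly by flatness (`h7`); all that remain are quadratic.
      have expand : g s * A q' (p + h - x₀) - g' s = f p s * (s • fderiv ℝ A q h h + ρ (y + h) +
          s • (A q h * (A q h + s • fderiv ℝ A q h (y + h) + ρ (y + h)))) := by
        simp only [g, g', hyh, hA', ← hq, map_add]
        have h7 : A q h * A q y = A q y * A q h - fderiv ℝ A q h y + fderiv ℝ A q y h := by
          rw [← sub_eq_zero, ← hfl]; abel
        simp only [mul_add, add_mul, mul_one, mul_assoc, smul_mul_assoc, mul_smul_comm, smul_add,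
          smul_smul, h7, mul_sub, smul_sub]
        abel
      rw [dist_comm, dist_eq_norm, expand]
      have b1 : ‖fderiv ℝ A q h h‖ ≤ C₁ * ‖h‖ * ‖h‖ :=
        (ContinuousLinearMap.le_opNorm₂ _ _ _).trans (by gcongr; exact (hb q hqb).2.2.2.le)
      have hyh2 : ‖y + h‖ ≤ 2 := (norm_add_le _ _).trans (by linarith)
      have b2 : ‖ρ (y + h)‖ ≤ C₂ * ‖h‖ ^ 2 * 2 :=
        (ρ.le_opNorm _).trans (by gcongr)
      have b3 : ‖A q h‖ ≤ C₀ * ‖h‖ :=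
        ((A q).le_opNorm _).trans (by gcongr; exact (hb q hqb).2.2.1.le)
      have b4 : ‖fderiv ℝ A q h (y + h)‖ ≤ C₁ * ‖h‖ * 2 :=
        (ContinuousLinearMap.le_opNorm₂ _ _ _).trans (by gcongr; exact (hb q hqb).2.2.2.le)
      have sm (z : 𝔸) : ‖s • z‖ ≤ ‖z‖ := by
        rw [norm_smul]; exact mul_le_of_le_one_left (norm_nonneg _) hs0
      have b5 : ‖A q h + s • fderiv ℝ A q h (y + h) + ρ (y + h)‖ ≤
          (C₀ + C₁ * 2 + C₂ * 2) * ‖h‖ := by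
        refine (norm_add₃_le).trans ?_
        have := sm (fderiv ℝ A q h (y + h))
        have h9 : (C₂ : ℝ) * ‖h‖ ^ 2 * 2 ≤ C₂ * 2 * ‖h‖ := by
          have : ‖h‖ ^ 2 ≤ ‖h‖ := by
            rw [sq]; exact mul_le_of_le_one_left (norm_nonneg _) hh1.le
          calc (C₂ : ℝ) * ‖h‖ ^ 2 * 2 ≤ C₂ * ‖h‖ * 2 := by gcongr
            _ = _ := by ring
        linarith
      have b6 : ‖s • fderiv ℝ A q h h + ρ (y + h) +
          s • (A q h * (A q h + s • fderiv ℝ A q h (y + h) + ρ (y + h)))‖ ≤ D * ‖h‖ ^ 2 := by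
        refine (norm_add₃_le).trans ?_
        have c1 := sm (fderiv ℝ A q h h)
        have c2 := sm (A q h * (A q h + s • fderiv ℝ A q h (y + h) + ρ (y + h)))
        have c3 : ‖A q h * (A q h + s • fderiv ℝ A q h (y + h) + ρ (y + h))‖ ≤
            (C₀ * ‖h‖) * ((C₀ + C₁ * 2 + C₂ * 2) * ‖h‖) :=
          (norm_mul_le _ _).trans (by gcongr)
        have c4 : D * ‖h‖ ^ 2 = C₁ * ‖h‖ * ‖h‖ + C₂ * ‖h‖ ^ 2 * 2 +
            (C₀ * ‖h‖) * ((C₀ + C₁ * 2 + C₂ * 2) * ‖h‖) := by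
          simp only [D]; ring
        linarith
      calc _ ≤ ‖f p s‖ * _ := norm_mul_le _ _
        _ ≤ N * (D * ‖h‖ ^ 2) := by gcongr; exact hN s hs'
        _ = _ := by ring
    have hgr := dist_le_of_approx_trajectories_ODE_of_mem (s := fun _ ↦ univ) (εf := 0) (δ := 0)
      hv (hfc _ hh) (fun s hs ↦ hfr _ hh s hs) (fun s hs ↦ (dist_self _).le) (fun _ _ ↦ trivial)
      (fun s hs ↦ (hg s hs).continuousWithinAt)
      (fun s hs ↦ (hg s (Ico_subset_Icc_self hs)).mono_of_mem_nhdsWithin (Icc_mem_nhdsGE_of_mem hs))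
      hgerr (fun _ _ ↦ trivial) (by simp [g, hf0 _ hh, hf0 p hp]) 1 (by simp)
    rw [gronwallBound_of_K_ne_0 hK, dist_eq_norm] at hgr
    have hg1 : g 1 = f p 1 + f p 1 * A p h := by
      simp only [g, one_smul, mul_add, mul_one, hy, add_sub_cancel]
    rw [hg1] at hgr
    rw [sub_sub]
    refine hgr.trans (le_of_eq ?_)
    rw [Real.norm_of_nonneg (by positivity)]
    simp only [zero_add, sub_zero, zero_mul]
    ring
  rw [hasFDerivAt_iff_isLittleO_nhds_zero]
  refine (Asymptotics.IsBigO.of_bound _ main).trans_isLittleO ?_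
  exact (Asymptotics.isLittleO_norm_pow_id one_lt_two)

end Frobenius

/-! ### Affine coordinates of a flat torsion free connection. -/

section Affine

variable {E : Type*} [NormedAddCommGroup E] [NormedSpace ℝ E]

/-- The bootstrap step: applied to dF = F A it raises the regularity of F one order at a time, and
applied to dψ = F it passes from F to ψ. -/
lemma contDiffOn_of_hasFDerivAt {G : Type*} [NormedAddCommGroup G] [NormedSpace ℝ G] {U : Set E}
    (hU : IsOpen U) {f : E → G} {f' : E → E →L[ℝ] G} (hf : ∀ p ∈ U, HasFDerivAt f (f' p) p) {n : ℕ}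
    (hf' : ContDiffOn ℝ n f' U) : ContDiffOn ℝ (n + 1 : ℕ) f U := by
  rw [Nat.cast_add, Nat.cast_one, contDiffOn_succ_iff_fderiv_of_isOpen hU]
  refine ⟨fun p hp ↦ (hf p hp).differentiableAt.differentiableWithinAt, by simp, ?_⟩
  exact hf'.congr fun p hp ↦ (hf p hp).fderiv

set_option synthInstance.maxHeartbeats 200000 in
/-- Affine coordinates of a flat torsion free connection. -/
lemma exists_affine_coordinates [CompleteSpace E] {A : E → E →L[ℝ] E →L[ℝ] E} {U : Set E}
    (hU : IsOpen U) (hA : ContDiffOn ℝ ∞ A U) {x₀ : E} (hx₀ : x₀ ∈ U)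
    (hsymm : ∀ y ∈ U, ∀ u v, A y u v = A y v u)
    (hflat : ∀ y ∈ U, ∀ u v, fderiv ℝ A y u v - fderiv ℝ A y v u + A y u * A y v - A y v * A y u = 0) :
    ∃ r > 0, ∃ (F : E → E →L[ℝ] E) (ψ : E → E), Metric.ball x₀ r ⊆ U ∧ F x₀ = 1 ∧
      ContDiffOn ℝ ∞ F (Metric.ball x₀ r) ∧ ContDiffOn ℝ ∞ ψ (Metric.ball x₀ r) ∧
      (∀ p ∈ Metric.ball x₀ r, ∀ u, fderiv ℝ F p u = F p * A p u) ∧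
      ∀ p ∈ Metric.ball x₀ r, HasFDerivAt ψ (F p) p := by
  obtain ⟨r, hr, F, hrU, hF0, hF⟩ := exists_parallel_frame hU hA hx₀ hflat
  have hFd (p) (hp : p ∈ Metric.ball x₀ r) (u) : fderiv ℝ F p u = F p * A p u := by
    rw [(hF p hp).fderiv]; rfl
  have hFn (n : ℕ) : ContDiffOn ℝ n F (Metric.ball x₀ r) := by
    induction n with
    | zero =>
      rw [Nat.cast_zero, contDiffOn_zero]
      exact fun p hp ↦ (hF p hp).continuousAt.continuousWithinAt
    | succ n ih =>
      have hF' (p) (hp : p ∈ Metric.ball x₀ r) :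
          HasFDerivAt F ((ContinuousLinearMap.compL ℝ E E E (F p)) ∘L A p) p :=
        (hF p hp).congr_fderiv (by ext; rfl)
      refine contDiffOn_of_hasFDerivAt Metric.isOpen_ball hF' ?_
      have h1 : ContDiffOn ℝ n (fun p ↦ ContinuousLinearMap.compL ℝ E E E (F p))
        (Metric.ball x₀ r) := (ContinuousLinearMap.compL ℝ E E E).contDiff.comp_contDiffOn ih
      exact h1.clm_comp ((hA.mono hrU).of_le (by exact_mod_cast le_top))
  have hFs : ContDiffOn ℝ ∞ F (Metric.ball x₀ r) := contDiffOn_infty.2 hFn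
  -- Since dF(u)v = F(A(u)v) and A is symmetric, the one-form F is closed, hence exact on the ball.
  obtain ⟨ψ, hψ⟩ := (convex_ball x₀ r).exists_forall_hasFDerivWithinAt_of_hasFDerivWithinAt_symmetric
    (fun p hp ↦ ((hF p hp).differentiableAt.hasFDerivAt.hasFDerivWithinAt :
      HasFDerivWithinAt F (fderiv ℝ F p) _ p))
    (fun p hp u _ v _ ↦ by
      rw [hFd p hp, hFd p hp, mul_apply_eq_comp, mul_apply_eq_comp, hsymm p (hrU hp)])
  have hψ' (p) (hp : p ∈ Metric.ball x₀ r) : HasFDerivAt ψ (F p) p :=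
    (hψ p hp).hasFDerivAt (Metric.isOpen_ball.mem_nhds hp)
  refine ⟨r, hr, F, ψ, hrU, hF0, hFs, ?_, hFd, hψ'⟩
  exact contDiffOn_infty.2 fun n ↦
    (contDiffOn_of_hasFDerivAt Metric.isOpen_ball hψ' (hFn n)).of_le (by simp)

end Affine

/-! ### The trace identity behind the exterior derivative of Ω. -/

section TraceCalculus

/-- The algebraic identity behind the exterior derivative of `(u, v) ↦ tr (N u * N v * j)`, where
`N u = dj(u) + [a u, j]` is the covariant derivative of `j`. -/
lemma trace_covariant_identity {R : Type*} [Ring R] [Module ℝ R] (tr : R →ₗ[ℝ] ℝ)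
    (htr : ∀ a b, tr (a * b) = tr (b * a)) {ι : Type*} {j : R} (hj : j * j = -1)
    (a d N : ι → R) (S D : ι → ι → R) (hN : ∀ u, N u = d u + (a u * j - j * a u))
    (hd : ∀ u, d u * j = -(j * d u)) (hS : ∀ u v, S u v = S v u) (DN : ι → ι → R)
    (hDN : ∀ u v, DN u v = S u v + (D u v * j + a v * d u - (d u * a v + j * D u v)))
    (Rm : ι → ι → R) (hR : ∀ u v, Rm u v = D u v - D v u + a u * a v - a v * a u) (u v x : ι) :
    tr (DN u v * N x * j + N v * DN u x * j + N v * N x * d u) +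
      tr (DN v x * N u * j + N x * DN v u * j + N x * N u * d v) +
      tr (DN x u * N v * j + N u * DN x v * j + N u * N v * d x) =
    2 * (tr (Rm u v * N x) + tr (Rm v x * N u) + tr (Rm x u * N v)) := by
  have hNj (u) : N u * j = -(j * N u) := by
    rw [hN, add_mul, mul_add, hd, sub_mul, mul_sub, mul_assoc, hj, ← mul_assoc j j, hj, mul_assoc]
    noncomm_ring
  have hjNj (u) : j * N u * j = N u := by
    rw [mul_assoc, hNj, mul_neg, ← mul_assoc, hj]; simp
  -- The covariant derivative of N; by the Ricci identity its antisymmetrisation is the commutator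
  -- of the curvature with j.
  let C : ι → ι → R := fun u v ↦ DN u v + (a u * N v - N v * a u)
  have hC (u v) : C u v - C v u = Rm u v * j - j * Rm u v := by
    simp only [C, hDN, hR, hS v u, hN]
    noncomm_ring
  -- A product of three factors anticommuting with j anticommutes with j, and such an element is
  -- traceless because j² = -1.
  have hodd (u v x) : tr (N u * N v * N x) = 0 := by
    have h0 : N u * N v * N x * j = -(j * (N u * N v * N x)) := by
      calc N u * N v * N x * j = N u * N v * (N x * j) := mul_assoc _ _ _
        _ = -(N u * (N v * j) * N x) := by rw [hNj]; noncomm_ring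
        _ = N u * j * N v * N x := by rw [hNj v]; noncomm_ring
        _ = _ := by rw [hNj u]; noncomm_ring
    have h1 : j * (N u * N v * N x * j) = N u * N v * N x := by
      rw [h0, mul_neg, ← mul_assoc, hj]; simp
    have h2 := congrArg tr h1
    rw [htr, mul_assoc _ j j, hj] at h2
    simp only [mul_neg, mul_one, map_neg] at h2
    linarith
  -- A covariant Leibniz rule: the trace kills the commutator with `a u`, and trading `d u` for `N
  -- u` costs only a term covered by `hodd`.
  have hder (u v x) : tr (DN u v * N x * j + N v * DN u x * j + N v * N x * d u) =
      tr (C u v * N x * j) + tr (N v * C u x * j) := by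
    have h1 : DN u v * N x * j + N v * DN u x * j + N v * N x * d u =
        C u v * N x * j + N v * C u x * j + N v * N x * N u -
          (a u * (N v * N x * j) - (N v * N x * j) * a u) := by
      have hdu : d u = N u - (a u * j - j * a u) := by rw [hN]; abel
      simp only [C, hdu]
      noncomm_ring
    rw [h1, map_sub, map_sub, htr (a u), sub_self, sub_zero, map_add, map_add, hodd, add_zero]
  -- Moving `N x` cyclically past j changes the sign of the second term, so only the antisymmetrised
  -- `C` enters; the two halves of its commutator with j then contribute equally.
  have hpair (u v x) : tr (C u v * N x * j) + tr (N x * C v u * j) = 2 * tr (Rm u v * N x) := by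
    have h1 : tr (N x * C v u * j) = -tr (C v u * N x * j) := by
      rw [mul_assoc, htr, mul_assoc (C v u), mul_assoc, hNj, mul_neg, map_neg, neg_neg]
    rw [h1, ← sub_eq_add_neg, ← map_sub, ← sub_mul, ← sub_mul, hC]
    have h2 : (Rm u v * j - j * Rm u v) * N x * j = Rm u v * (j * N x * j) - j * (Rm u v * N x * j) := by
      noncomm_ring
    rw [h2, hjNj, map_sub, htr j, mul_assoc _ j j, hj]
    simp
    ring
  rw [hder, hder, hder]
  linarith [hpair u v x, hpair v x u, hpair x u v]

end TraceCalculus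

/-! ### Directional derivatives, used below to apply product rules one direction at a time. -/

lemma HasFDerivAt.hasLineDerivAt_comp {E W G : Type*} [NormedAddCommGroup E] [NormedSpace ℝ E]
    [NormedAddCommGroup W] [NormedSpace ℝ W] [NormedAddCommGroup G] [NormedSpace ℝ G]
    {b : W →L[ℝ] E} {w : W} {f : E → G} {f' : E →L[ℝ] G}
    (hf : HasFDerivAt f f' (b w)) (u : W) : HasLineDerivAt ℝ (fun w ↦ f (b w)) (f' (b u)) w u :=
  (hf.comp w b.hasFDerivAt).hasLineDerivAt u

lemma hasLineDerivAt_fderiv {W G : Type*} [NormedAddCommGroup W] [NormedSpace ℝ W]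
    [NormedAddCommGroup G] [NormedSpace ℝ G] {f : W → G} {w : W} (hf : DifferentiableAt ℝ f w)
    (u : W) : HasLineDerivAt ℝ f (fderiv ℝ f w u) w u :=
  hf.hasFDerivAt.hasLineDerivAt u

lemma hasLineDerivAt_fderiv_comp {E W G : Type*} [NormedAddCommGroup E] [NormedSpace ℝ E]
    [NormedAddCommGroup W] [NormedSpace ℝ W] [NormedAddCommGroup G] [NormedSpace ℝ G]
    (b : W →L[ℝ] E) {w : W} {f : E → G} (hf : DifferentiableAt ℝ f (b w)) (u : W) :
    HasLineDerivAt ℝ (fun w ↦ f (b w)) (fderiv ℝ f (b w) (b u)) w u :=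
  HasFDerivAt.hasLineDerivAt_comp hf.hasFDerivAt u

lemma HasLineDerivAt.clm_apply_const {W G H : Type*} [NormedAddCommGroup W] [NormedSpace ℝ W]
    [NormedAddCommGroup G] [NormedSpace ℝ G] [NormedAddCommGroup H]
    [NormedSpace ℝ H] {f : W → G →L[ℝ] H} {f' : G →L[ℝ] H} {w u : W}
    (hf : HasLineDerivAt ℝ f f' w u) (z : G) : HasLineDerivAt ℝ (fun w ↦ f w z) (f' z) w u := by
  have := HasDerivAt.clm_apply hf (hasDerivAt_const (0 : ℝ) z)
  simp only [map_zero, add_zero] at this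
  exact this

/-! ### The form Ω and its exterior derivative in coordinates. -/

section Coordinates

variable {E : Type*} [NormedAddCommGroup E] [NormedSpace ℝ E] [FiniteDimensional ℝ E]

variable (E) in
/-- The trace as a continuous linear form. -/
def trE : (E →L[ℝ] E) →L[ℝ] ℝ :=
  LinearMap.toContinuousLinearMap (LinearMap.trace ℝ E ∘ₗ ContinuousLinearMap.coeLM ℝ)

lemma trE_apply (f : E →L[ℝ] E) : trE E f = LinearMap.trace ℝ E f.toLinearMap := rfl

lemma trE_mul_comm (f g : E →L[ℝ] E) : trE E (f * g) = trE E (g * f) :=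
  LinearMap.trace_mul_comm ℝ f.toLinearMap g.toLinearMap

variable {W : Type*} [NormedAddCommGroup W] [NormedSpace ℝ W]

/-- The covariant derivative of the endomorphism field `j` along `b`, for the connection form
`A`. -/
def covEnd (A : E → E →L[ℝ] E →L[ℝ] E) (b : W →L[ℝ] E) (j : W → E →L[ℝ] E) (w u : W) : E →L[ℝ] E :=
  fderiv ℝ j w u + (A (b w) (b u) * j w - j w * A (b w) (b u))

/-- The curvature of the connection form `A`. -/
def curvForm (A : E → E →L[ℝ] E →L[ℝ] E) (y u v : E) : E →L[ℝ] E :=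
  fderiv ℝ A y u v - fderiv ℝ A y v u + A y u * A y v - A y v * A y u

/-- The form `t ϖ(b·, b·) + ⅛ tr (∇j ∇j j)`. -/
def coordForm (t : ℝ) (ϖ : E → E →L[ℝ] E →L[ℝ] ℝ) (A : E → E →L[ℝ] E →L[ℝ] E) (b : W →L[ℝ] E)
    (j : W → E →L[ℝ] E) (w u v : W) : ℝ :=
  t * ϖ (b w) (b u) (b v) + 1 / 8 * trE E (covEnd A b j w u * covEnd A b j w v * j w)

variable {t : ℝ} {ϖ : E → E →L[ℝ] E →L[ℝ] ℝ} {A : E → E →L[ℝ] E →L[ℝ] E} {b : W →L[ℝ] E}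
  {j : W → E →L[ℝ] E} {O : Set W} {U : Set E}

lemma contDiffOn_coordForm (hO : IsOpen O) (hb : Set.MapsTo b O U)
    (hϖ : ContDiffOn ℝ ∞ ϖ U) (hA : ContDiffOn ℝ ∞ A U) (hj : ContDiffOn ℝ ∞ j O) (u v : W) :
    ContDiffOn ℝ ∞ (fun w ↦ coordForm t ϖ A b j w u v) O := by
  have h1 : ContDiffOn ℝ ∞ (fun w ↦ ϖ (b w)) O := hϖ.comp b.contDiff.contDiffOn hb
  have h2 : ContDiffOn ℝ ∞ (fun w ↦ A (b w)) O := hA.comp b.contDiff.contDiffOn hb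
  have h3 : ContDiffOn ℝ ∞ (fderiv ℝ j) O := hj.fderiv_of_isOpen hO (by simp)
  have hm {f g : W → E →L[ℝ] E} (hf : ContDiffOn ℝ ∞ f O) (hg : ContDiffOn ℝ ∞ g O) :
      ContDiffOn ℝ ∞ (fun w ↦ f w * g w) O := hf.clm_comp hg
  have hN (u : W) : ContDiffOn ℝ ∞ (fun w ↦ covEnd A b j w u) O := by
    have h2u : ContDiffOn ℝ ∞ (fun w ↦ A (b w) (b u)) O := h2.clm_apply contDiffOn_const
    exact (h3.clm_apply contDiffOn_const).add ((hm h2u hj).sub (hm hj h2u))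
  have h4 : ContDiffOn ℝ ∞ (fun w ↦ ϖ (b w) (b u) (b v)) O :=
    (h1.clm_apply contDiffOn_const).clm_apply contDiffOn_const
  exact (contDiffOn_const.mul h4).add
    (contDiffOn_const.mul ((trE E).contDiff.comp_contDiffOn (hm (hm (hN u) (hN v)) hj)))

lemma contDiffOn_of_eq_coordForm [FiniteDimensional ℝ W] (hO : IsOpen O) (hb : Set.MapsTo b O U)
    (hϖ : ContDiffOn ℝ ∞ ϖ U) (hA : ContDiffOn ℝ ∞ A U) (hj : ContDiffOn ℝ ∞ j O)
    {B : W → W →L[ℝ] W →L[ℝ] ℝ} (hB : ∀ w ∈ O, ∀ u v, B w u v = coordForm t ϖ A b j w u v) :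
    ContDiffOn ℝ ∞ B O := by
  refine contDiffOn_clm_apply.2 fun u ↦ contDiffOn_clm_apply.2 fun v ↦ ?_
  exact (contDiffOn_coordForm hO hb hϖ hA hj u v).congr fun w hw ↦ hB w hw u v

omit [FiniteDimensional ℝ E] in
lemma fderiv_mul_self_eq (hO : IsOpen O) (hj : ContDiffOn ℝ ∞ j O) (hjj : ∀ w ∈ O, j w * j w = -1)
    {w : W} (hw : w ∈ O) (u : W) : fderiv ℝ j w u * j w = -(j w * fderiv ℝ j w u) := by
  have h1 : HasLineDerivAt ℝ j (fderiv ℝ j w u) w u :=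
    ((hj.contDiffAt (hO.mem_nhds hw)).differentiableAt (by simp)).hasFDerivAt.hasLineDerivAt u
  have h2 := HasDerivAt.mul h1 h1
  have h3 : HasDerivAt (fun s : ℝ ↦ j (w + s • u) * j (w + s • u)) 0 0 := by
    refine (hasDerivAt_const (0 : ℝ) (-1 : E →L[ℝ] E)).congr_of_eventuallyEq ?_
    have hc : ContinuousAt (fun s : ℝ ↦ w + s • u) 0 := by fun_prop
    have : ∀ᶠ s : ℝ in 𝓝 0, w + s • u ∈ O := hc.eventually (hO.mem_nhds (by simpa using hw))
    filter_upwards [this] with s hs using hjj _ hs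
  have h4 := h2.unique h3
  simp only [zero_smul, add_zero] at h4
  exact eq_neg_of_add_eq_zero_left h4

omit [FiniteDimensional ℝ E] in
lemma covEnd_mul_self_eq (hO : IsOpen O) (hj : ContDiffOn ℝ ∞ j O) (hjj : ∀ w ∈ O, j w * j w = -1)
    {w : W} (hw : w ∈ O) (u : W) : covEnd A b j w u * j w = -(j w * covEnd A b j w u) := by
  rw [covEnd, add_mul, mul_add, fderiv_mul_self_eq hO hj hjj hw, sub_mul, mul_sub, mul_assoc,
    hjj w hw, ← mul_assoc (j w) (j w), hjj w hw, mul_assoc]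
  noncomm_ring

-- The product rule along each direction puts the derivatives into the shape of
-- `trace_covariant_identity`, with S the symmetric second derivative of j. The part with t cancels
-- because ϖ is closed, and 1/4 = 2 · 1/8.
set_option synthInstance.maxHeartbeats 400000 in
set_option maxHeartbeats 1600000 in
lemma fderiv_coordForm_cyclic [FiniteDimensional ℝ W] (hO : IsOpen O) (hU : IsOpen U)
    (hb : Set.MapsTo b O U)
    (hϖ : ContDiffOn ℝ ∞ ϖ U) (hA : ContDiffOn ℝ ∞ A U) (hj : ContDiffOn ℝ ∞ j O)
    (hjj : ∀ w ∈ O, j w * j w = -1)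
    (hcl : ∀ y ∈ U, ∀ u v x, fderiv ℝ ϖ y u v x + fderiv ℝ ϖ y v x u + fderiv ℝ ϖ y x u v = 0)
    {B : W → W →L[ℝ] W →L[ℝ] ℝ} (hB : ∀ w ∈ O, ∀ u v, B w u v = coordForm t ϖ A b j w u v)
    {w : W} (hw : w ∈ O) (u v x : W) :
    fderiv ℝ B w u v x + fderiv ℝ B w v x u + fderiv ℝ B w x u v =
      1 / 4 * (trE E (curvForm A (b w) (b u) (b v) * covEnd A b j w x) +
        trE E (curvForm A (b w) (b v) (b x) * covEnd A b j w u) +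
        trE E (curvForm A (b w) (b x) (b u) * covEnd A b j w v)) := by
  have hBs := contDiffOn_of_eq_coordForm hO hb hϖ hA hj hB
  have hOw := hO.mem_nhds hw
  have hbw := hU.mem_nhds (hb hw)
  have hBd := (hBs.contDiffAt hOw).differentiableAt (by simp)
  have hϖd := (hϖ.contDiffAt hbw).differentiableAt (by simp)
  have hAd := (hA.contDiffAt hbw).differentiableAt (by simp)
  have hjd := (hj.contDiffAt hOw).differentiableAt (by simp)
  have hjdd := ((hj.fderiv_of_isOpen hO (m := ∞) (by simp)).contDiffAt hOw).differentiableAt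
    (by simp)
  let S (u v : W) := fderiv ℝ (fderiv ℝ j) w u v
  let D (u v : W) := fderiv ℝ A (b w) (b u) (b v)
  let a (u : W) := A (b w) (b u)
  let d (u : W) := fderiv ℝ j w u
  let N (u : W) := covEnd A b j w u
  let DN (u v : W) := S u v + (D u v * j w + a v * d u - (d u * a v + j w * D u v))
  have hS (u v : W) : S u v = S v u :=
    ((hj.contDiffAt hOw).isSymmSndFDerivAt (by simpa using WithTop.coe_le_coe.2 (le_top : (2 : ℕ∞) ≤ ⊤))).eq u v
  have hNl (u v : W) : HasLineDerivAt ℝ (fun w ↦ covEnd A b j w v) (DN u v) w u := by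
    have h1 := HasLineDerivAt.clm_apply_const (hasLineDerivAt_fderiv hjdd u) v
    have h2 : HasLineDerivAt ℝ (fun w ↦ A (b w) (b v)) (D u v) w u := HasLineDerivAt.clm_apply_const (hasLineDerivAt_fderiv_comp b hAd u) (b v)
    have h3 := hasLineDerivAt_fderiv hjd u
    have h4 := HasDerivAt.add h1 (HasDerivAt.sub (HasDerivAt.mul h2 h3) (HasDerivAt.mul h3 h2))
    simp only [zero_smul, add_zero] at h4
    exact h4
  have hBl (u v x : W) : fderiv ℝ B w u v x = t * fderiv ℝ ϖ (b w) (b u) (b v) (b x) +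
      1 / 8 * trE E (DN u v * N x * j w + N v * DN u x * j w + N v * N x * d u) := by
    have h1 := HasLineDerivAt.clm_apply_const (HasLineDerivAt.clm_apply_const (hasLineDerivAt_fderiv hBd u) v) x
    have h2 := HasLineDerivAt.clm_apply_const (HasLineDerivAt.clm_apply_const
      (hasLineDerivAt_fderiv_comp b hϖd u) (b v)) (b x)
    have h3 := hasLineDerivAt_fderiv hjd u
    have h4 := HasDerivAt.mul (HasDerivAt.mul (hNl u v) (hNl u x)) h3
    have h5 := (trE E).hasFDerivAt.comp_hasDerivAt (0 : ℝ) h4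
    have h6 := HasDerivAt.add (HasDerivAt.const_mul t h2) (HasDerivAt.const_mul (1 / 8) h5)
    have hev : (fun s : ℝ ↦ B (w + s • u) v x) =ᶠ[𝓝 0]
        fun s ↦ coordForm t ϖ A b j (w + s • u) v x := by
      have hc : ContinuousAt (fun s : ℝ ↦ w + s • u) 0 := by fun_prop
      have : ∀ᶠ s : ℝ in 𝓝 0, w + s • u ∈ O := hc.eventually (hO.mem_nhds (by simpa using hw))
      filter_upwards [this] with s hs using hB _ hs v x
    have h7 := HasDerivAt.unique h1 (h6.congr_of_eventuallyEq hev)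
    simp only [zero_smul, add_zero, Pi.mul_apply] at h7
    rw [h7, add_mul]
  have key := trace_covariant_identity (trE E).toLinearMap trE_mul_comm (hjj w hw) a d N S D
    (fun u ↦ rfl) (fun u ↦ fderiv_mul_self_eq hO hj hjj hw u) hS DN (fun u v ↦ rfl)
    (fun u v ↦ curvForm A (b w) (b u) (b v)) (fun u v ↦ rfl) u v x
  have hc := hcl (b w) (hb hw) (b u) (b v) (b x)
  have hsum (p q r p' q' r' s : ℝ) (h1 : p + q + r = 0) (h2 : p' + q' + r' = 2 * s) :
      t * p + 1 / 8 * p' + (t * q + 1 / 8 * q') + (t * r + 1 / 8 * r') = 1 / 4 * s := by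
    linear_combination t * h1 + 1 / 8 * h2
  rw [hBl, hBl, hBl]
  exact hsum _ _ _ _ _ _ _ hc key

end Coordinates

/-! ### Submanifolds defined by slice charts. -/

section Submanifold

variable {G : Type*} [NormedAddCommGroup G] [NormedSpace ℝ G]
  {T : Type*} [NormedAddCommGroup T] [NormedSpace ℝ T]
  {F' : Type*} [NormedAddCommGroup F'] [NormedSpace ℝ F']
  {H : Type*} [TopologicalSpace H] (I : ModelWithCorners ℝ G H) [I.Boundaryless]
  {N : Type*} [TopologicalSpace N] [ChartedSpace H N] (S : N → Prop) (L : (T × F') ≃L[ℝ] G)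

/-- A chart of `N` in which `S` is a linear slice. -/
structure SliceChart where
  chart : OpenPartialHomeomorph N H
  mem_maximalAtlas : chart ∈ IsManifold.maximalAtlas I ∞ N
  slice : ∀ p ∈ chart.source, S p ↔ (L.symm (I (chart p))).2 = 0

variable {I S L}

lemma SliceChart.eq_of_mem (c : SliceChart I S L) {p : N} (hp : p ∈ c.chart.source) (hS : S p) :
    L ((L.symm (I (c.chart p))).1, 0) = I (c.chart p) := by
  rw [← (c.slice p hp).1 hS, Prod.mk.eta, L.apply_symm_apply]

lemma SliceChart.mem_of_mem (c : SliceChart I S L) {t : T}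
    (ht : I.symm (L (t, 0)) ∈ c.chart.target) : S (c.chart.symm (I.symm (L (t, 0)))) := by
  rw [c.slice _ (c.chart.map_target ht), c.chart.right_inv ht, I.right_inv (by rw [I.range_eq_univ]; trivial)]
  simp

/-- The chart induced on a slice. -/
def SliceChart.subChart (c : SliceChart I S L) [Nonempty (Subtype S)] :
    OpenPartialHomeomorph (Subtype S) T where
  toFun p := (L.symm (I (c.chart p.1))).1
  -- Off the target the value is arbitrary, which is why the slice has to be nonempty.
  invFun t := open Classical in
    if h : I.symm (L (t, 0)) ∈ c.chart.target then ⟨_, c.mem_of_mem h⟩ else Classical.arbitrary _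
  source := Subtype.val ⁻¹' c.chart.source
  target := {t | I.symm (L (t, 0)) ∈ c.chart.target}
  map_source' p hp := by
    simp only [Set.mem_setOf_eq]
    rw [c.eq_of_mem hp p.2, I.left_inv]
    exact c.chart.map_source hp
  map_target' t ht := by
    simp only [Set.mem_setOf_eq] at ht
    simp only [ht, dif_pos, Set.mem_preimage]
    exact c.chart.map_target ht
  left_inv' p hp := by
    have h : I.symm (L ((L.symm (I (c.chart p.1))).1, 0)) = c.chart p.1 := by
      rw [c.eq_of_mem hp p.2, I.left_inv]
    have h2 : c.chart p.1 ∈ c.chart.target := c.chart.map_source hp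
    simp only [h, h2, dif_pos]
    exact Subtype.ext (c.chart.left_inv hp)
  right_inv' t ht := by
    simp only [Set.mem_setOf_eq] at ht
    simp only [ht, dif_pos]
    rw [c.chart.right_inv ht, I.right_inv (by rw [I.range_eq_univ]; trivial)]
    simp
  open_source := c.chart.open_source.preimage continuous_subtype_val
  open_target := c.chart.open_target.preimage (by fun_prop)
  continuousOn_toFun := by
    have h := c.chart.continuousOn.comp (continuous_subtype_val (p := S)).continuousOn
      (fun x (hx : x ∈ Subtype.val ⁻¹' c.chart.source) ↦ hx)
    exact (continuous_fst.comp (L.symm.continuous.comp I.continuous)).comp_continuousOn h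
  continuousOn_invFun := by
    refine Topology.IsInducing.subtypeVal.continuousOn_iff.2 ?_
    have h : ContinuousOn (fun t : T ↦ c.chart.symm (I.symm (L (t, 0))))
        {t | I.symm (L (t, 0)) ∈ c.chart.target} :=
      c.chart.symm.continuousOn.comp (by fun_prop) (fun t ht ↦ ht)
    refine h.congr fun t ht ↦ ?_
    simp only [Set.mem_setOf_eq] at ht
    simp [ht]

lemma SliceChart.mem_subChart_target (c : SliceChart I S L) [Nonempty (Subtype S)] {t : T} :
    t ∈ c.subChart.target ↔ I.symm (L (t, 0)) ∈ c.chart.target := Iff.rfl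

lemma SliceChart.coe_subChart_symm (c : SliceChart I S L) [Nonempty (Subtype S)] {t : T}
    (ht : t ∈ c.subChart.target) :
    (c.subChart.symm t).1 = c.chart.symm (I.symm (L (t, 0))) := by
  have h : I.symm (L (t, 0)) ∈ c.chart.target := ht
  change (open Classical in if h : I.symm (L (t, 0)) ∈ c.chart.target then
    (⟨_, c.mem_of_mem h⟩ : Subtype S) else Classical.arbitrary _).1 = _
  simp [h]

/-- The charts of a submanifold given by slice charts. -/
abbrev subChartedSpace (c : Subtype S → SliceChart I S L)
    (hc : ∀ z, z.1 ∈ (c z).chart.source) : ChartedSpace T (Subtype S) where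
  atlas := Set.range fun z ↦ haveI : Nonempty (Subtype S) := ⟨z⟩; (c z).subChart
  chartAt z := haveI : Nonempty (Subtype S) := ⟨z⟩; (c z).subChart
  mem_chart_source z := hc z
  chart_mem_atlas z := ⟨z, rfl⟩

variable [IsManifold I ∞ N]

/-- The transition maps are ambient transition maps restricted to vectors `L (t, 0)` and followed by
a linear projection. -/
lemma isManifold_subChartedSpace (c : Subtype S → SliceChart I S L)
    (hc : ∀ z, z.1 ∈ (c z).chart.source) :
    letI := subChartedSpace c hc
    IsManifold 𝓘(ℝ, T) ∞ (Subtype S) := by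
  letI := subChartedSpace c hc
  refine isManifold_of_contDiffOn _ _ _ ?_
  rintro _ _ ⟨z, rfl⟩ ⟨z', rfl⟩
  haveI : Nonempty (Subtype S) := ⟨z⟩
  have hg := (IsManifold.compatible_of_mem_maximalAtlas (c z).mem_maximalAtlas
    (c z').mem_maximalAtlas)
  rw [contDiffGroupoid, mem_groupoid_of_pregroupoid] at hg
  have h1 := hg.1
  have h1' : ContDiffOn ℝ ∞ (I ∘ ((c z).chart.symm ≫ₕ (c z').chart) ∘ I.symm)
    (I.symm ⁻¹' ((c z).chart.symm ≫ₕ (c z').chart).source ∩ Set.range I) := h1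
  have h2 : ContDiffOn ℝ ∞ (fun t : T ↦ (L.symm ((I ∘ ((c z).chart.symm ≫ₕ (c z').chart) ∘ I.symm)
      (L (t, 0)))).1) ((fun t ↦ L (t, 0)) ⁻¹'
        (I.symm ⁻¹' ((c z).chart.symm ≫ₕ (c z').chart).source ∩ Set.range I)) :=
    (contDiff_fst.comp L.symm.contDiff).comp_contDiffOn
      (h1'.comp (L.contDiff.comp (contDiff_id.prodMk contDiff_const)).contDiffOn (fun t ht ↦ ht))
  refine (h2.congr ?_).mono ?_
  · rintro t ⟨⟨ht, -⟩, -⟩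
    change (L.symm (I ((c z').chart ((c z).subChart.symm t).1))).1 = _
    rw [(c z).coe_subChart_symm (ht : t ∈ (c z).subChart.target)]
    rfl
  · rintro t ⟨ht, -⟩
    simp only [Set.mem_preimage, OpenPartialHomeomorph.trans_source, Set.mem_inter_iff,
      OpenPartialHomeomorph.symm_source] at ht ⊢
    have ht1 : t ∈ (c z).subChart.target := ht.1
    refine ⟨⟨ht1, ?_⟩, by rw [I.range_eq_univ]; trivial⟩
    have h3 : ((c z).subChart.symm t).1 ∈ (c z').chart.source := ht.2
    rwa [(c z).coe_subChart_symm ht1] at h3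

/-- Read in an induced chart and its slice chart, the inclusion is t ↦ `L (t, 0)`, the normal form
of an immersion; the topology is the induced one. -/
lemma isSmoothEmbedding_subtypeVal (c : Subtype S → SliceChart I S L)
    (hc : ∀ z, z.1 ∈ (c z).chart.source) :
    letI := subChartedSpace c hc
    IsSmoothEmbedding 𝓘(ℝ, T) I ∞ (Subtype.val : Subtype S → N) := by
  letI := subChartedSpace c hc
  haveI := isManifold_subChartedSpace c hc
  refine ⟨IsImmersionOfComplement.isImmersion (F := F') fun z ↦ ?_, .subtypeVal⟩
  haveI : Nonempty (Subtype S) := ⟨z⟩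
  refine IsImmersionAtOfComplement.mk_of_charts (F := F') L (chartAt T z) (c z).chart
    (mem_chart_source T z) (hc z) (IsManifold.chart_mem_maximalAtlas z) (c z).mem_maximalAtlas
    (fun p hp ↦ hp) ?_
  intro t ht
  have ht' : t ∈ (c z).subChart.target := by
    rw [OpenPartialHomeomorph.extend_target] at ht
    exact ht.1
  change I ((c z).chart ((c z).subChart.symm t).1) = L (t, 0)
  rw [(c z).coe_subChart_symm ht', (c z).chart.right_inv ht', I.right_inv (by rw [I.range_eq_univ]; trivial)]

end Submanifold

/-! ### Vector fields and tensor fields in charts. -/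

section ChartCalculus

variable {F : Type*} [NormedAddCommGroup F] [NormedSpace ℝ F]
  {N : Type*} [TopologicalSpace N] [ChartedSpace F N] [IsManifold 𝓘(ℝ, F) ∞ N]

/-- The components of tangent vectors at `x` in the preferred chart at `x₀`. -/
abbrev toCoord (x₀ x : N) : TangentSpace 𝓘(ℝ, F) x →L[ℝ] F :=
  (trivializationAt F (TangentSpace 𝓘(ℝ, F) : N → Type _) x₀).continuousLinearMapAt ℝ x

/-- The tangent vector at `x` with given components in the preferred chart at `x₀`. -/
abbrev ofCoord (x₀ x : N) : F →L[ℝ] TangentSpace 𝓘(ℝ, F) x :=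
  (trivializationAt F (TangentSpace 𝓘(ℝ, F) : N → Type _) x₀).symmL ℝ x

lemma mem_baseSet_iff {x₀ x : N} :
    x ∈ (trivializationAt F (TangentSpace 𝓘(ℝ, F) : N → Type _) x₀).baseSet ↔
      x ∈ (chartAt F x₀).source := by
  rw [TangentBundle.trivializationAt_baseSet]

lemma toCoord_ofCoord {x₀ x : N} (hx : x ∈ (chartAt F x₀).source) (u : F) :
    toCoord x₀ x (ofCoord x₀ x u) = u :=
  Trivialization.continuousLinearMapAt_symmL _ (mem_baseSet_iff.2 hx) u

lemma ofCoord_toCoord {x₀ x : N} (hx : x ∈ (chartAt F x₀).source) (v : TangentSpace 𝓘(ℝ, F) x) :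
    ofCoord x₀ x (toCoord x₀ x v) = v :=
  Trivialization.symmL_continuousLinearMapAt _ (mem_baseSet_iff.2 hx) v

lemma symm_mem_source {x₀ : N} {y : F} (hy : y ∈ (extChartAt 𝓘(ℝ, F) x₀).target) :
    (extChartAt 𝓘(ℝ, F) x₀).symm y ∈ (chartAt F x₀).source := by
  rw [← extChartAt_source 𝓘(ℝ, F)]; exact (extChartAt 𝓘(ℝ, F) x₀).map_target hy

/-- Reconciles `inChart`, a pullback by the inverse chart, with components in the bundle
trivialization; `inChart_apply` is the form used later. -/
lemma mfderiv_extChartAt_symm {x₀ : N} {y : F} (hy : y ∈ (extChartAt 𝓘(ℝ, F) x₀).target) :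
    (mfderiv 𝓘(ℝ, F) 𝓘(ℝ, F) (extChartAt 𝓘(ℝ, F) x₀).symm y :
      F →L[ℝ] TangentSpace 𝓘(ℝ, F) ((extChartAt 𝓘(ℝ, F) x₀).symm y)) =
      ofCoord (F := F) x₀ ((extChartAt 𝓘(ℝ, F) x₀).symm y) := by
  rw [ofCoord, TangentBundle.symmL_trivializationAt (symm_mem_source hy),
    (extChartAt 𝓘(ℝ, F) x₀).right_inv hy, modelWithCornersSelf_coe, Set.range_id,
    mfderivWithin_univ]

lemma inChart_apply (Ω : BilinField F N) {x₀ : N} {y : F}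
    (hy : y ∈ (extChartAt 𝓘(ℝ, F) x₀).target) (u v : F) :
    inChart Ω x₀ y u v = Ω ((extChartAt 𝓘(ℝ, F) x₀).symm y)
      (ofCoord x₀ ((extChartAt 𝓘(ℝ, F) x₀).symm y) u)
      (ofCoord x₀ ((extChartAt 𝓘(ℝ, F) x₀).symm y) v) := by
  rw [← mfderiv_extChartAt_symm hy]; rfl

lemma contMDiffAt_ofCoord {x₀ x : N} (hx : x ∈ (chartAt F x₀).source) (u : F) :
    ContMDiffAt 𝓘(ℝ, F) (𝓘(ℝ, F).prod 𝓘(ℝ, F)) ∞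
      (fun x ↦ (TotalSpace.mk' F x (ofCoord x₀ x u) : TangentBundle 𝓘(ℝ, F) N)) x := by
  rw [Trivialization.contMDiffAt_section_iff
    (trivializationAt F (TangentSpace 𝓘(ℝ, F) : N → Type _) x₀) (mem_baseSet_iff.2 hx)]
  refine (contMDiffAt_const (c := u)).congr_of_eventuallyEq ?_
  filter_upwards [(chartAt F x₀).open_source.mem_nhds hx] with y hy
  have := toCoord_ofCoord hy u
  rwa [toCoord, Trivialization.continuousLinearMapAt_apply,
    Trivialization.linearMapAt_apply, if_pos (mem_baseSet_iff.2 hy)] at this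

lemma trivializationAt_apply_eq_toCoord {x₀ x : N} (hx : x ∈ (chartAt F x₀).source)
    (v : TangentSpace 𝓘(ℝ, F) x) :
    (trivializationAt F (TangentSpace 𝓘(ℝ, F) : N → Type _) x₀ ⟨x, v⟩).2 = toCoord x₀ x v := by
  rw [toCoord, Trivialization.continuousLinearMapAt_apply, Trivialization.linearMapAt_apply,
    if_pos (mem_baseSet_iff.2 hx)]

lemma contMDiffAt_field_iff {x₀ x : N} (hx : x ∈ (chartAt F x₀).source)
    {Y : Π x : N, TangentSpace 𝓘(ℝ, F) x} :
    ContMDiffAt 𝓘(ℝ, F) (𝓘(ℝ, F).prod 𝓘(ℝ, F)) ∞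
      (fun x ↦ (TotalSpace.mk' F x (Y x) : TangentBundle 𝓘(ℝ, F) N)) x ↔
      ContMDiffAt 𝓘(ℝ, F) 𝓘(ℝ, F) ∞ (fun x ↦ toCoord x₀ x (Y x)) x := by
  rw [Trivialization.contMDiffAt_section_iff
    (trivializationAt F (TangentSpace 𝓘(ℝ, F) : N → Type _) x₀) (mem_baseSet_iff.2 hx)]
  refine Filter.EventuallyEq.contMDiffAt_iff ?_
  filter_upwards [(chartAt F x₀).open_source.mem_nhds hx] with y hy
    using trivializationAt_apply_eq_toCoord hy _

lemma mdifferentiableAt_field_iff {x₀ x : N} (hx : x ∈ (chartAt F x₀).source)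
    {Y : Π x : N, TangentSpace 𝓘(ℝ, F) x} :
    MDifferentiableAt 𝓘(ℝ, F) (𝓘(ℝ, F).prod 𝓘(ℝ, F))
      (fun x ↦ (TotalSpace.mk' F x (Y x) : TangentBundle 𝓘(ℝ, F) N)) x ↔
      MDifferentiableAt 𝓘(ℝ, F) 𝓘(ℝ, F) (fun x ↦ toCoord x₀ x (Y x)) x := by
  rw [Trivialization.mdifferentiableAt_section_iff
    (e := trivializationAt F (TangentSpace 𝓘(ℝ, F) : N → Type _) x₀) _ _ (mem_baseSet_iff.2 hx)]
  refine Filter.EventuallyEq.mdifferentiableAt_iff ?_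
  filter_upwards [(chartAt F x₀).open_source.mem_nhds hx] with y hy
    using trivializationAt_apply_eq_toCoord hy _

variable {G : Type*} [NormedAddCommGroup G] [NormedSpace ℝ G]

lemma mfderiv_eq_fderiv_chart {x₀ x : N} (hx : x ∈ (chartAt F x₀).source) {f : N → G} {g : F → G}
    (hfg : ∀ᶠ x in 𝓝 x, f x = g (extChartAt 𝓘(ℝ, F) x₀ x))
    (hg : DifferentiableAt ℝ g (extChartAt 𝓘(ℝ, F) x₀ x)) (v : TangentSpace 𝓘(ℝ, F) x) :
    MDifferentiableAt 𝓘(ℝ, F) 𝓘(ℝ, G) f x ∧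
    (mfderiv 𝓘(ℝ, F) 𝓘(ℝ, G) f x v : G) =
      fderiv ℝ g (extChartAt 𝓘(ℝ, F) x₀ x) (toCoord x₀ x v) := by
  have h1 := (mdifferentiableAt_extChartAt (I := 𝓘(ℝ, F)) hx).hasMFDerivAt
  have h2 := (hg.mdifferentiableAt.hasMFDerivAt.comp x h1).congr_of_eventuallyEq hfg
  refine ⟨h2.mdifferentiableAt, ?_⟩
  rw [h2.mfderiv, mfderiv_eq_fderiv, toCoord, TangentBundle.continuousLinearMapAt_trivializationAt hx]
  rfl

lemma contMDiffAt_iff_contDiffAt_chart {x₀ : N} {y : F} (hy : y ∈ (extChartAt 𝓘(ℝ, F) x₀).target)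
    {f : N → G} :
    ContMDiffAt 𝓘(ℝ, F) 𝓘(ℝ, G) ∞ f ((extChartAt 𝓘(ℝ, F) x₀).symm y) ↔
      ContDiffAt ℝ ∞ (fun y ↦ f ((extChartAt 𝓘(ℝ, F) x₀).symm y)) y := by
  rw [← contMDiffAt_iff_contDiffAt]
  have ho : (extChartAt 𝓘(ℝ, F) x₀).target ∈ 𝓝 y := (isOpen_extChartAt_target x₀).mem_nhds hy
  constructor
  · intro h
    exact h.comp y ((contMDiffOn_extChartAt_symm x₀).contMDiffAt ho)
  · intro h
    have hx := symm_mem_source hy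
    have h1 : ContMDiffAt 𝓘(ℝ, F) 𝓘(ℝ, F) ∞ (extChartAt 𝓘(ℝ, F) x₀)
        ((extChartAt 𝓘(ℝ, F) x₀).symm y) :=
      contMDiffAt_extChartAt' hx
    have h2 := ContMDiffAt.comp (x := (extChartAt 𝓘(ℝ, F) x₀).symm y)
      (g := fun y ↦ f ((extChartAt 𝓘(ℝ, F) x₀).symm y))
      (by rw [(extChartAt 𝓘(ℝ, F) x₀).right_inv hy]; exact h) h1
    refine h2.congr_of_eventuallyEq ?_
    filter_upwards [(chartAt F x₀).open_source.mem_nhds hx] with x' hx'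
    simp only [Function.comp]
    rw [(extChartAt 𝓘(ℝ, F) x₀).left_inv (by rwa [extChartAt_source])]

lemma mdifferentiableAt_iff_differentiableAt_chart {x₀ : N} {y : F}
    (hy : y ∈ (extChartAt 𝓘(ℝ, F) x₀).target) {f : N → G} :
    MDifferentiableAt 𝓘(ℝ, F) 𝓘(ℝ, G) f ((extChartAt 𝓘(ℝ, F) x₀).symm y) ↔
      DifferentiableAt ℝ (fun y ↦ f ((extChartAt 𝓘(ℝ, F) x₀).symm y)) y := by
  rw [← mdifferentiableAt_iff_differentiableAt]
  have ho : (extChartAt 𝓘(ℝ, F) x₀).target ∈ 𝓝 y := (isOpen_extChartAt_target x₀).mem_nhds hy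
  constructor
  · intro h
    exact h.comp y (((contMDiffOn_extChartAt_symm (n := ∞) x₀).contMDiffAt ho).mdifferentiableAt
      (by simp))
  · intro h
    have hx := symm_mem_source hy
    have h2 := MDifferentiableAt.comp ((extChartAt 𝓘(ℝ, F) x₀).symm y)
      (g := fun y ↦ f ((extChartAt 𝓘(ℝ, F) x₀).symm y))
      (by rw [(extChartAt 𝓘(ℝ, F) x₀).right_inv hy]; exact h)
      (mdifferentiableAt_extChartAt (I := 𝓘(ℝ, F)) hx)
    refine h2.congr_of_eventuallyEq ?_
    filter_upwards [(chartAt F x₀).open_source.mem_nhds hx] with x' hx'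
    simp only [Function.comp]
    rw [(extChartAt 𝓘(ℝ, F) x₀).left_inv (by rwa [extChartAt_source])]

/-- The expression of a field of endomorphisms in the preferred chart at `x₀`. -/
def endInChart (J : EndField F N) (x₀ : N) (y : F) : F →L[ℝ] F :=
  (toCoord x₀ ((extChartAt 𝓘(ℝ, F) x₀).symm y)).comp
    ((J ((extChartAt 𝓘(ℝ, F) x₀).symm y)).comp (ofCoord x₀ ((extChartAt 𝓘(ℝ, F) x₀).symm y)))

/-- Only the centre of each preferred chart has to be tested, since every point is the centre of its
own chart. -/
lemma contMDiff_endField [FiniteDimensional ℝ F] {J : EndField F N}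
    (h : ∀ x₀, ContDiffAt ℝ ∞ (endInChart J x₀) (extChartAt 𝓘(ℝ, F) x₀ x₀)) :
    ContMDiff 𝓘(ℝ, F) (𝓘(ℝ, F).prod 𝓘(ℝ, F →L[ℝ] F)) ∞
    (fun x ↦ (TotalSpace.mk' (F →L[ℝ] F) x (J x) :
      TotalSpace (F →L[ℝ] F)
        (fun x : N ↦ TangentSpace 𝓘(ℝ, F) x →L[ℝ] TangentSpace 𝓘(ℝ, F) x))) := by
  intro x₀
  rw [contMDiffAt_hom_bundle]
  refine ⟨contMDiffAt_id, ?_⟩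
  have ht := mem_extChartAt_target (I := 𝓘(ℝ, F)) x₀
  have h1 := contMDiffAt_iff_contDiffAt_chart (x₀ := x₀) ht (f := fun x ↦
    (toCoord x₀ x).comp ((J x).comp (ofCoord x₀ x)))
  rw [(extChartAt 𝓘(ℝ, F) x₀).left_inv (mem_extChartAt_source x₀)] at h1
  refine (h1.2 (h x₀)).congr_of_eventuallyEq ?_
  filter_upwards [(chartAt F x₀).open_source.mem_nhds (mem_chart_source F x₀)] with x hx
  rw [ContinuousLinearMap.inCoordinates_eq (mem_baseSet_iff.2 hx) (mem_baseSet_iff.2 hx)]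
  ext u
  simp only [ContinuousLinearMap.comp_apply, ContinuousLinearEquiv.coe_coe]
  rw [Trivialization.coe_continuousLinearEquivAt_eq _ (mem_baseSet_iff.2 hx), ofCoord,
    Trivialization.symmL_apply _ (mem_baseSet_iff.2 hx)]
  rfl

lemma contMDiff_bilinField [FiniteDimensional ℝ F] {Ω : BilinField F N}
    (h : ∀ x₀, ContDiffAt ℝ ∞ (inChart Ω x₀) (extChartAt 𝓘(ℝ, F) x₀ x₀)) :
    ContMDiff 𝓘(ℝ, F) (𝓘(ℝ, F).prod 𝓘(ℝ, F →L[ℝ] F →L[ℝ] ℝ)) ∞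
    (fun x ↦ (TotalSpace.mk' (F →L[ℝ] F →L[ℝ] ℝ) x (Ω x) :
      TotalSpace (F →L[ℝ] F →L[ℝ] ℝ)
        (fun x : N ↦ TangentSpace 𝓘(ℝ, F) x →L[ℝ] TangentSpace 𝓘(ℝ, F) x →L[ℝ] ℝ))) := by
  intro x₀
  rw [contMDiffAt_hom_bundle]
  refine ⟨contMDiffAt_id, ?_⟩
  have ht := mem_extChartAt_target (I := 𝓘(ℝ, F)) x₀
  have hs := (extChartAt 𝓘(ℝ, F) x₀).left_inv (mem_extChartAt_source x₀)
  conv => arg 5; rw [← hs]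
  rw [contMDiffAt_iff_contDiffAt_chart ht]
  refine (h x₀).congr_of_eventuallyEq ?_
  filter_upwards [(isOpen_extChartAt_target x₀).mem_nhds ht] with y hy
  have hx := mem_baseSet_iff.2 (symm_mem_source hy)
  ext u v
  rw [inCoordinates_apply_eq₂ hx hx (by simp), inChart_apply _ hy, ofCoord,
    Trivialization.symmL_apply _ hx, Trivialization.symmL_apply _ hx]
  simp

lemma contDiffOn_inChart [FiniteDimensional ℝ F] {Ω : BilinField F N}
    (h : ContMDiff 𝓘(ℝ, F) (𝓘(ℝ, F).prod 𝓘(ℝ, F →L[ℝ] F →L[ℝ] ℝ)) ∞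
    (fun x ↦ (TotalSpace.mk' (F →L[ℝ] F →L[ℝ] ℝ) x (Ω x) :
      TotalSpace (F →L[ℝ] F →L[ℝ] ℝ)
        (fun x : N ↦ TangentSpace 𝓘(ℝ, F) x →L[ℝ] TangentSpace 𝓘(ℝ, F) x →L[ℝ] ℝ)))) (x₀ : N) :
    ContDiffOn ℝ ∞ (inChart Ω x₀) (extChartAt 𝓘(ℝ, F) x₀).target := by
  refine contDiffOn_clm_apply.2 fun u ↦ contDiffOn_clm_apply.2 fun v ↦ ?_
  intro y hy
  have hx := symm_mem_source hy
  have h1 : ContMDiffAt 𝓘(ℝ, F) (𝓘(ℝ, F).prod 𝓘(ℝ, ℝ)) ∞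
      (fun x ↦ (TotalSpace.mk' ℝ x (Ω x (ofCoord x₀ x u) (ofCoord x₀ x v)) :
        TotalSpace ℝ (Bundle.Trivial N ℝ))) ((extChartAt 𝓘(ℝ, F) x₀).symm y) :=
    ContMDiffAt.clm_bundle_apply₂ (F₁ := F) (F₂ := F) (h _) (contMDiffAt_ofCoord hx u)
      (contMDiffAt_ofCoord hx v)
  rw [contMDiffAt_section] at h1
  have h2 := (contMDiffAt_iff_contDiffAt_chart hy).1 h1
  refine (h2.congr_of_eventuallyEq ?_).contDiffWithinAt
  filter_upwards [(isOpen_extChartAt_target x₀).mem_nhds hy] with y' hy'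
  rw [inChart_apply _ hy']
  rfl

end ChartCalculus

/-! ### The connection form in a chart of the base. -/

section BaseCoordinates

variable {n : ℕ} {M : Type*} [TopologicalSpace M]
  [ChartedSpace (EuclideanSpace ℝ (Fin (2 * n))) M] [IsManifold 𝓘(ℝ, Model n) ∞ M]
  {σ : BilinField (Model n) M} {cov : LinearConnection n M}

lemma frameSection_eq_ofCoord (x₀ x : M) (w : Model n) : frameSection x₀ w x = ofCoord x₀ x w := rfl

lemma diffFieldAt_frameSection {x₀ x : M} (hx : x ∈ (chartAt (Model n) x₀).source) (w : Model n) :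
    DiffFieldAt (frameSection x₀ w) x :=
  (contMDiffAt_ofCoord hx w).mdifferentiableAt (by simp)

lemma diffFieldAt_of_coord {x₀ : M} {y : Model n} (hy : y ∈ (extChartAt 𝓘(ℝ, Model n) x₀).target)
    {Y : Π x : M, TangentSpace 𝓘(ℝ, Model n) x} {Y' : Model n → Model n}
    (hY : ∀ᶠ y' in 𝓝 y, toCoord x₀ ((extChartAt 𝓘(ℝ, Model n) x₀).symm y') (Y ((extChartAt 𝓘(ℝ, Model n) x₀).symm y')) = Y' y')
    (hd : DifferentiableAt ℝ Y' y) : DiffFieldAt Y ((extChartAt 𝓘(ℝ, Model n) x₀).symm y) := by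
  rw [DiffFieldAt, mdifferentiableAt_field_iff (symm_mem_source hy),
    mdifferentiableAt_iff_differentiableAt_chart hy]
  exact hd.congr_of_eventuallyEq hY

/-- The components of the connection in the preferred chart at `x₀`. -/
def connForm (cov : LinearConnection n M) (x₀ : M) (y : Model n) :
    Model n →L[ℝ] Model n →L[ℝ] Model n :=
  LinearMap.toContinuousBilinearMap <| LinearMap.mk₂ ℝ
    (fun v w ↦ toCoord x₀ ((extChartAt 𝓘(ℝ, Model n) x₀).symm y)
      (cov (frameSection x₀ w) ((extChartAt 𝓘(ℝ, Model n) x₀).symm y) (ofCoord x₀ ((extChartAt 𝓘(ℝ, Model n) x₀).symm y) v)))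
    (fun v v' w ↦ by simp only [map_add])
    (fun c v w ↦ by simp only [map_smul])
    (fun v w w' ↦ by
      -- Additivity of the connection needs differentiable frame sections, available on the chart
      -- domain; elsewhere `ofCoord` is zero and nothing is to be shown.
      by_cases hx : (extChartAt 𝓘(ℝ, Model n) x₀).symm y ∈ (chartAt (Model n) x₀).source
      · have h : frameSection x₀ (w + w') = frameSection x₀ w + frameSection x₀ w' := by
          funext y; simp only [frameSection, map_add, Pi.add_apply]
        rw [h, cov.isCovariantDerivativeOnUniv.add (diffFieldAt_frameSection hx _)
          (diffFieldAt_frameSection hx _)]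
        simp only [ContinuousLinearMap.add_apply, map_add]
      · have : (ofCoord x₀ ((extChartAt 𝓘(ℝ, Model n) x₀).symm y) v) = 0 := by
          rw [ofCoord, Trivialization.symmL_apply_of_notMem]
          rwa [mem_baseSet_iff]
        simp only [this, map_zero, add_zero, smul_zero])
    (fun c v w ↦ by
      by_cases hx : (extChartAt 𝓘(ℝ, Model n) x₀).symm y ∈ (chartAt (Model n) x₀).source
      · have h : frameSection x₀ (c • w) = c • frameSection x₀ w := by
          funext y; simp only [frameSection, map_smul, Pi.smul_apply]
        rw [h, cov.isCovariantDerivativeOnUniv.smul_const c (diffFieldAt_frameSection hx _)]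
        simp only [ContinuousLinearMap.smul_apply, map_smul]
      · have : (ofCoord x₀ ((extChartAt 𝓘(ℝ, Model n) x₀).symm y) v) = 0 := by
          rw [ofCoord, Trivialization.symmL_apply_of_notMem]
          rwa [mem_baseSet_iff]
        simp only [this, map_zero, add_zero, smul_zero])

lemma connForm_apply (cov : LinearConnection n M) (x₀ : M) (y v w : Model n) :
    connForm cov x₀ y v w = toCoord x₀ ((extChartAt 𝓘(ℝ, Model n) x₀).symm y)
      (cov (frameSection x₀ w) ((extChartAt 𝓘(ℝ, Model n) x₀).symm y) (ofCoord x₀ ((extChartAt 𝓘(ℝ, Model n) x₀).symm y) v)) := rfl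

lemma cov_sum_smul {ι : Type*} (s : Finset ι) (cov : LinearConnection n M) {x : M}
    {g : ι → M → ℝ} {Y : ι → Π x : M, TangentSpace 𝓘(ℝ, Model n) x}
    (hg : ∀ i, MDifferentiableAt 𝓘(ℝ, Model n) 𝓘(ℝ, ℝ) (g i) x) (hY : ∀ i, DiffFieldAt (Y i) x) :
    DiffFieldAt (∑ i ∈ s, g i • Y i) x ∧
    ∀ v, cov (∑ i ∈ s, g i • Y i) x v =
      ∑ i ∈ s, (g i x • cov (Y i) x v + mvfderiv 𝓘(ℝ, Model n) (g i) x v • Y i x) := by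
  classical
  induction s using Finset.induction_on with
  | empty =>
    refine ⟨mdifferentiableAt_zeroSection .., fun v ↦ ?_⟩
    rw [Finset.sum_empty, Finset.sum_empty, cov.zero]; rfl
  | insert i s hi ih =>
    have h1 : DiffFieldAt (g i • Y i) x := MDifferentiableAt.smul_section (hg i) (hY i)
    rw [Finset.sum_insert hi]
    refine ⟨mdifferentiableAt_add_section h1 ih.1, fun v ↦ ?_⟩
    rw [Finset.sum_insert hi, cov.isCovariantDerivativeOnUniv.add h1 ih.1,
      cov.isCovariantDerivativeOnUniv.leibniz (hY i) (hg i), ContinuousLinearMap.add_apply, ih.2]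
    rfl

/-- Near the point Y is a combination of coordinate frame fields with coefficients the components of
`Y'`; locality and the Leibniz rule then give ∇Y = dY' + A Y'. -/
lemma toCoord_cov {x₀ : M} {y : Model n} (hy : y ∈ (extChartAt 𝓘(ℝ, Model n) x₀).target)
    {Y : Π x : M, TangentSpace 𝓘(ℝ, Model n) x} {Y' : Model n → Model n}
    (hY : ∀ᶠ y' in 𝓝 y, toCoord x₀ ((extChartAt 𝓘(ℝ, Model n) x₀).symm y') (Y ((extChartAt 𝓘(ℝ, Model n) x₀).symm y')) = Y' y')
    (hd : DifferentiableAt ℝ Y' y) : ∀ v : TangentSpace 𝓘(ℝ, Model n) ((extChartAt 𝓘(ℝ, Model n) x₀).symm y),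
    toCoord x₀ ((extChartAt 𝓘(ℝ, Model n) x₀).symm y) (cov Y ((extChartAt 𝓘(ℝ, Model n) x₀).symm y) v) =
      fderiv ℝ Y' y (toCoord x₀ ((extChartAt 𝓘(ℝ, Model n) x₀).symm y) v) +
        connForm cov x₀ y (toCoord x₀ ((extChartAt 𝓘(ℝ, Model n) x₀).symm y) v) (Y' y) := by
  have hx := symm_mem_source hy
  have hr := (extChartAt 𝓘(ℝ, Model n) x₀).right_inv hy
  set x := (extChartAt 𝓘(ℝ, Model n) x₀).symm y with hxdef
  intro v
  let b := EuclideanSpace.basisFun (Fin (2 * n)) ℝ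
  let g (i : Fin (2 * n)) (x' : M) : ℝ := Y' (extChartAt 𝓘(ℝ, Model n) x₀ x') i
  let pr (i : Fin (2 * n)) : Model n →L[ℝ] ℝ := EuclideanSpace.proj i
  have hgd (i) : DifferentiableAt ℝ (fun y ↦ Y' y i) y := (pr i).differentiableAt.comp y hd
  have hg (i) := mfderiv_eq_fderiv_chart hx (f := g i) (g := fun y ↦ Y' y i)
    (Filter.Eventually.of_forall fun _ ↦ rfl) (by rw [hr]; exact hgd i)
  have hgv (i) (v : TangentSpace 𝓘(ℝ, Model n) x) : mvfderiv 𝓘(ℝ, Model n) (g i) x v =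
      (fderiv ℝ Y' y (toCoord x₀ x v)) i := by
    have h1 : mvfderiv 𝓘(ℝ, Model n) (g i) x v = mfderiv 𝓘(ℝ, Model n) 𝓘(ℝ, ℝ) (g i) x v := rfl
    rw [h1, (hg i v).2, hr]
    have h2 := ((pr i).hasFDerivAt.comp y hd.hasFDerivAt).fderiv
    exact congrArg (fun f ↦ f (toCoord x₀ x v)) h2
  have hs := cov_sum_smul Finset.univ cov (fun i ↦ (hg i 0).1)
    (fun i ↦ diffFieldAt_frameSection hx (b i))
  have hsum (z : Model n) : ∑ i, z i • b i = z := by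
    have := b.sum_repr z
    simpa [b] using this
  have heq : ∀ᶠ x' in 𝓝 x, Y x' = (∑ i, g i • frameSection x₀ (b i)) x' := by
    have hc : ContinuousAt (extChartAt 𝓘(ℝ, Model n) x₀) x := continuousAt_extChartAt' (by rwa [extChartAt_source])
    have h1 : ∀ᶠ x' in 𝓝 x, toCoord x₀ ((extChartAt 𝓘(ℝ, Model n) x₀).symm (extChartAt 𝓘(ℝ, Model n) x₀ x')) (Y ((extChartAt 𝓘(ℝ, Model n) x₀).symm (extChartAt 𝓘(ℝ, Model n) x₀ x'))) =
      Y' (extChartAt 𝓘(ℝ, Model n) x₀ x') := hc.eventually (by rw [hr]; exact hY)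
    filter_upwards [h1, (chartAt (Model n) x₀).open_source.mem_nhds hx] with x' h1 h2
    rw [(extChartAt 𝓘(ℝ, Model n) x₀).left_inv (by rwa [extChartAt_source])] at h1
    rw [← ofCoord_toCoord h2 (Y x'), h1, Finset.sum_apply]
    simp only [Pi.smul_apply', frameSection_eq_ofCoord, ← map_smul, ← map_sum, g]
    rw [hsum]
  have hYd : DiffFieldAt Y x := diffFieldAt_of_coord hy hY hd
  rw [cov.isCovariantDerivativeOnUniv.congr_of_eventuallyEq hYd hs.1 Filter.univ_mem heq, hs.2 v]
  simp only [hgv, map_sum, map_add, map_smul, Finset.sum_add_distrib, frameSection_eq_ofCoord,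
    toCoord_ofCoord hx, hsum]
  rw [add_comm]
  congr 1
  conv_rhs => rw [← hsum (Y' y)]
  simp only [map_sum, map_smul]
  refine Finset.sum_congr rfl fun i _ ↦ ?_
  rw [connForm_apply, ← hxdef, ofCoord_toCoord hx]
  simp only [g, hr]

end BaseCoordinates

/-! ### Smoothness, torsion and parallelism in coordinates. -/

section BaseGeometry

variable {n : ℕ} {M : Type*} [TopologicalSpace M]
  [ChartedSpace (EuclideanSpace ℝ (Fin (2 * n))) M] [IsManifold 𝓘(ℝ, Model n) ∞ M]
  {σ : BilinField (Model n) M} {cov : LinearConnection n M}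

/-- `IsFlat` quantifies over globally smooth fields, so coordinate frame fields must be cut off by a
bump function; the smoothness of the connection is exploited in the same way. -/
lemma exists_smoothField_eq_frameSection [T2Space M] {x₀ x₁ : M}
    (hx : x₁ ∈ (chartAt (Model n) x₀).source) (w : Model n) :
    ∃ Y : Π x : M, TangentSpace 𝓘(ℝ, Model n) x, SmoothField Y ∧
      ∀ᶠ x in 𝓝 x₁, Y x = frameSection x₀ w x := by
  obtain ⟨f, -, hf⟩ := (SmoothBumpFunction.nhds_basis_tsupport (I := 𝓘(ℝ, Model n)) x₁).mem_iff.1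
    ((chartAt (Model n) x₀).open_source.mem_nhds hx)
  refine ⟨(f : M → ℝ) • frameSection x₀ w, ?_, ?_⟩
  · exact f.contMDiff.contMDiffOn.smul_section_of_tsupport (chartAt (Model n) x₀).open_source hf
      fun x hx ↦ (contMDiffAt_ofCoord hx w).contMDiffWithinAt
  · filter_upwards [f.eventuallyEq_one] with x hx
    simp [hx]

lemma SmoothField.diffFieldAt {Y : Π x : M, TangentSpace 𝓘(ℝ, Model n) x} (hY : SmoothField Y)
    (x : M) : DiffFieldAt Y x :=
  (hY x).mdifferentiableAt (by simp)

lemma contDiffOn_connForm [T2Space M] (hcov : CovariantDerivative.ContMDiffCovariantDerivative cov ∞)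
    (x₀ : M) : ContDiffOn ℝ ∞ (connForm cov x₀) (extChartAt 𝓘(ℝ, Model n) x₀).target := by
  refine contDiffOn_clm_apply.2 fun v ↦ contDiffOn_clm_apply.2 fun w ↦ ?_
  intro y hy
  have hx := symm_mem_source hy
  obtain ⟨Y, hY, hYw⟩ := exists_smoothField_eq_frameSection hx w
  have h1 := (hcov.contMDiff.contMDiff (σ := Y) (by exact hY.contMDiffOn)).contMDiffAt
    (Filter.univ_mem (f := 𝓝 ((extChartAt 𝓘(ℝ, Model n) x₀).symm y)))
  have h2 : ContMDiffAt 𝓘(ℝ, Model n) (𝓘(ℝ, Model n).prod 𝓘(ℝ, Model n)) ∞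
      (fun x ↦ (TotalSpace.mk' (Model n) x (cov Y x (ofCoord x₀ x v)) :
        TangentBundle 𝓘(ℝ, Model n) M)) ((extChartAt 𝓘(ℝ, Model n) x₀).symm y) :=
    h1.clm_bundle_apply (contMDiffAt_ofCoord hx v)
  rw [contMDiffAt_field_iff hx, contMDiffAt_iff_contDiffAt_chart hy] at h2
  refine (h2.congr_of_eventuallyEq ?_).contDiffWithinAt
  have hc : ContinuousAt (extChartAt 𝓘(ℝ, Model n) x₀).symm y := continuousAt_extChartAt_symm'' hy
  filter_upwards [hc.eventually (eventually_eventually_nhds.2 hYw),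
    (isOpen_extChartAt_target (I := 𝓘(ℝ, Model n)) x₀).mem_nhds hy] with y' hy' hyt
  rw [connForm_apply, cov.isCovariantDerivativeOnUniv.congr_of_eventuallyEq (hY.diffFieldAt _)
    (diffFieldAt_frameSection (symm_mem_source hyt) w) Filter.univ_mem hy']

/-- The pullback by the inverse chart makes the frame fields constant, and constant fields commute;
invertibility of the differential carries this back to M. -/
lemma mlieBracket_frameSection {x₀ : M} {y : Model n}
    (hy : y ∈ (extChartAt 𝓘(ℝ, Model n) x₀).target) (v w : Model n) :
    VectorField.mlieBracket 𝓘(ℝ, Model n) (frameSection x₀ v) (frameSection x₀ w)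
      ((extChartAt 𝓘(ℝ, Model n) x₀).symm y) = 0 := by
  have hx := symm_mem_source hy
  have ho := (isOpen_extChartAt_target (I := 𝓘(ℝ, Model n)) x₀).mem_nhds hy
  haveI : IsManifold 𝓘(ℝ, Model n) (minSmoothness ℝ 2) M := by
    rw [minSmoothness_of_isRCLikeNormedField]
    exact IsManifold.of_le (n := ∞) (WithTop.coe_le_coe.2 (le_top : (2 : ℕ∞) ≤ ⊤))
  have h1 := VectorField.mpullback_mlieBracket (I := 𝓘(ℝ, Model n)) (x₀ := y) (n := ∞)
    (f := (extChartAt 𝓘(ℝ, Model n) x₀).symm) (V := frameSection x₀ v) (W := frameSection x₀ w)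
    (diffFieldAt_frameSection hx v) (diffFieldAt_frameSection hx w)
    ((contMDiffOn_extChartAt_symm x₀).contMDiffAt ho)
    (by simpa using WithTop.coe_le_coe.2 (le_top : (2 : ℕ∞) ≤ ⊤))
  have hinv {y : Model n} (hy : y ∈ (extChartAt 𝓘(ℝ, Model n) x₀).target) :=
    isInvertible_mfderivWithin_extChartAt_symm (I := 𝓘(ℝ, Model n)) hy
  simp only [modelWithCornersSelf_coe, Set.range_id, mfderivWithin_univ] at hinv
  have h2 (w : Model n) : VectorField.mpullback 𝓘(ℝ, Model n) 𝓘(ℝ, Model n)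
      (extChartAt 𝓘(ℝ, Model n) x₀).symm (frameSection x₀ w) =ᶠ[𝓝 y] fun _ ↦ w := by
    filter_upwards [ho] with y' hy'
    rw [VectorField.mpullback_apply, frameSection_eq_ofCoord]
    have h3 := hinv hy'
    obtain ⟨L, hL⟩ := h3
    have h4 : ofCoord x₀ ((extChartAt 𝓘(ℝ, Model n) x₀).symm y') w = L w := by
      rw [← mfderiv_extChartAt_symm hy', ← hL]; rfl
    rw [h4, ← hL, ContinuousLinearMap.inverse_equiv]
    exact L.symm_apply_apply w
  rw [Filter.EventuallyEq.mlieBracket_vectorField_eq (h2 v) (h2 w),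
    VectorField.mpullback_apply] at h1
  have h5 : VectorField.mlieBracket 𝓘(ℝ, Model n)
      (fun x ↦ (v : TangentSpace 𝓘(ℝ, Model n) x)) (fun x ↦ (w : TangentSpace 𝓘(ℝ, Model n) x))
      y = 0 := by
    have h6 := congrFun (VectorField.mlieBracketWithin_eq_lieBracketWithin (𝕜 := ℝ)
      (E := Model n) (V := fun _ ↦ v) (W := fun _ ↦ w) (s := Set.univ)) y
    refine Eq.trans h6 ?_
    simp [VectorField.lieBracketWithin]
    rfl
  rw [h5] at h1
  obtain ⟨L, hL⟩ := hinv hy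
  rw [← hL, ContinuousLinearMap.inverse_equiv] at h1
  exact (map_eq_zero_iff L.symm L.symm.injective).1 h1

lemma connForm_symm (htor : cov.torsion = 0) {x₀ : M} {y : Model n}
    (hy : y ∈ (extChartAt 𝓘(ℝ, Model n) x₀).target) (v w : Model n) :
    connForm cov x₀ y v w = connForm cov x₀ y w v := by
  have hx := symm_mem_source hy
  have h := (CovariantDerivative.torsion_eq_zero_iff cov).1 htor (diffFieldAt_frameSection hx v)
    (diffFieldAt_frameSection hx w)
  rw [mlieBracket_frameSection hy, sub_eq_zero] at h
  rw [connForm_apply, connForm_apply]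
  exact congrArg _ h

-- This is ∇σ = 0 tested on two coordinate frame fields, whose components are constant.
set_option synthInstance.maxHeartbeats 200000 in
lemma fderiv_inChart_eq (hσ : IsTwoForm σ) (hcov : IsSymplecticConnection σ cov) {x₀ : M}
    {y : Model n} (hy : y ∈ (extChartAt 𝓘(ℝ, Model n) x₀).target) (v a b : Model n) :
    fderiv ℝ (inChart σ x₀) y v a b =
      inChart σ x₀ y (connForm cov x₀ y v a) b + inChart σ x₀ y a (connForm cov x₀ y v b) := by
  have hx := symm_mem_source hy
  have ho := (isOpen_extChartAt_target (I := 𝓘(ℝ, Model n)) x₀).mem_nhds hy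
  have hd : DifferentiableAt ℝ (inChart σ x₀) y :=
    ((contDiffOn_inChart hσ.smooth x₀).contDiffAt ho).differentiableAt (by simp)
  have h1 := hcov.parallel _ _ _ (diffFieldAt_frameSection hx a) (diffFieldAt_frameSection hx b)
    (ofCoord x₀ _ v)
  have hr := (extChartAt 𝓘(ℝ, Model n) x₀).right_inv hy
  have h2 := (mfderiv_eq_fderiv_chart hx (g := fun y ↦ inChart σ x₀ y a b)
    (f := fun x ↦ σ x (frameSection x₀ a x) (frameSection x₀ b x)) (by
      filter_upwards [(chartAt (Model n) x₀).open_source.mem_nhds hx] with x' hx'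
      have hx'' : x' ∈ (extChartAt 𝓘(ℝ, Model n) x₀).source := by rwa [extChartAt_source]
      rw [inChart_apply _ ((extChartAt 𝓘(ℝ, Model n) x₀).map_source hx''),
        (extChartAt 𝓘(ℝ, Model n) x₀).left_inv hx'']
      rfl) (by rw [hr]; fun_prop) (ofCoord x₀ _ v)).2
  rw [toCoord_ofCoord hx, hr] at h2
  have h3 : fderiv ℝ (fun y ↦ inChart σ x₀ y a b) y v = fderiv ℝ (inChart σ x₀) y v a b := by
    rw [← (HasLineDerivAt.clm_apply_const (HasLineDerivAt.clm_apply_const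
      (hd.hasFDerivAt.hasLineDerivAt v) a) b).lineDeriv]
    exact (DifferentiableAt.lineDeriv_eq_fderiv (by fun_prop)).symm
  rw [← h3, ← h2, inChart_apply _ hy, inChart_apply _ hy, connForm_apply, connForm_apply,
    ofCoord_toCoord hx, ofCoord_toCoord hx]
  exact h1

lemma inChart_self (hσ : IsTwoForm σ) {x₀ : M}
    {y : Model n} (hy : y ∈ (extChartAt 𝓘(ℝ, Model n) x₀).target) (u : Model n) :
    inChart σ x₀ y u u = 0 := by
  rw [inChart_apply _ hy]; exact hσ.alternating _ _

lemma inChart_nondegenerate (hσ : IsSymplecticForm σ) {x₀ : M}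
    {y : Model n} (hy : y ∈ (extChartAt 𝓘(ℝ, Model n) x₀).target) (u : Model n)
    (h : ∀ v, inChart σ x₀ y u v = 0) : u = 0 := by
  have hx := symm_mem_source hy
  rw [← toCoord_ofCoord hx u, hσ.nondegenerate _ (ofCoord x₀ _ u), map_zero]
  intro v
  have := h (toCoord x₀ _ v)
  rwa [inChart_apply _ hy, ofCoord_toCoord hx] at this

end BaseGeometry

/-! ### Curvature in coordinates. -/

section Curvature

variable {n : ℕ} {M : Type*} [TopologicalSpace M]
  [ChartedSpace (EuclideanSpace ℝ (Fin (2 * n))) M] [IsManifold 𝓘(ℝ, Model n) ∞ M]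
  {cov : LinearConnection n M}

lemma SmoothField.contDiffAt {Y : Π x : M, TangentSpace 𝓘(ℝ, Model n) x} (hY : SmoothField Y)
    {x₀ : M} {y : Model n} (hy : y ∈ (extChartAt 𝓘(ℝ, Model n) x₀).target) :
    ContDiffAt ℝ ∞ (fun y ↦ toCoord x₀ ((extChartAt 𝓘(ℝ, Model n) x₀).symm y)
      (Y ((extChartAt 𝓘(ℝ, Model n) x₀).symm y))) y := by
  have h := hY ((extChartAt 𝓘(ℝ, Model n) x₀).symm y)
  rwa [contMDiffAt_field_iff (symm_mem_source hy), contMDiffAt_iff_contDiffAt_chart hy] at h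

-- Apply `toCoord_cov` twice. Second derivatives of Z cancel by symmetry. The bracket is rewritten
-- as ∇_X Y - ∇_Y X by vanishing torsion, and with A symmetric all derivatives of X and Y cancel.
set_option synthInstance.maxHeartbeats 200000 in
set_option maxHeartbeats 800000 in
lemma toCoord_curvature [T2Space M] (hcov : CovariantDerivative.ContMDiffCovariantDerivative cov ∞)
    (htor : cov.torsion = 0) {X Y Z : Π x : M, TangentSpace 𝓘(ℝ, Model n) x}
    (hX : SmoothField X) (hY : SmoothField Y) (hZ : SmoothField Z) {x₀ : M} {y : Model n}
    (hy : y ∈ (extChartAt 𝓘(ℝ, Model n) x₀).target) :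
    toCoord x₀ ((extChartAt 𝓘(ℝ, Model n) x₀).symm y)
        (curvature cov X Y Z ((extChartAt 𝓘(ℝ, Model n) x₀).symm y)) =
      curvForm (connForm cov x₀) y
        (toCoord x₀ ((extChartAt 𝓘(ℝ, Model n) x₀).symm y)
          (X ((extChartAt 𝓘(ℝ, Model n) x₀).symm y)))
        (toCoord x₀ ((extChartAt 𝓘(ℝ, Model n) x₀).symm y)
          (Y ((extChartAt 𝓘(ℝ, Model n) x₀).symm y)))
        (toCoord x₀ ((extChartAt 𝓘(ℝ, Model n) x₀).symm y)
          (Z ((extChartAt 𝓘(ℝ, Model n) x₀).symm y))) := by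
  have ho := (isOpen_extChartAt_target (I := 𝓘(ℝ, Model n)) x₀).mem_nhds hy
  have hA := (contDiffOn_connForm hcov x₀).contDiffAt ho
  have hAd := (hA.differentiableAt (by simp)).hasFDerivAt
  have hsymm := connForm_symm htor hy
  set A := connForm cov x₀ with hAdef
  let hat (Y : Π x : M, TangentSpace 𝓘(ℝ, Model n) x) (y : Model n) : Model n :=
    toCoord x₀ ((extChartAt 𝓘(ℝ, Model n) x₀).symm y) (Y ((extChartAt 𝓘(ℝ, Model n) x₀).symm y))
  have hs {Y : Π x : M, TangentSpace 𝓘(ℝ, Model n) x} (hY : SmoothField Y) {y : Model n}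
    (hy : y ∈ (extChartAt 𝓘(ℝ, Model n) x₀).target) : ContDiffAt ℝ ∞ (hat Y) y := hY.contDiffAt hy
  have hc {Y : Π x : M, TangentSpace 𝓘(ℝ, Model n) x} (hY : SmoothField Y) {y : Model n}
      (hy : y ∈ (extChartAt 𝓘(ℝ, Model n) x₀).target)
      (v : TangentSpace 𝓘(ℝ, Model n) ((extChartAt 𝓘(ℝ, Model n) x₀).symm y)) :
      toCoord x₀ ((extChartAt 𝓘(ℝ, Model n) x₀).symm y)
        (cov Y ((extChartAt 𝓘(ℝ, Model n) x₀).symm y) v) =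
      fderiv ℝ (hat Y) y (toCoord x₀ _ v) + A y (toCoord x₀ _ v) (hat Y y) :=
    toCoord_cov hy (Filter.Eventually.of_forall fun _ ↦ rfl)
      ((hs hY hy).differentiableAt (by simp)) v
  have hd {Y : Π x : M, TangentSpace 𝓘(ℝ, Model n) x} (hY : SmoothField Y) :=
    ((hs hY hy).differentiableAt (by simp)).hasFDerivAt
  have hdd := ((hs hZ hy).fderiv_right (m := ∞) (by simp)).differentiableAt (by simp)
  have second {X Y : Π x : M, TangentSpace 𝓘(ℝ, Model n) x} (hX : SmoothField X)
      (hY : SmoothField Y) :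
      toCoord x₀ ((extChartAt 𝓘(ℝ, Model n) x₀).symm y)
        (cov (fun y ↦ cov Z y (Y y)) ((extChartAt 𝓘(ℝ, Model n) x₀).symm y)
          (X ((extChartAt 𝓘(ℝ, Model n) x₀).symm y))) =
      fderiv ℝ (fderiv ℝ (hat Z)) y (hat X y) (hat Y y) +
        fderiv ℝ (hat Z) y (fderiv ℝ (hat Y) y (hat X y)) +
        (fderiv ℝ A y (hat X y) (hat Y y) (hat Z y) +
          A y (fderiv ℝ (hat Y) y (hat X y)) (hat Z y) +
          A y (hat Y y) (fderiv ℝ (hat Z) y (hat X y))) +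
        A y (hat X y) (fderiv ℝ (hat Z) y (hat Y y) + A y (hat Y y) (hat Z y)) := by
    let f (y : Model n) : Model n :=
      fderiv ℝ (hat Z) y (hat Y y) + A y (hat Y y) (hat Z y)
    have hf : DifferentiableAt ℝ f y :=
      (hdd.clm_apply (hd hY).differentiableAt).add
        ((hAd.differentiableAt.clm_apply (hd hY).differentiableAt).clm_apply (hd hZ).differentiableAt)
    have h1 := toCoord_cov (cov := cov) hy (Y := fun y ↦ cov Z y (Y y)) (Y' := f) (by
      filter_upwards [ho] with y' hy'
      rw [hc hZ hy']) hf (X ((extChartAt 𝓘(ℝ, Model n) x₀).symm y))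
    rw [h1]
    congr 1
    have l1 := HasDerivAt.clm_apply (hasLineDerivAt_fderiv hdd (hat X y))
      ((hd hY).hasLineDerivAt (hat X y))
    have l0 := HasDerivAt.clm_apply (hasLineDerivAt_fderiv hAd.differentiableAt (hat X y))
      ((hd hY).hasLineDerivAt (hat X y))
    have l2 := HasDerivAt.clm_apply l0 ((hd hZ).hasLineDerivAt (hat X y))
    have l3 := HasDerivAt.unique (hf.hasFDerivAt.hasLineDerivAt (hat X y)) (l1.add l2)
    refine l3.trans ?_
    simp only [zero_smul, add_zero, ContinuousLinearMap.add_apply]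
  have hbr := (CovariantDerivative.torsion_eq_zero_iff cov).1 htor
    (hX.diffFieldAt ((extChartAt 𝓘(ℝ, Model n) x₀).symm y))
    (hY.diffFieldAt ((extChartAt 𝓘(ℝ, Model n) x₀).symm y))
  have hS : fderiv ℝ (fderiv ℝ (hat Z)) y (hat X y) (hat Y y) =
      fderiv ℝ (fderiv ℝ (hat Z)) y (hat Y y) (hat X y) :=
    ((hs hZ hy).isSymmSndFDerivAt (by
      simpa using WithTop.coe_le_coe.2 (le_top : (2 : ℕ∞) ≤ ⊤))).eq _ _
  rw [curvature, ← hbr, map_sub, map_sub, second hX hY, second hY hX, hc hZ hy, map_sub, hc hX hy,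
    hc hY hy, curvForm]
  change _ = (fderiv ℝ A y (hat X y) (hat Y y) - fderiv ℝ A y (hat Y y) (hat X y) +
    A y (hat X y) * A y (hat Y y) - A y (hat Y y) * A y (hat X y)) (hat Z y)
  change _ + _ + _ + _ - _ - (fderiv ℝ (hat Z) y (fderiv ℝ (hat Y) y (hat X y) +
    A y (hat X y) (hat Y y) - (fderiv ℝ (hat X) y (hat Y y) + A y (hat Y y) (hat X y))) +
    A y (fderiv ℝ (hat Y) y (hat X y) +
    A y (hat X y) (hat Y y) - (fderiv ℝ (hat X) y (hat Y y) + A y (hat Y y) (hat X y))) (hat Z y)) = _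
  rw [hS, hsymm (hat X y) (hat Y y)]
  simp only [ContinuousLinearMap.sub_apply, ContinuousLinearMap.add_apply, map_add, map_sub,
    mul_apply_eq_comp]
  abel

lemma isFlat_iff [T2Space M] (hcov : CovariantDerivative.ContMDiffCovariantDerivative cov ∞)
    (htor : cov.torsion = 0) :
    IsFlat cov ↔ ∀ x₀ : M, ∀ y ∈ (extChartAt 𝓘(ℝ, Model n) x₀).target, ∀ u v,
      curvForm (connForm cov x₀) y u v = 0 := by
  constructor
  · intro h x₀ y hy u v
    ext1 w
    have hx := symm_mem_source hy
    obtain ⟨X, hX, hXu⟩ := exists_smoothField_eq_frameSection hx u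
    obtain ⟨Y, hY, hYv⟩ := exists_smoothField_eq_frameSection hx v
    obtain ⟨Z, hZ, hZw⟩ := exists_smoothField_eq_frameSection hx w
    have h1 := toCoord_curvature hcov htor hX hY hZ hy
    rw [h X Y Z hX hY hZ, map_zero, hXu.self_of_nhds, hYv.self_of_nhds, hZw.self_of_nhds] at h1
    simp only [frameSection_eq_ofCoord, toCoord_ofCoord hx] at h1
    exact h1.symm
  · intro h X Y Z hX hY hZ x
    have hy := mem_extChartAt_target (I := 𝓘(ℝ, Model n)) x
    have h1 := toCoord_curvature hcov htor hX hY hZ hy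
    rw [h x _ hy, ContinuousLinearMap.zero_apply,
      (extChartAt 𝓘(ℝ, Model n) x).left_inv (mem_extChartAt_source x)] at h1
    rw [← ofCoord_toCoord (mem_chart_source (Model n) x) (curvature cov X Y Z x), h1, map_zero]

end Curvature

/-! ### Model spaces and their splittings into base and fibre coordinates. -/

section ModelSpaces

/-- A linear complex structure on the model space, orthogonal for the Euclidean inner product. -/
def stdJ (n : ℕ) : Model n →L[ℝ] Model n := (exists_standard n).choose

lemma isOrthComplex_stdJ (n : ℕ) : IsOrthComplex (stdJ n) := (exists_standard n).choose_spec.1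

lemma finrank_symAnti_stdJ (n : ℕ) : Module.finrank ℝ (symAnti (stdJ n)) = n * (n + 1) :=
  (exists_standard n).choose_spec.2

/-- The model space of the twistor space as a product. -/
def modelEquiv (n : ℕ) : TModel n ≃L[ℝ] Model n × symAnti (stdJ n) :=
  ContinuousLinearEquiv.ofFinrankEq (by
    rw [Module.finrank_prod, finrank_symAnti_stdJ, finrank_euclideanSpace_fin,
      finrank_euclideanSpace_fin])

/-- A complement of the space of fibre coordinates. -/
def modelCompl (n : ℕ) : Submodule ℝ (Model n →L[ℝ] Model n) :=
  (Submodule.exists_isCompl (symAnti (stdJ n))).choose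

lemma isCompl_modelCompl (n : ℕ) : IsCompl (symAnti (stdJ n)) (modelCompl n) :=
  (Submodule.exists_isCompl (symAnti (stdJ n))).choose_spec

/-- A linear equivalence of a product of finite dimensional normed spaces with a normed space,
as a continuous linear equivalence. -/
def splitEquiv {T F' G : Type*} [NormedAddCommGroup T] [NormedSpace ℝ T] [NormedAddCommGroup F']
    [NormedSpace ℝ F'] [NormedAddCommGroup G] [NormedSpace ℝ G] [FiniteDimensional ℝ T]
    [FiniteDimensional ℝ F'] (L : (T × F') ≃ₗ[ℝ] G) : (T × F') ≃L[ℝ] G :=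
  L.toContinuousLinearEquiv

/-- The splitting of the model space of `End(TM)`, as a linear equivalence. -/
def ambientLinearEquiv (n : ℕ) :
    (TModel n × modelCompl n) ≃ₗ[ℝ] Model n × (Model n →L[ℝ] Model n) :=
  ((modelEquiv n).toLinearEquiv.prodCongr (LinearEquiv.refl ℝ (modelCompl n))).trans
    ((LinearEquiv.prodAssoc ℝ _ _ _).trans ((LinearEquiv.refl ℝ _).prodCongr
      (Submodule.prodEquivOfIsCompl _ _ (isCompl_modelCompl n))))

/-- The splitting of the model space of `End(TM)`. -/
def ambientEquiv (n : ℕ) :=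
  splitEquiv (T := TModel n) (F' := modelCompl n) (G := Model n × (Model n →L[ℝ] Model n))
    (ambientLinearEquiv n)

/-- The base coordinates. -/
def baseMap (n : ℕ) : TModel n →L[ℝ] Model n :=
  (ContinuousLinearMap.fst ℝ _ _).comp (modelEquiv n : TModel n →L[ℝ] Model n × symAnti (stdJ n))

/-- The fibre coordinates. -/
def fibreMap (n : ℕ) : TModel n →L[ℝ] Model n →L[ℝ] Model n :=
  (symAnti (stdJ n)).subtypeL.comp ((ContinuousLinearMap.snd ℝ _ _).comp
    (modelEquiv n : TModel n →L[ℝ] Model n × symAnti (stdJ n)))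

/-- The coordinates on the slice. -/
def sliceMap (n : ℕ) : Model n × (Model n →L[ℝ] Model n) →L[ℝ] TModel n :=
  (ContinuousLinearMap.fst ℝ _ _).comp (ambientEquiv n).symm.toContinuousLinearMap

variable {n : ℕ}

lemma fibreMap_mem (t : TModel n) : fibreMap n t ∈ symAnti (stdJ n) := (modelEquiv n t).2.2

lemma ambientEquiv_zero (t : TModel n) : ambientEquiv n (t, 0) = (baseMap n t, fibreMap n t) := by
  change ambientLinearEquiv n (t, 0) = _
  simp [ambientLinearEquiv, baseMap, fibreMap]

lemma ambientEquiv_symm_snd {y : Model n} {X : Model n →L[ℝ] Model n} :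
    ((ambientEquiv n).symm (y, X)).2 = 0 ↔ X ∈ symAnti (stdJ n) := by
  constructor
  · intro h
    have h1 : (y, X) = ambientEquiv n (((ambientEquiv n).symm (y, X)).1, 0) := by
      rw [← h, Prod.mk.eta, ContinuousLinearEquiv.apply_symm_apply]
    rw [ambientEquiv_zero] at h1
    have h2 : X = fibreMap n _ := congrArg Prod.snd h1
    rw [h2]
    exact fibreMap_mem _
  · intro h
    have h1 : (y, X) = ambientEquiv n ((modelEquiv n).symm (y, ⟨X, h⟩), 0) := by
      rw [ambientEquiv_zero]
      simp [baseMap, fibreMap]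
    rw [h1, ContinuousLinearEquiv.symm_apply_apply]

lemma ambientEquiv_sliceMap {y : Model n} {X : Model n →L[ℝ] Model n}
    (hX : X ∈ symAnti (stdJ n)) : ambientEquiv n (sliceMap n (y, X), 0) = (y, X) := by
  have h : ((ambientEquiv n).symm (y, X)).2 = 0 := ambientEquiv_symm_snd.2 hX
  change ambientEquiv n (((ambientEquiv n).symm (y, X)).1, 0) = (y, X)
  rw [← h, Prod.mk.eta, ContinuousLinearEquiv.apply_symm_apply]

lemma baseMap_sliceMap {y : Model n} {X : Model n →L[ℝ] Model n}
    (hX : X ∈ symAnti (stdJ n)) : baseMap n (sliceMap n (y, X)) = y := by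
  have := ambientEquiv_sliceMap (y := y) hX
  rw [ambientEquiv_zero] at this
  exact (Prod.ext_iff.1 this).1

lemma fibreMap_sliceMap {y : Model n} {X : Model n →L[ℝ] Model n}
    (hX : X ∈ symAnti (stdJ n)) : fibreMap n (sliceMap n (y, X)) = X := by
  have := ambientEquiv_sliceMap (y := y) hX
  rw [ambientEquiv_zero] at this
  exact (Prod.ext_iff.1 this).2

set_option synthInstance.maxHeartbeats 200000 in
lemma sliceMap_ambientEquiv (t : TModel n) : sliceMap n (baseMap n t, fibreMap n t) = t := by
  rw [← ambientEquiv_zero]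
  simp [sliceMap]

end ModelSpaces

/-! ### Cayley charts on the model of the endomorphism bundle. -/

section CayleyChart

variable {E : Type*} [NormedAddCommGroup E] [InnerProductSpace ℝ E] [FiniteDimensional ℝ E]
  {j : E →L[ℝ] E} {g : E → E →L[ℝ] E} {T : Set E}

/-- Conjugation by the frame `g`, followed by the Cayley transform. -/
def cayleyMap (j : E →L[ℝ] E) (g : E → E →L[ℝ] E) (p : E × (E →L[ℝ] E)) : E × (E →L[ℝ] E) :=
  (p.1, cayley j (g p.1 * p.2 * Ring.inverse (g p.1)))

/-- The inverse of `cayleyMap`. -/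
def cayleyMapInv (j : E →L[ℝ] E) (g : E → E →L[ℝ] E) (p : E × (E →L[ℝ] E)) : E × (E →L[ℝ] E) :=
  (p.1, Ring.inverse (g p.1) * cayleyInv j p.2 * g p.1)

/-- The domain of `cayleyMap`. -/
def cayleySource (j : E →L[ℝ] E) (g : E → E →L[ℝ] E) (T : Set E) : Set (E × (E →L[ℝ] E)) :=
  {p | p.1 ∈ T ∧ IsUnit (1 - j * (g p.1 * p.2 * Ring.inverse (g p.1))) ∧ ‖(cayleyMap j g p).2‖ < 1}

/-- The range of `cayleyMap`. -/
def cayleyTarget (T : Set E) : Set (E × (E →L[ℝ] E)) := {p | p.1 ∈ T ∧ ‖p.2‖ < 1}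

lemma contDiffAt_ringInverse_comp {W : Type*} [NormedAddCommGroup W] [NormedSpace ℝ W]
    {f : W → E →L[ℝ] E} {w : W} (hf : ContDiffAt ℝ ∞ f w) (hu : IsUnit (f w)) :
    ContDiffAt ℝ ∞ (fun w ↦ Ring.inverse (f w)) w := by
  obtain ⟨u, hu⟩ := hu
  have := contDiffAt_ringInverse ℝ u (n := ∞)
  rw [hu] at this
  exact this.comp w hf

lemma contDiffAt_frame (hT : IsOpen T) (hg : ContDiffOn ℝ ∞ g T) (hu : ∀ y ∈ T, IsUnit (g y))
    {p : E × (E →L[ℝ] E)} (hp : p.1 ∈ T) :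
    ContDiffAt ℝ ∞ (fun p : E × (E →L[ℝ] E) ↦ g p.1) p ∧
    ContDiffAt ℝ ∞ (fun p : E × (E →L[ℝ] E) ↦ Ring.inverse (g p.1)) p := by
  have h1 : ContDiffAt ℝ ∞ (fun p : E × (E →L[ℝ] E) ↦ g p.1) p :=
    ContDiffAt.comp p (hg.contDiffAt (hT.mem_nhds hp)) contDiffAt_fst
  exact ⟨h1, contDiffAt_ringInverse_comp h1 (hu _ hp)⟩

lemma contDiffAt_conj (hT : IsOpen T) (hg : ContDiffOn ℝ ∞ g T) (hu : ∀ y ∈ T, IsUnit (g y))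
    {p : E × (E →L[ℝ] E)} (hp : p.1 ∈ T) :
    ContDiffAt ℝ ∞ (fun p : E × (E →L[ℝ] E) ↦ 1 - j * (g p.1 * p.2 * Ring.inverse (g p.1))) p ∧
    ContDiffAt ℝ ∞ (fun p : E × (E →L[ℝ] E) ↦ 1 + j * (g p.1 * p.2 * Ring.inverse (g p.1))) p := by
  obtain ⟨h1, h2⟩ := contDiffAt_frame hT hg hu hp
  have h3 : ContDiffAt ℝ ∞ (fun p : E × (E →L[ℝ] E) ↦ j * (g p.1 * p.2 * Ring.inverse (g p.1))) p :=
    contDiffAt_const.clm_comp ((h1.clm_comp contDiffAt_snd).clm_comp h2)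
  exact ⟨contDiffAt_const.sub h3, contDiffAt_const.add h3⟩

lemma contDiffAt_cayleyMap (hT : IsOpen T) (hg : ContDiffOn ℝ ∞ g T) (hu : ∀ y ∈ T, IsUnit (g y))
    {p : E × (E →L[ℝ] E)} (hp : p.1 ∈ T)
    (hp' : IsUnit (1 - j * (g p.1 * p.2 * Ring.inverse (g p.1)))) :
    ContDiffAt ℝ ∞ (cayleyMap j g) p := by
  obtain ⟨h1, h2⟩ := contDiffAt_conj (j := j) hT hg hu hp
  exact contDiffAt_fst.prodMk (h2.clm_comp (contDiffAt_ringInverse_comp h1 hp'))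

lemma contDiffAt_cayleyInv {W : Type*} [NormedAddCommGroup W] [NormedSpace ℝ W]
    {f : W → E →L[ℝ] E} {w : W} (hf : ContDiffAt ℝ ∞ f w) (hu : IsUnit (1 + f w)) :
    ContDiffAt ℝ ∞ (fun w ↦ cayleyInv j (f w)) w := by
  have h1 : ContDiffAt ℝ ∞ (fun w ↦ 1 + f w) w := contDiffAt_const.add hf
  exact (contDiffAt_const.clm_comp (contDiffAt_const.sub hf)).clm_comp
    (contDiffAt_ringInverse_comp h1 hu)

lemma contDiffAt_cayleyMapInv (hT : IsOpen T) (hg : ContDiffOn ℝ ∞ g T)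
    (hu : ∀ y ∈ T, IsUnit (g y)) {p : E × (E →L[ℝ] E)} (hp : p ∈ cayleyTarget T) :
    ContDiffAt ℝ ∞ (cayleyMapInv j g) p := by
  obtain ⟨h1, h2⟩ := contDiffAt_frame hT hg hu hp.1
  exact contDiffAt_fst.prodMk ((h2.clm_comp (contDiffAt_cayleyInv contDiffAt_snd
    (isUnit_one_add_of_norm_lt_one hp.2))).clm_comp h1)

lemma isOpen_cayleyTarget (hT : IsOpen T) : IsOpen (cayleyTarget T) :=
  (hT.preimage continuous_fst).inter
    (isOpen_lt (continuous_norm.comp continuous_snd) continuous_const)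

/-- The conditions are imposed in turn, since continuity of each is known only where the preceding
ones hold. -/
lemma isOpen_cayleySource (hT : IsOpen T) (hg : ContDiffOn ℝ ∞ g T) (hu : ∀ y ∈ T, IsUnit (g y)) :
    IsOpen (cayleySource j g T) := by
  have hT' : IsOpen {p : E × (E →L[ℝ] E) | p.1 ∈ T} := hT.preimage continuous_fst
  have h1 : ContinuousOn (fun p : E × (E →L[ℝ] E) ↦
      1 - j * (g p.1 * p.2 * Ring.inverse (g p.1))) {p | p.1 ∈ T} := fun p hp ↦
    (contDiffAt_conj hT hg hu hp).1.continuousAt.continuousWithinAt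
  have h2 := h1.isOpen_inter_preimage hT' (Units.isOpen (R := E →L[ℝ] E))
  have h3 : ContinuousOn (fun p ↦ (cayleyMap j g p).2) ({p : E × (E →L[ℝ] E) | p.1 ∈ T} ∩
      (fun p ↦ 1 - j * (g p.1 * p.2 * Ring.inverse (g p.1))) ⁻¹' {x | IsUnit x}) := fun p hp ↦
    (continuous_snd.continuousAt.comp
      (contDiffAt_cayleyMap hT hg hu hp.1 hp.2).continuousAt).continuousWithinAt
  have h4 := h3.isOpen_inter_preimage h2 (Metric.isOpen_ball (x := 0) (ε := 1))
  convert h4 using 1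
  ext p
  simp only [cayleySource, Set.mem_setOf_eq, Set.mem_inter_iff, Set.mem_preimage,
    mem_ball_zero_iff, and_assoc]

lemma cayleyMapInv_cayleyMap (hj : j * j = -1) (hu : ∀ y ∈ T, IsUnit (g y))
    {p : E × (E →L[ℝ] E)} (hp : p ∈ cayleySource j g T) :
    cayleyMapInv j g (cayleyMap j g p) = p := by
  refine Prod.ext rfl ?_
  have h := hu _ hp.1
  simp only [cayleyMapInv, cayleyMap]
  rw [cayleyInv_cayley hj hp.2.1, mul_assoc, mul_assoc, mul_assoc, Ring.inverse_mul_cancel _ h,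
    mul_one, ← mul_assoc, Ring.inverse_mul_cancel _ h, one_mul]

lemma conj_cayleyMapInv (hu : ∀ y ∈ T, IsUnit (g y)) {p : E × (E →L[ℝ] E)} (hp : p.1 ∈ T) :
    g p.1 * (cayleyMapInv j g p).2 * Ring.inverse (g p.1) = cayleyInv j p.2 := by
  have h := hu _ hp
  simp only [cayleyMapInv]
  rw [mul_assoc, mul_assoc, mul_assoc, Ring.mul_inverse_cancel _ h, mul_one, ← mul_assoc,
    Ring.mul_inverse_cancel _ h, one_mul]

lemma cayleyMap_cayleyMapInv (hj : j * j = -1) (hu : ∀ y ∈ T, IsUnit (g y))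
    {p : E × (E →L[ℝ] E)} (hp : p ∈ cayleyTarget T) :
    cayleyMap j g (cayleyMapInv j g p) = p := by
  refine Prod.ext rfl ?_
  have h1 := conj_cayleyMapInv (j := j) hu hp.1
  change cayley j (g p.1 * (cayleyMapInv j g p).2 * Ring.inverse (g p.1)) = p.2
  rw [h1, cayley_cayleyInv hj (isUnit_one_add_of_norm_lt_one hp.2)]

/-- The local diffeomorphism `cayleyMap`. -/
def cayleyChart (hj : j * j = -1) (hT : IsOpen T) (hg : ContDiffOn ℝ ∞ g T)
    (hu : ∀ y ∈ T, IsUnit (g y)) :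
    OpenPartialHomeomorph (ModelProd E (E →L[ℝ] E)) (ModelProd E (E →L[ℝ] E)) where
  toFun := cayleyMap j g
  invFun := cayleyMapInv j g
  source := cayleySource j g T
  target := cayleyTarget T
  map_source' p hp := ⟨hp.1, hp.2.2⟩
  map_target' p hp := by
    refine ⟨hp.1, ?_, ?_⟩
    · change IsUnit (1 - j * (g p.1 * (cayleyMapInv j g p).2 * Ring.inverse (g p.1)))
      rw [conj_cayleyMapInv hu hp.1]
      exact isUnit_one_sub_cayleyInv hj (isUnit_one_add_of_norm_lt_one hp.2)
    · rw [cayleyMap_cayleyMapInv hj hu hp]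
      exact hp.2
  left_inv' p hp := cayleyMapInv_cayleyMap hj hu hp
  right_inv' p hp := cayleyMap_cayleyMapInv hj hu hp
  open_source := isOpen_cayleySource hT hg hu
  open_target := isOpen_cayleyTarget hT
  continuousOn_toFun := fun p hp ↦
    (contDiffAt_cayleyMap hT hg hu hp.1 hp.2.1).continuousAt.continuousWithinAt
  continuousOn_invFun := fun p hp ↦
    (contDiffAt_cayleyMapInv hT hg hu hp).continuousAt.continuousWithinAt

lemma cayleyChart_mem_contDiffGroupoid (hj : j * j = -1) (hT : IsOpen T) (hg : ContDiffOn ℝ ∞ g T)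
    (hu : ∀ y ∈ T, IsUnit (g y)) :
    cayleyChart hj hT hg hu ∈ contDiffGroupoid ∞ (𝓘(ℝ, E).prod 𝓘(ℝ, E →L[ℝ] E)) := by
  rw [contDiffGroupoid, mem_groupoid_of_pregroupoid]
  constructor
  · change ContDiffOn ℝ ∞ (cayleyMap j g) _
    rintro p ⟨hp, -⟩
    have hp' : p ∈ cayleySource j g T := hp
    exact (contDiffAt_cayleyMap hT hg hu hp'.1 hp'.2.1).contDiffWithinAt
  · change ContDiffOn ℝ ∞ (cayleyMapInv j g) _
    rintro p ⟨hp, -⟩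
    have hp' : p ∈ cayleyTarget T := hp
    exact (contDiffAt_cayleyMapInv hT hg hu hp').contDiffWithinAt

end CayleyChart

lemma trans_mem_maximalAtlas {H N : Type*} [TopologicalSpace H] [TopologicalSpace N]
    [ChartedSpace H N] {G : StructureGroupoid H} [HasGroupoid N G]
    {e : OpenPartialHomeomorph N H} (he : e ∈ G.maximalAtlas N) {f : OpenPartialHomeomorph H H}
    (hf : f ∈ G) : e ≫ₕ f ∈ G.maximalAtlas N := by
  intro e' he'
  have h1 := (mem_maximalAtlas_iff.1 he e' he')
  constructor
  · rw [OpenPartialHomeomorph.trans_symm_eq_symm_trans_symm, OpenPartialHomeomorph.trans_assoc]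
    exact G.trans (G.symm hf) h1.1
  · rw [← OpenPartialHomeomorph.trans_assoc]
    exact G.trans h1.2 hf

/-! ### Charts of the twistor space. -/

section TwistorCharts

variable {n : ℕ} {M : Type*} [TopologicalSpace M]
  [ChartedSpace (EuclideanSpace ℝ (Fin (2 * n))) M] [IsManifold 𝓘(ℝ, Model n) ∞ M]
  {σ : BilinField (Model n) M}

scoped instance (priority := high) instTopologicalSpaceTwistorSpace :
    TopologicalSpace (TwistorSpace σ) := instTopologicalSpaceSubtype

/-- A local frame in which the symplectic form becomes the standard one. -/
structure SympFrame (σ : BilinField (Model n) M) (x₀ : M) where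
  dom : Set (Model n)
  g : Model n → Model n →L[ℝ] Model n
  isOpen_dom : IsOpen dom
  mem_dom : extChartAt 𝓘(ℝ, Model n) x₀ x₀ ∈ dom
  dom_subset : dom ⊆ (extChartAt 𝓘(ℝ, Model n) x₀).target
  contDiffOn_g : ContDiffOn ℝ ∞ g dom
  isUnit_g : ∀ y ∈ dom, IsUnit (g y)
  inChart_eq : ∀ y ∈ dom, ∀ u v, inChart σ x₀ y u v = inner ℝ (stdJ n (g y u)) (g y v)

lemma nonempty_sympFrame (hσ : IsSymplecticForm σ) (x₀ : M) : Nonempty (SympFrame σ x₀) := by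
  obtain ⟨T, g, h1, h2, h3, h4, h5⟩ := exists_symplectic_frame (isOrthComplex_stdJ n)
    (isOpen_extChartAt_target (I := 𝓘(ℝ, Model n)) x₀)
    (contDiffOn_inChart hσ.isTwoForm.smooth x₀) (fun y hy u ↦ inChart_self hσ.isTwoForm hy u)
    (fun y hy u h ↦ inChart_nondegenerate hσ hy u h) (mem_extChartAt_target x₀)
  exact ⟨⟨T, g, h1, h2, h3, h4, fun y hy ↦ (h5 y hy).1, fun y hy ↦ (h5 y hy).2⟩⟩

/-- The components of an endomorphism of `T_x M` in the preferred chart at `x₀`. -/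
def endCoord (x₀ x : M) (p : TangentSpace 𝓘(ℝ, Model n) x →L[ℝ] TangentSpace 𝓘(ℝ, Model n) x) :
    Model n →L[ℝ] Model n :=
  (toCoord x₀ x).comp (p.comp (ofCoord x₀ x))

lemma endCoord_apply (x₀ x : M)
    (p : TangentSpace 𝓘(ℝ, Model n) x →L[ℝ] TangentSpace 𝓘(ℝ, Model n) x) (u : Model n) :
    endCoord x₀ x p u = toCoord x₀ x (p (ofCoord x₀ x u)) := rfl

/-- The expression of the canonical section in a chart of the twistor space. -/
def jCoord {x₀ : M} (f : SympFrame σ x₀) (t : TModel n) : Model n →L[ℝ] Model n :=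
  Ring.inverse (f.g (baseMap n t)) * cayleyInv (stdJ n) (fibreMap n t) * f.g (baseMap n t)

/-- The frame, composed with the components in the chart, is an isomorphism carrying σ to ⟪j·, ·⟫,
so it transports compatible structures by conjugation. -/
lemma isCompatible_iff {x₀ x : M} (f : SympFrame σ x₀) (hx : x ∈ (chartAt (Model n) x₀).source)
    (hf : extChartAt 𝓘(ℝ, Model n) x₀ x ∈ f.dom)
    (p : TangentSpace 𝓘(ℝ, Model n) x →L[ℝ] TangentSpace 𝓘(ℝ, Model n) x) :
    IsCompatible σ x p ↔ IsStdCompatible (stdJ n) (f.g (extChartAt 𝓘(ℝ, Model n) x₀ x) *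
      endCoord x₀ x p * Ring.inverse (f.g (extChartAt 𝓘(ℝ, Model n) x₀ x))) := by
  set y := extChartAt 𝓘(ℝ, Model n) x₀ x with hy
  have hxs : (extChartAt 𝓘(ℝ, Model n) x₀).symm y = x :=
    (extChartAt 𝓘(ℝ, Model n) x₀).left_inv (by rwa [extChartAt_source])
  have hu := f.isUnit_g y hf
  set g := f.g y
  set gi := Ring.inverse g
  have h1 (u) : g (gi u) = u := congrArg (fun f : Model n →L[ℝ] Model n ↦ f u)
    (Ring.mul_inverse_cancel _ hu)
  have h2 (u) : gi (g u) = u := congrArg (fun f : Model n →L[ℝ] Model n ↦ f u)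
    (Ring.inverse_mul_cancel _ hu)
  have hσ (u v : TangentSpace 𝓘(ℝ, Model n) x) :
      σ x u v = inner ℝ (stdJ n (g (toCoord x₀ x u))) (g (toCoord x₀ x v)) := by
    rw [← f.inChart_eq y hf, inChart_apply _ (f.dom_subset hf)]
    rw [hxs, ofCoord_toCoord hx, ofCoord_toCoord hx]
  have hc (u : TangentSpace 𝓘(ℝ, Model n) x) :
      (g * endCoord x₀ x p * gi) (g (toCoord x₀ x u)) = g (toCoord x₀ x (p u)) := by
    simp only [mul_apply_eq_comp, h2, endCoord_apply, ofCoord_toCoord hx]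
  have hsurj (u : Model n) : ∃ v, g (toCoord x₀ x v) = u :=
    ⟨ofCoord x₀ x (gi u), by rw [toCoord_ofCoord hx, h1]⟩
  have hinj {u v : TangentSpace 𝓘(ℝ, Model n) x} (h : g (toCoord x₀ x u) = g (toCoord x₀ x v)) :
      u = v := by
    have := congrArg gi h
    rw [h2, h2] at this
    rw [← ofCoord_toCoord hx u, this, ofCoord_toCoord hx]
  set c := g * endCoord x₀ x p * gi
  constructor
  · intro h
    refine ⟨?_, fun u v ↦ ?_, fun u hu ↦ ?_⟩
    · ext1 u
      obtain ⟨u, rfl⟩ := hsurj u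
      rw [mul_apply_eq_comp, hc, hc, h.sq, map_neg, map_neg]
      rfl
    · obtain ⟨u, rfl⟩ := hsurj u
      obtain ⟨v, rfl⟩ := hsurj v
      rw [hc, hc, ← hσ, ← hσ, h.invariant]
    · obtain ⟨u, rfl⟩ := hsurj u
      rw [hc, ← hσ]
      refine h.positive u ?_
      rintro rfl
      simp at hu
  · intro h
    refine ⟨fun u ↦ hinj ?_, fun u v ↦ ?_, fun u hu ↦ ?_⟩
    · rw [← hc, ← hc, map_neg, map_neg]
      exact congrArg (fun f : Model n →L[ℝ] Model n ↦ f (g (toCoord x₀ x u))) h.sq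
    · rw [hσ, hσ, ← hc, ← hc, h.invariant]
    · rw [hσ, ← hc]
      refine h.positive _ fun h0 ↦ hu (hinj ?_)
      rw [h0, map_zero, map_zero]

lemma chartAt_endTM_apply (p₀ p : EndTM n M) :
    chartAt (ModelProd (Model n) (Model n →L[ℝ] Model n)) p₀ p =
      (extChartAt 𝓘(ℝ, Model n) p₀.proj p.proj, endCoord p₀.proj p.proj p.snd) := by
  rw [FiberBundle.chartedSpace_chartAt]
  simp
  rfl

lemma mem_chartAt_endTM_source {p₀ p : EndTM n M} :
    p ∈ (chartAt (ModelProd (Model n) (Model n →L[ℝ] Model n)) p₀).source ↔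
      p.proj ∈ (chartAt (Model n) p₀.proj).source := by
  rw [FiberBundle.chartedSpace_chartAt]
  simp
  exact id

/-- The chart of `End(TM)` in which the twistor space is a slice. -/
def twistorSliceChart {x₀ : M} (f : SympFrame σ x₀) (p₀ : EndTM n M) (hp : p₀.proj = x₀) :
    SliceChart (𝓘(ℝ, Model n).prod 𝓘(ℝ, Model n →L[ℝ] Model n))
      (fun p : EndTM n M ↦ IsCompatible σ p.proj p.snd) (ambientEquiv n) where
  chart := chartAt (ModelProd (Model n) (Model n →L[ℝ] Model n)) p₀ ≫ₕ
    cayleyChart (isOrthComplex_stdJ n).sq f.isOpen_dom f.contDiffOn_g f.isUnit_g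
  mem_maximalAtlas := trans_mem_maximalAtlas (IsManifold.chart_mem_maximalAtlas p₀)
    (cayleyChart_mem_contDiffGroupoid _ _ _ _)
  slice p hp' := by
    subst hp
    obtain ⟨h1, h2⟩ := hp'
    replace h1 := mem_chartAt_endTM_source.1 h1
    have h3 : (extChartAt 𝓘(ℝ, Model n) p₀.proj p.proj, endCoord p₀.proj p.proj p.snd) ∈
      cayleySource (stdJ n) f.g f.dom := by rw [← chartAt_endTM_apply]; exact h2
    rw [isCompatible_iff f h1 h3.1]
    change _ ↔ ((ambientEquiv n).symm (cayleyMap (stdJ n) f.g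
      (chartAt (ModelProd (Model n) (Model n →L[ℝ] Model n)) p₀ p))).2 = 0
    rw [chartAt_endTM_apply, cayleyMap, ambientEquiv_symm_snd]
    -- On the chart domain the Cayley transform X has ‖X‖ < 1, so the linear condition X ∈ `symAnti`
    -- alone characterises compatibility.
    constructor
    · intro h
      exact (cayley_mem_of_isStdCompatible (isOrthComplex_stdJ n) h).1
    · intro h
      have h4 := isStdCompatible_cayleyInv (isOrthComplex_stdJ n) h h3.2.2
      rwa [cayleyInv_cayley (isOrthComplex_stdJ n).sq h3.2.1] at h4

/-- The symplectic frame at a point. -/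
def sympFrame (hσ : IsSymplecticForm σ) (x₀ : M) : SympFrame σ x₀ := (nonempty_sympFrame hσ x₀).some

/-- The slice charts defining the manifold structure of the twistor space. -/
def twistorSlices (hσ : IsSymplecticForm σ) (z : TwistorSpace σ) :
    SliceChart (𝓘(ℝ, Model n).prod 𝓘(ℝ, Model n →L[ℝ] Model n))
      (fun p : EndTM n M ↦ IsCompatible σ p.proj p.snd) (ambientEquiv n) :=
  twistorSliceChart (sympFrame hσ z.1.proj) z.1 rfl

lemma mem_twistorSlices (hσ : IsSymplecticForm σ) (z : TwistorSpace σ) :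
    z.1 ∈ (twistorSlices hσ z).chart.source := by
  have h1 : z.1.proj ∈ (chartAt (Model n) z.1.proj).source := mem_chart_source _ _
  have h2 := (isCompatible_iff (sympFrame hσ z.1.proj) h1 (sympFrame hσ z.1.proj).mem_dom
    z.1.snd).1 z.2
  refine ⟨mem_chartAt_endTM_source.2 h1, ?_⟩
  change chartAt (ModelProd (Model n) (Model n →L[ℝ] Model n)) z.1 z.1 ∈
    cayleySource (stdJ n) _ _
  rw [chartAt_endTM_apply]
  exact ⟨(sympFrame hσ z.1.proj).mem_dom, isUnit_one_sub_of_isStdCompatible (isOrthComplex_stdJ n) h2,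
    (cayley_mem_of_isStdCompatible (isOrthComplex_stdJ n) h2).2⟩

/-- The charts of the twistor space are given by symplectic frames and Cayley transforms. -/
def IsAdapted [ChartedSpace (TModel n) (TwistorSpace σ)]
    (frame : ∀ z₀ : TwistorSpace σ, SympFrame σ z₀.proj) : Prop :=
  ∀ (z₀ : TwistorSpace σ) (t : TModel n), (t ∈ (chartAt (TModel n) z₀).target ↔
      baseMap n t ∈ (frame z₀).dom ∧ ‖fibreMap n t‖ < 1) ∧
    (t ∈ (chartAt (TModel n) z₀).target →
      ((chartAt (TModel n) z₀).symm t).proj =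
        (extChartAt 𝓘(ℝ, Model n) z₀.proj).symm (baseMap n t) ∧
      endCoord z₀.proj ((chartAt (TModel n) z₀).symm t).proj ((chartAt (TModel n) z₀).symm t).Phi =
        jCoord (frame z₀) t)

/-- A choice of symplectic frames to which the charts of the twistor space are adapted. -/
def AdaptedCharts (σ : BilinField (Model n) M) [ChartedSpace (TModel n) (TwistorSpace σ)] :
    Type _ :=
  {frame : ∀ z₀ : TwistorSpace σ, SympFrame σ z₀.proj // IsAdapted frame}

namespace AdaptedCharts

variable [ChartedSpace (TModel n) (TwistorSpace σ)] (h : AdaptedCharts σ) (z₀ : TwistorSpace σ)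
  (t : TModel n)

/-- The symplectic frame at a point of the twistor space. -/
def frame : SympFrame σ z₀.proj := h.1 z₀

lemma mem_target : t ∈ (chartAt (TModel n) z₀).target ↔
    baseMap n t ∈ (h.frame z₀).dom ∧ ‖fibreMap n t‖ < 1 :=
  (Subtype.property h z₀ t).1

include h in
lemma proj_symm (ht : t ∈ (chartAt (TModel n) z₀).target) :
    ((chartAt (TModel n) z₀).symm t).proj =
      (extChartAt 𝓘(ℝ, Model n) z₀.proj).symm (baseMap n t) :=
  ((Subtype.property h z₀ t).2 ht).1

lemma endCoord_symm (ht : t ∈ (chartAt (TModel n) z₀).target) :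
    endCoord z₀.proj ((chartAt (TModel n) z₀).symm t).proj ((chartAt (TModel n) z₀).symm t).Phi =
      jCoord (h.frame z₀) t :=
  ((Subtype.property h z₀ t).2 ht).2

end AdaptedCharts

/-- The manifold structure of the twistor space. -/
abbrev twistorChartedSpace (hσ : IsSymplecticForm σ) : ChartedSpace (TModel n) (TwistorSpace σ) :=
  subChartedSpace (twistorSlices hσ) (mem_twistorSlices hσ)

/-- The charts of the twistor space are adapted. -/
def adaptedCharts (hσ : IsSymplecticForm σ) :
    letI := twistorChartedSpace hσ
    AdaptedCharts σ :=
  letI := twistorChartedSpace hσ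
  have hsymm (z₀ : TwistorSpace σ) (t : TModel n) (ht : t ∈ (chartAt (TModel n) z₀).target) :
      chartAt (ModelProd (Model n) (Model n →L[ℝ] Model n)) z₀.1 ((chartAt (TModel n) z₀).symm t).1 =
        (baseMap n t, jCoord (sympFrame hσ z₀.proj) t) ∧
      ((chartAt (TModel n) z₀).symm t).1 ∈
        (chartAt (ModelProd (Model n) (Model n →L[ℝ] Model n)) z₀.1).source ∧
      baseMap n t ∈ (sympFrame hσ z₀.proj).dom := by
    haveI : Nonempty (TwistorSpace σ) := ⟨z₀⟩
    have h1 : ((chartAt (TModel n) z₀).symm t).1 = _ :=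
      (twistorSlices hσ z₀).coe_subChart_symm ht
    have h2 : ambientEquiv n (t, 0) ∈ (twistorSlices hσ z₀).chart.target := ht
    have h3 : cayleyMapInv (stdJ n) (sympFrame hσ z₀.proj).g (ambientEquiv n (t, 0)) ∈
      (chartAt (ModelProd (Model n) (Model n →L[ℝ] Model n)) z₀.1).target := h2.2
    have h4 : ((chartAt (TModel n) z₀).symm t).1 =
      (chartAt (ModelProd (Model n) (Model n →L[ℝ] Model n)) z₀.1).symm
        (cayleyMapInv (stdJ n) (sympFrame hσ z₀.proj).g (ambientEquiv n (t, 0))) := h1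
    have h5 : ambientEquiv n (t, 0) ∈ cayleyTarget (sympFrame hσ z₀.proj).dom := h2.1
    rw [ambientEquiv_zero] at h5 h4 h3
    rw [h4]
    exact ⟨(chartAt (ModelProd (Model n) (Model n →L[ℝ] Model n)) z₀.1).right_inv h3,
      (chartAt (ModelProd (Model n) (Model n →L[ℝ] Model n)) z₀.1).map_target h3, h5.1⟩
  Subtype.mk (fun z₀ ↦ sympFrame hσ z₀.proj) fun z₀ t ↦ by
      refine ⟨?_, fun ht ↦ ?_⟩
      · haveI : Nonempty (TwistorSpace σ) := ⟨z₀⟩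
        have h1 : t ∈ (chartAt (TModel n) z₀).target ↔
          ambientEquiv n (t, 0) ∈ (twistorSlices hσ z₀).chart.target :=
          (twistorSlices hσ z₀).mem_subChart_target
        have h5 : ambientEquiv n (t, 0) ∈ cayleyTarget (sympFrame hσ z₀.proj).dom ↔
            baseMap n t ∈ (sympFrame hσ z₀.proj).dom ∧ ‖fibreMap n t‖ < 1 := by
          rw [ambientEquiv_zero]; rfl
        rw [h1, ← h5]
        refine ⟨fun h ↦ h.1, fun h ↦ ⟨h, ?_⟩⟩
        change cayleyMapInv (stdJ n) (sympFrame hσ z₀.proj).g (ambientEquiv n (t, 0)) ∈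
          (chartAt (ModelProd (Model n) (Model n →L[ℝ] Model n)) z₀.1).target
        rw [ambientEquiv_zero] at h ⊢
        have h6 := (sympFrame hσ z₀.proj).dom_subset h.1
        rw [FiberBundle.chartedSpace_chartAt]
        simp only [cayleyMapInv]
        simp only [extChartAt_target, modelWithCornersSelf_coe_symm, Set.preimage_id,
          Set.range_id, Set.inter_univ, modelWithCornersSelf_coe] at h6
        simp only [OpenPartialHomeomorph.trans_target, OpenPartialHomeomorph.prod_target,
          OpenPartialHomeomorph.refl_target]
        simp
        exact ⟨h6, (chartAt (Model n) z₀.1.proj).map_target h6⟩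
      · obtain ⟨h1, h2, h3⟩ := hsymm z₀ t ht
        rw [chartAt_endTM_apply] at h1
        refine ⟨?_, congrArg Prod.snd h1⟩
        have h4 : extChartAt 𝓘(ℝ, Model n) z₀.proj ((chartAt (TModel n) z₀).symm t).proj =
          baseMap n t := congrArg Prod.fst h1
        rw [← h4, (extChartAt 𝓘(ℝ, Model n) z₀.proj).left_inv]
        rw [extChartAt_source]
        exact mem_chartAt_endTM_source.1 h2

end TwistorCharts

/-- Behaviour under a change of frame: differentiating C Ci = 1 eliminates the derivative of Ci and
leaves a commutator of j with C' Ci. -/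
lemma fderiv_conj {E W : Type*} [NormedAddCommGroup E] [NormedSpace ℝ E]
    [NormedAddCommGroup W] [NormedSpace ℝ W] {b : W →L[ℝ] E} {C Ci : E → E →L[ℝ] E}
    {j : W → E →L[ℝ] E} {w : W} (hC : DifferentiableAt ℝ C (b w))
    (hCi : DifferentiableAt ℝ Ci (b w)) (hj : DifferentiableAt ℝ j w)
    (h : ∀ᶠ y in 𝓝 (b w), C y * Ci y = 1) (h' : Ci (b w) * C (b w) = 1) :
    DifferentiableAt ℝ (fun w ↦ Ci (b w) * j w * C (b w)) w ∧
    ∀ u, C (b w) * fderiv ℝ (fun w ↦ Ci (b w) * j w * C (b w)) w u * Ci (b w) =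
      fderiv ℝ j w u + j w * (fderiv ℝ C (b w) (b u) * Ci (b w)) -
        fderiv ℝ C (b w) (b u) * Ci (b w) * j w := by
  have hb : DifferentiableAt ℝ b w := b.differentiableAt
  have hd : DifferentiableAt ℝ (fun w ↦ Ci (b w) * j w * C (b w)) w :=
    ((hCi.comp w hb).mul hj).mul (hC.comp w hb)
  refine ⟨hd, fun u ↦ ?_⟩
  have h1 := HasFDerivAt.hasLineDerivAt_comp (b := b) hC.hasFDerivAt u
  have h2 := HasFDerivAt.hasLineDerivAt_comp (b := b) hCi.hasFDerivAt u
  have h3 : HasLineDerivAt ℝ j (fderiv ℝ j w u) w u := hj.hasFDerivAt.hasLineDerivAt u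
  have h4 : HasLineDerivAt ℝ (fun w ↦ Ci (b w) * j w * C (b w)) _ w u := hd.hasFDerivAt.hasLineDerivAt u
  have h5 := h4.unique ((HasDerivAt.mul (HasDerivAt.mul h2 h3) h1))
  have h6 := HasDerivAt.mul h1 h2
  have h7 : HasDerivAt (fun s : ℝ ↦ C (b (w + s • u)) * Ci (b (w + s • u))) 0 0 := by
    refine (hasDerivAt_const (0 : ℝ) (1 : E →L[ℝ] E)).congr_of_eventuallyEq ?_
    have hc : ContinuousAt (fun s : ℝ ↦ b (w + s • u)) 0 := (b.continuous.comp
      (continuous_const.add (continuous_id.smul continuous_const))).continuousAt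
    exact hc.eventually (p := fun y ↦ C y * Ci y = 1) (by simpa using h)
  have h8 := h6.unique h7
  simp only [zero_smul, add_zero] at h5 h8
  rw [h5]
  have h9 : C (b w) * Ci (b w) = 1 := h.self_of_nhds
  have h10 : C (b w) * fderiv ℝ Ci (b w) (b u) = -(fderiv ℝ C (b w) (b u) * Ci (b w)) :=
    eq_neg_of_add_eq_zero_right h8
  generalize fderiv ℝ Ci (b w) (b u) = Ci' at *
  generalize fderiv ℝ C (b w) (b u) = C' at *
  generalize fderiv ℝ j w u = j' at *
  calc C (b w) * ((Ci' * j w + Ci (b w) * j') * C (b w) + Ci (b w) * j w * C') * Ci (b w)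
      = C (b w) * Ci' * j w * (C (b w) * Ci (b w)) + (C (b w) * Ci (b w)) * j' * (C (b w) * Ci (b w))
        + (C (b w) * Ci (b w)) * j w * (C' * Ci (b w)) := by noncomm_ring
    _ = _ := by rw [h9, h10]; noncomm_ring

lemma contDiffAt_clm_of_apply {D E F : Type*} [NormedAddCommGroup D] [NormedSpace ℝ D]
    [NormedAddCommGroup E] [NormedSpace ℝ E] [NormedAddCommGroup F] [NormedSpace ℝ F]
    [FiniteDimensional ℝ E] {k : WithTop ℕ∞} {f : D → E →L[ℝ] F} {x : D}
    (h : ∀ y, ContDiffAt ℝ k (fun x ↦ f x y) x) : ContDiffAt ℝ k f x := by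
  let e₁ := ContinuousLinearEquiv.ofFinrankEq (𝕜 := ℝ) (E := E) (F := Fin (Module.finrank ℝ E) → ℝ)
    (Module.finrank_fin_fun ℝ).symm
  let e₂ := (e₁.arrowCongr (1 : F ≃L[ℝ] F)).trans (ContinuousLinearEquiv.piRing _)
  rw [← Function.id_comp f, ← e₂.symm_comp_self]
  exact e₂.symm.contDiff.contDiffAt.comp x (contDiffAt_pi.2 fun i ↦ h _)

/-! ### The covariant derivative of Φ in an arbitrary adapted chart. -/

section Coordinates

variable {n : ℕ} {M : Type*} [TopologicalSpace M]
  [ChartedSpace (EuclideanSpace ℝ (Fin (2 * n))) M] [IsManifold 𝓘(ℝ, Model n) ∞ M]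
  {σ : BilinField (Model n) M} {cov : LinearConnection n M}

/-- The change of components between the preferred charts at `x₁` and `x₂`. -/
def coordTrans (x₁ x₂ x : M) : Model n →L[ℝ] Model n := (toCoord x₂ x).comp (ofCoord x₁ x)

lemma coordTrans_mul_coordTrans {x₁ x₂ x : M} (h1 : x ∈ (chartAt (Model n) x₁).source)
    (h2 : x ∈ (chartAt (Model n) x₂).source) :
    coordTrans (n := n) x₁ x₂ x * coordTrans x₂ x₁ x = 1 := by
  ext1 u
  change toCoord x₂ x (ofCoord x₁ x (toCoord x₁ x (ofCoord x₂ x u))) = u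
  rw [ofCoord_toCoord h1, toCoord_ofCoord h2]

lemma contDiffAt_coordTrans {x₀ x₁ x₂ : M} {y : Model n} (hy : y ∈ (extChartAt 𝓘(ℝ, Model n) x₀).target)
    (h1 : (extChartAt 𝓘(ℝ, Model n) x₀).symm y ∈ (chartAt (Model n) x₁).source)
    (h2 : (extChartAt 𝓘(ℝ, Model n) x₀).symm y ∈ (chartAt (Model n) x₂).source) :
    ContDiffAt ℝ ∞ (fun y ↦ coordTrans (n := n) x₁ x₂ ((extChartAt 𝓘(ℝ, Model n) x₀).symm y)) y := by
  have h (w : Model n) := (contMDiffAt_iff_contDiffAt_chart hy).1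
    ((contMDiffAt_field_iff h2).1 (contMDiffAt_ofCoord (F := Model n) h1 w))
  exact contDiffAt_clm_of_apply fun w ↦ h w

lemma endCoord_eq_conj {x₁ x₂ x : M} (h1 : x ∈ (chartAt (Model n) x₁).source)
    (p : TangentSpace 𝓘(ℝ, Model n) x →L[ℝ] TangentSpace 𝓘(ℝ, Model n) x) :
    endCoord x₂ x p = coordTrans x₁ x₂ x * endCoord x₁ x p * coordTrans x₂ x₁ x := by
  ext1 u
  change _ = toCoord x₂ x (ofCoord x₁ x (toCoord x₁ x (p (ofCoord x₁ x (toCoord x₁ x (ofCoord x₂ x u))))))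
  rw [ofCoord_toCoord h1, ofCoord_toCoord h1]
  rfl

lemma toCoord_cov_apply {x₀ x : M} (hx : x ∈ (chartAt (Model n) x₀).source)
    {Y : Π x : M, TangentSpace 𝓘(ℝ, Model n) x} {Y' : Model n → Model n}
    (hY : ∀ᶠ x' in 𝓝 x, toCoord x₀ x' (Y x') = Y' (extChartAt 𝓘(ℝ, Model n) x₀ x'))
    (hd : DifferentiableAt ℝ Y' (extChartAt 𝓘(ℝ, Model n) x₀ x)) (v : TangentSpace 𝓘(ℝ, Model n) x) :
    toCoord x₀ x (cov Y x v) = fderiv ℝ Y' (extChartAt 𝓘(ℝ, Model n) x₀ x) (toCoord x₀ x v) +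
      connForm cov x₀ (extChartAt 𝓘(ℝ, Model n) x₀ x) (toCoord x₀ x v)
        (Y' (extChartAt 𝓘(ℝ, Model n) x₀ x)) := by
  rw [← extChartAt_source 𝓘(ℝ, Model n)] at hx
  have ht := (extChartAt 𝓘(ℝ, Model n) x₀).map_source hx
  have hl := (extChartAt 𝓘(ℝ, Model n) x₀).left_inv hx
  generalize extChartAt 𝓘(ℝ, Model n) x₀ x = y at *
  subst hl
  refine toCoord_cov ht ?_ hd v
  have hc : ContinuousAt (extChartAt 𝓘(ℝ, Model n) x₀).symm y := continuousAt_extChartAt_symm'' ht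
  filter_upwards [hc.eventually hY, (isOpen_extChartAt_target x₀).mem_nhds ht] with y' h1 h2
  rw [h1, (extChartAt 𝓘(ℝ, Model n) x₀).right_inv h2]

lemma isStdCompatible_cayleyInv_fibreMap {t : TModel n} (ht : ‖fibreMap n t‖ < 1) :
    IsStdCompatible (stdJ n) (cayleyInv (stdJ n) (fibreMap n t)) :=
  isStdCompatible_cayleyInv (isOrthComplex_stdJ n) (fibreMap_mem t) ht

lemma contDiffAt_jCoord {x₀ : M} (f : SympFrame σ x₀) {t : TModel n} (h1 : baseMap n t ∈ f.dom)
    (h2 : ‖fibreMap n t‖ < 1) : ContDiffAt ℝ ∞ (jCoord f) t := by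
  have h3 : ContDiffAt ℝ ∞ (fun t ↦ f.g (baseMap n t)) t :=
    (f.contDiffOn_g.contDiffAt (f.isOpen_dom.mem_nhds h1)).comp t (baseMap n).contDiff.contDiffAt
  exact ((contDiffAt_ringInverse_comp h3 (f.isUnit_g _ h1)).clm_comp
    (contDiffAt_cayleyInv (fibreMap n).contDiff.contDiffAt
      (isUnit_one_add_of_norm_lt_one h2))).clm_comp h3

variable [ChartedSpace (TModel n) (TwistorSpace σ)]

namespace AdaptedCharts

variable (h : AdaptedCharts σ) {z₀ z : TwistorSpace σ}

include h in
lemma proj_eq (hz : z ∈ (chartAt (TModel n) z₀).source) :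
    z.proj = (extChartAt 𝓘(ℝ, Model n) z₀.proj).symm (baseMap n (chartAt (TModel n) z₀ z)) := by
  have := h.proj_symm z₀ _ ((chartAt (TModel n) z₀).map_source hz)
  rwa [(chartAt (TModel n) z₀).left_inv hz] at this

include h in
lemma endCoord_Phi (hz : z ∈ (chartAt (TModel n) z₀).source) :
    endCoord z₀.proj z.proj z.Phi = jCoord (h.frame z₀) (chartAt (TModel n) z₀ z) := by
  have := h.endCoord_symm z₀ _ ((chartAt (TModel n) z₀).map_source hz)
  rwa [(chartAt (TModel n) z₀).left_inv hz] at this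

lemma baseMap_mem (hz : z ∈ (chartAt (TModel n) z₀).source) :
    baseMap n (chartAt (TModel n) z₀ z) ∈ (h.frame z₀).dom :=
  ((h.mem_target z₀ _).1 ((chartAt (TModel n) z₀).map_source hz)).1

include h in
lemma norm_fibreMap_lt (hz : z ∈ (chartAt (TModel n) z₀).source) :
    ‖fibreMap n (chartAt (TModel n) z₀ z)‖ < 1 :=
  ((h.mem_target z₀ _).1 ((chartAt (TModel n) z₀).map_source hz)).2

include h in
lemma baseMap_mem_target (hz : z ∈ (chartAt (TModel n) z₀).source) :
    baseMap n (chartAt (TModel n) z₀ z) ∈ (extChartAt 𝓘(ℝ, Model n) z₀.proj).target :=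
  (h.frame z₀).dom_subset (h.baseMap_mem hz)

include h in
lemma proj_mem_source (hz : z ∈ (chartAt (TModel n) z₀).source) :
    z.proj ∈ (chartAt (Model n) z₀.proj).source := by
  rw [h.proj_eq hz]
  exact symm_mem_source (h.baseMap_mem_target hz)

include h in
lemma extChartAt_proj (hz : z ∈ (chartAt (TModel n) z₀).source) :
    extChartAt 𝓘(ℝ, Model n) z₀.proj z.proj = baseMap n (chartAt (TModel n) z₀ z) := by
  rw [h.proj_eq hz, (extChartAt 𝓘(ℝ, Model n) z₀.proj).right_inv (h.baseMap_mem_target hz)]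

variable [IsManifold 𝓘(ℝ, TModel n) ∞ (TwistorSpace σ)]

include h in
lemma dproj_apply (hz : z ∈ (chartAt (TModel n) z₀).source) :
    MDifferentiableAt 𝓘(ℝ, TModel n) 𝓘(ℝ, Model n) (TwistorSpace.proj (σ := σ)) z ∧
    ∀ X : TangentSpace 𝓘(ℝ, TModel n) z,
    toCoord z₀.proj z.proj (z.dproj X) = baseMap n (toCoord z₀ z X) := by
  have hy := h.baseMap_mem_target hz
  have hs : HasMFDerivAt 𝓘(ℝ, Model n) 𝓘(ℝ, Model n) (extChartAt 𝓘(ℝ, Model n) z₀.proj).symm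
      (baseMap n (chartAt (TModel n) z₀ z)) _ :=
    (((contMDiffOn_extChartAt_symm (n := ∞) (I := 𝓘(ℝ, Model n)) z₀.proj).contMDiffAt
      ((isOpen_extChartAt_target z₀.proj).mem_nhds hy)).mdifferentiableAt (by simp)).hasMFDerivAt
  have hb : MDifferentiableAt 𝓘(ℝ, TModel n) 𝓘(ℝ, Model n)
      (fun z ↦ baseMap n (chartAt (TModel n) z₀ z)) z :=
    (mfderiv_eq_fderiv_chart hz (f := fun z ↦ baseMap n (chartAt (TModel n) z₀ z))
      (g := baseMap n) (Filter.Eventually.of_forall fun _ ↦ rfl)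
      (baseMap n).differentiableAt (0 : TModel n)).1
  have hb' (X : TangentSpace 𝓘(ℝ, TModel n) z) := 
    (mfderiv_eq_fderiv_chart hz (f := fun z ↦ baseMap n (chartAt (TModel n) z₀ z))
      (g := baseMap n) (Filter.Eventually.of_forall fun _ ↦ rfl)
      (baseMap n).differentiableAt X).2
  have hc := (hs.comp z hb.hasMFDerivAt).congr_of_eventuallyEq
    (f₁ := TwistorSpace.proj (σ := σ)) (by
      filter_upwards [(chartAt (TModel n) z₀).open_source.mem_nhds hz] with z' hz' using h.proj_eq hz')
  refine ⟨hc.mdifferentiableAt, fun X ↦ ?_⟩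
  have h1 : z.dproj X = ofCoord z₀.proj ((extChartAt 𝓘(ℝ, Model n) z₀.proj).symm
      (baseMap n (chartAt (TModel n) z₀ z))) (baseMap n (toCoord z₀ z X)) := by
    have h2 := hb' X
    rw [ContinuousLinearMap.fderiv] at h2
    rw [← h2, ← mfderiv_extChartAt_symm hy, TwistorSpace.dproj, hc.mfderiv]
    rfl
  have h3 : ∀ x', x' = (extChartAt 𝓘(ℝ, Model n) z₀.proj).symm
      (baseMap n (chartAt (TModel n) z₀ z)) → ∀ w, toCoord (F := Model n) z₀.proj x'
      (ofCoord (F := Model n) z₀.proj ((extChartAt 𝓘(ℝ, Model n) z₀.proj).symm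
      (baseMap n (chartAt (TModel n) z₀ z))) w) = w := by
    rintro _ rfl w
    exact toCoord_ofCoord (symm_mem_source hy) w
  exact (congrArg (toCoord (F := Model n) z₀.proj z.proj) h1).trans (h3 _ (h.proj_eq hz) _)

-- `dFibre` at z differentiates in the trivialization at π(z), while the computations take place in
-- the one at π(z₀). The commutator is the price of the change of frame, supplied by `fderiv_conj`.
include h in
lemma endCoord_dFibre (hz : z ∈ (chartAt (TModel n) z₀).source) (X : TangentSpace 𝓘(ℝ, TModel n) z) :
    endCoord z₀.proj z.proj (z.dFibre X) =
      fderiv ℝ (jCoord (h.frame z₀)) (chartAt (TModel n) z₀ z) (toCoord z₀ z X) +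
      jCoord (h.frame z₀) (chartAt (TModel n) z₀ z) *
        (fderiv ℝ (fun y ↦ coordTrans (n := n) z.proj z₀.proj ((extChartAt 𝓘(ℝ, Model n) z₀.proj).symm y))
          (baseMap n (chartAt (TModel n) z₀ z)) (baseMap n (toCoord z₀ z X)) *
          coordTrans z₀.proj z.proj z.proj) -
        fderiv ℝ (fun y ↦ coordTrans (n := n) z.proj z₀.proj ((extChartAt 𝓘(ℝ, Model n) z₀.proj).symm y))
          (baseMap n (chartAt (TModel n) z₀ z)) (baseMap n (toCoord z₀ z X)) *
          coordTrans z₀.proj z.proj z.proj * jCoord (h.frame z₀) (chartAt (TModel n) z₀ z) := by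
  have hy := h.baseMap_mem_target hz
  have hp := h.proj_eq hz
  have hs := h.proj_mem_source hz
  have hs' : z.proj ∈ (chartAt (Model n) z.proj).source := mem_chart_source _ _
  set t := chartAt (TModel n) z₀ z with ht
  have hC := contDiffAt_coordTrans (x₁ := z.proj) (x₂ := z₀.proj) hy (hp ▸ hs') (hp ▸ hs)
  have hCi := contDiffAt_coordTrans (x₁ := z₀.proj) (x₂ := z.proj) hy (hp ▸ hs) (hp ▸ hs')
  have hj := contDiffAt_jCoord (h.frame z₀) (h.baseMap_mem hz) (h.norm_fibreMap_lt hz)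
  have hnear : ∀ᶠ y in 𝓝 (baseMap n t), (extChartAt 𝓘(ℝ, Model n) z₀.proj).symm y ∈
      (chartAt (Model n) z.proj).source ∧ (extChartAt 𝓘(ℝ, Model n) z₀.proj).symm y ∈
      (chartAt (Model n) z₀.proj).source := by
    have hc : ContinuousAt (extChartAt 𝓘(ℝ, Model n) z₀.proj).symm (baseMap n t) :=
      continuousAt_extChartAt_symm'' hy
    exact hc.eventually (((chartAt (Model n) z.proj).open_source.inter
      (chartAt (Model n) z₀.proj).open_source).mem_nhds (hp ▸ ⟨hs', hs⟩))
  obtain ⟨hd, hD⟩ := fderiv_conj (b := baseMap n) (hC.differentiableAt (by simp))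
    (hCi.differentiableAt (by simp)) (hj.differentiableAt (by simp))
    (hnear.mono fun y hy ↦ coordTrans_mul_coordTrans hy.1 hy.2)
    (by rw [← hp]; exact coordTrans_mul_coordTrans hs hs')
  have hD' := hD (toCoord z₀ z X)
  rw [← hp] at hD'
  rw [← hD']
  have hm := (mfderiv_eq_fderiv_chart hz (f := fun z' : TwistorSpace σ ↦
    endCoord z.proj z'.proj z'.Phi) (by
      have h1 : ∀ᶠ z' : TwistorSpace σ in 𝓝 z, z'.proj ∈ (chartAt (Model n) z.proj).source :=
        (h.dproj_apply hz).1.continuousAt.eventually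
          ((chartAt (Model n) z.proj).open_source.mem_nhds hs')
      filter_upwards [(chartAt (TModel n) z₀).open_source.mem_nhds hz, h1] with z' hz' h1
      rw [endCoord_eq_conj (h.proj_mem_source hz'), h.endCoord_Phi hz', h.proj_eq hz']
      rfl) hd X).2
  have h1 : z.dFibre X = (ofCoord z.proj z.proj).comp
      ((mfderiv 𝓘(ℝ, TModel n) 𝓘(ℝ, Model n →L[ℝ] Model n) (fun z' : TwistorSpace σ ↦
        endCoord z.proj z'.proj z'.Phi) z X : Model n →L[ℝ] Model n).comp
        (toCoord (F := Model n) z.proj z.proj)) := by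
    have h2 (A : Model n →L[ℝ] Model n) := Pretrivialization.continuousLinearMap_symm_apply'
      (RingHom.id ℝ) (trivializationAt (Model n) (TangentSpace 𝓘(ℝ, Model n) : M → Type _) z.proj)
      (trivializationAt (Model n) (TangentSpace 𝓘(ℝ, Model n) : M → Type _) z.proj)
      ⟨mem_baseSet_iff.2 hs', mem_baseSet_iff.2 hs'⟩ A
    have h3 (A : Model n →L[ℝ] Model n) := Trivialization.symmL_apply (R := ℝ)
      (trivializationAt (Model n →L[ℝ] Model n) (fun x : M ↦ TangentSpace 𝓘(ℝ, Model n) x →L[ℝ]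
        TangentSpace 𝓘(ℝ, Model n) x) z.proj) (FiberBundle.mem_baseSet_trivializationAt' z.proj) A
    exact (h3 _).trans (h2 _)
  rw [h1, hm]
  rfl

-- The inhomogeneous terms that `dFibre` and `christoffel` acquire under the change of frame cancel,
-- which is what makes the definition of `nablaPhi` through the frame at π(z) independent of that
-- frame.
set_option maxHeartbeats 1000000 in
include h in
lemma endCoord_nablaPhi (hz : z ∈ (chartAt (TModel n) z₀).source)
    (X : TangentSpace 𝓘(ℝ, TModel n) z) :
    endCoord z₀.proj z.proj (TwistorSpace.nablaPhi cov z X) =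
      covEnd (connForm cov z₀.proj) (baseMap n) (jCoord (h.frame z₀))
        (chartAt (TModel n) z₀ z) (toCoord z₀ z X) := by
  have hy := h.baseMap_mem_target hz
  have hp := h.proj_eq hz
  have hs := h.proj_mem_source hz
  have hs' : z.proj ∈ (chartAt (Model n) z.proj).source := mem_chart_source _ _
  have hΦ := h.endCoord_Phi hz
  have hF := h.endCoord_dFibre hz X
  have hb := (h.dproj_apply hz).2 X
  have he := h.extChartAt_proj hz
  set t := chartAt (TModel n) z₀ z with ht
  have hC := (contDiffAt_coordTrans (x₁ := z.proj) (x₂ := z₀.proj) hy (hp ▸ hs')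
    (hp ▸ hs)).differentiableAt (by simp)
  set C := fun y ↦ coordTrans (n := n) z.proj z₀.proj ((extChartAt 𝓘(ℝ, Model n) z₀.proj).symm y)
    with hCdef
  -- The transformation law of a connection form: the frame at π(z) has components C in the frame at
  -- π(z₀), whence the term with dC.
  have hΓ (v : Model n) : toCoord z₀.proj z.proj (christoffel cov z.proj (z.dproj X)
      (ofCoord z₀.proj z.proj v)) =
      fderiv ℝ C (baseMap n t) (baseMap n (toCoord z₀ z X))
        (coordTrans z₀.proj z.proj z.proj v) +
        connForm cov z₀.proj (baseMap n t) (baseMap n (toCoord z₀ z X)) v := by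
    have h1 := toCoord_cov_apply (cov := cov) hs (Y := frameSection z.proj
      (coordTrans z₀.proj z.proj z.proj v)) (Y' := fun y ↦ C y (coordTrans z₀.proj z.proj z.proj v))
      (by
        filter_upwards [(chartAt (Model n) z₀.proj).open_source.mem_nhds hs] with x' hx'
        simp only [hCdef]
        rw [(extChartAt 𝓘(ℝ, Model n) z₀.proj).left_inv (by rwa [extChartAt_source])]
        rfl) (by rw [he]; exact hC.clm_apply (differentiableAt_const _)) (z.dproj X)
    rw [he, hb, fderiv_clm_apply hC (differentiableAt_const _)] at h1
    have h2 : C (baseMap n t) * coordTrans z₀.proj z.proj z.proj = 1 := by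
      simp only [hCdef]
      rw [← hp]
      exact coordTrans_mul_coordTrans hs' hs
    have h3 : C (baseMap n t) (coordTrans z₀.proj z.proj z.proj v) = v :=
      congrArg (fun f : Model n →L[ℝ] Model n ↦ f v) h2
    rw [h3] at h1
    refine h1.trans ?_
    simp
  have hj (v : Model n) : z.Phi (ofCoord z₀.proj z.proj v) =
      ofCoord z₀.proj z.proj (jCoord (h.frame z₀) t v) := by
    rw [← hΦ, endCoord_apply, ofCoord_toCoord hs]
  ext1 v
  have h1 : TwistorSpace.nablaPhi cov z X (ofCoord z₀.proj z.proj v) =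
      z.dFibre X (ofCoord z₀.proj z.proj v) +
      (christoffel cov z.proj (z.dproj X) (z.Phi (ofCoord z₀.proj z.proj v)) -
        z.Phi (christoffel cov z.proj (z.dproj X) (ofCoord z₀.proj z.proj v))) := rfl
  have h2 : toCoord z₀.proj z.proj (z.Phi (christoffel cov z.proj (z.dproj X)
      (ofCoord z₀.proj z.proj v))) = jCoord (h.frame z₀) t (toCoord z₀.proj z.proj
        (christoffel cov z.proj (z.dproj X) (ofCoord z₀.proj z.proj v))) := by
    rw [← hΦ, endCoord_apply, ofCoord_toCoord hs]
  rw [endCoord_apply, h1, map_add, map_sub, h2, hj, hΓ, hΓ, ← endCoord_apply, hF]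
  simp only [covEnd, add_apply, sub_apply, mul_apply_eq_comp, map_add]
  abel

end AdaptedCharts

end Coordinates

/-! ### Ω as a differential form, and the condition dΩ = 0. -/

section TwistorForm

variable {n : ℕ} {M : Type*} [TopologicalSpace M]
  [ChartedSpace (EuclideanSpace ℝ (Fin (2 * n))) M] [IsManifold 𝓘(ℝ, Model n) ∞ M]
  {σ : BilinField (Model n) M} {cov : LinearConnection n M}

lemma trace_eq_trE_endCoord {x₀ x : M} (hx : x ∈ (chartAt (Model n) x₀).source)
    (A : TangentSpace 𝓘(ℝ, Model n) x →L[ℝ] TangentSpace 𝓘(ℝ, Model n) x) :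
    LinearMap.trace ℝ (TangentSpace 𝓘(ℝ, Model n) x) A.toLinearMap =
      trE (Model n) (endCoord x₀ x A) := by
  let e : TangentSpace 𝓘(ℝ, Model n) x ≃ₗ[ℝ] Model n := LinearEquiv.ofLinear
    (toCoord x₀ x).toLinearMap (ofCoord x₀ x).toLinearMap
    (LinearMap.ext fun u ↦ toCoord_ofCoord hx u) (LinearMap.ext fun u ↦ ofCoord_toCoord hx u)
  rw [trE_apply, ← LinearMap.trace_conj' A.toLinearMap e]
  rfl

lemma endCoord_mul {x₀ x : M} (hx : x ∈ (chartAt (Model n) x₀).source)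
    (A B : TangentSpace 𝓘(ℝ, Model n) x →L[ℝ] TangentSpace 𝓘(ℝ, Model n) x) :
    endCoord x₀ x (A.comp B) = endCoord x₀ x A * endCoord x₀ x B := by
  ext1 u
  change _ = toCoord x₀ x (A (ofCoord x₀ x (toCoord x₀ x (B (ofCoord x₀ x u)))))
  rw [ofCoord_toCoord hx]
  rfl

lemma jCoord_mul_self {x₀ : M} (f : SympFrame σ x₀) {t : TModel n} (h1 : baseMap n t ∈ f.dom)
    (h2 : ‖fibreMap n t‖ < 1) : jCoord f t * jCoord f t = -1 := by
  have h3 := f.isUnit_g _ h1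
  have h4 := (isStdCompatible_cayleyInv_fibreMap h2).sq
  calc jCoord f t * jCoord f t = Ring.inverse (f.g (baseMap n t)) *
        cayleyInv (stdJ n) (fibreMap n t) * (f.g (baseMap n t) * Ring.inverse (f.g (baseMap n t))) *
        cayleyInv (stdJ n) (fibreMap n t) * f.g (baseMap n t) := by simp only [jCoord]; noncomm_ring
    _ = Ring.inverse (f.g (baseMap n t)) * (cayleyInv (stdJ n) (fibreMap n t) *
        cayleyInv (stdJ n) (fibreMap n t)) * f.g (baseMap n t) := by
      rw [Ring.mul_inverse_cancel _ h3]; noncomm_ring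
    _ = -(Ring.inverse (f.g (baseMap n t)) * f.g (baseMap n t)) := by
      rw [h4]; ext1 u; simp only [mul_apply_eq_comp, neg_apply, one_apply_eq_self, map_neg]
    _ = -1 := by rw [Ring.inverse_mul_cancel _ h3]

namespace AdaptedCharts

variable [ChartedSpace (TModel n) (TwistorSpace σ)] (h : AdaptedCharts σ)
  {z₀ z : TwistorSpace σ}

lemma contDiffOn_jCoord : ContDiffOn ℝ ∞ (jCoord (h.frame z₀)) (chartAt (TModel n) z₀).target :=
  fun t ht ↦ (contDiffAt_jCoord _ ((h.mem_target z₀ t).1 ht).1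
    ((h.mem_target z₀ t).1 ht).2).contDiffWithinAt

lemma jCoord_mul_self {t : TModel n} (ht : t ∈ (chartAt (TModel n) z₀).target) :
    jCoord (h.frame z₀) t * jCoord (h.frame z₀) t = -1 :=
  SympTwistor.jCoord_mul_self _ ((h.mem_target z₀ t).1 ht).1 ((h.mem_target z₀ t).1 ht).2

include h in
lemma mapsTo_baseMap : Set.MapsTo (baseMap n) (chartAt (TModel n) z₀).target
    (extChartAt 𝓘(ℝ, Model n) z₀.proj).target :=
  fun t ht ↦ (h.frame z₀).dom_subset ((h.mem_target z₀ t).1 ht).1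

variable [IsManifold 𝓘(ℝ, TModel n) ∞ (TwistorSpace σ)]

lemma endCoord_P (hz : z ∈ (chartAt (TModel n) z₀).source)
    (X : TangentSpace 𝓘(ℝ, TModel n) z) :
    endCoord z₀.proj z.proj (TwistorSpace.P cov z X) =
      (-(1 / 2 : ℝ)) • (covEnd (connForm cov z₀.proj) (baseMap n) (jCoord (h.frame z₀))
        (chartAt (TModel n) z₀ z) (toCoord z₀ z X) *
        jCoord (h.frame z₀) (chartAt (TModel n) z₀ z)) := by
  rw [← h.endCoord_nablaPhi hz, ← h.endCoord_Phi hz, ← endCoord_mul (h.proj_mem_source hz)]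
  ext1 u
  exact (toCoord (F := Model n) z₀.proj z.proj).map_smul (-(1 / 2 : ℝ)) _

-- With P = -½NΦ and Φ² = -1 one has ½ tr(P Φ P') = -⅛ tr(N N' Φ), which explains the coefficient in
-- `coordForm`.
set_option maxHeartbeats 1000000 in
lemma Omega_apply (hz : z ∈ (chartAt (TModel n) z₀).source) (t : ℝ)
    (X Y : TangentSpace 𝓘(ℝ, TModel n) z) :
    TwistorSpace.Omega cov t z X Y =
      coordForm t (inChart σ z₀.proj) (connForm cov z₀.proj) (baseMap n) (jCoord (h.frame z₀))
        (chartAt (TModel n) z₀ z) (toCoord z₀ z X) (toCoord z₀ z Y) := by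
  have hs := h.proj_mem_source hz
  have h1 : TwistorSpace.Omega cov t z X Y = t * σ z.proj (z.dproj X) (z.dproj Y) -
      (1 / 2 : ℝ) * LinearMap.trace ℝ (TangentSpace 𝓘(ℝ, Model n) z.proj)
        ((TwistorSpace.P cov z X).comp (z.Phi.comp (TwistorSpace.P cov z Y))).toLinearMap := rfl
  have h2 : σ z.proj (z.dproj X) (z.dproj Y) = inChart σ z₀.proj
      (baseMap n (chartAt (TModel n) z₀ z)) (baseMap n (toCoord z₀ z X))
        (baseMap n (toCoord z₀ z Y)) := by
    rw [inChart_apply _ (h.baseMap_mem_target hz), ← h.proj_eq hz, ← (h.dproj_apply hz).2,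
      ← (h.dproj_apply hz).2, ofCoord_toCoord hs, ofCoord_toCoord hs]
  rw [h1, h2, trace_eq_trE_endCoord hs, endCoord_mul hs, endCoord_mul hs, h.endCoord_P hz,
    h.endCoord_P hz, h.endCoord_Phi hz, coordForm]
  have hjj := h.jCoord_mul_self ((chartAt (TModel n) z₀).map_source hz)
  generalize jCoord (h.frame z₀) = jh at *
  generalize chartAt (TModel n) z₀ z = w at *
  generalize covEnd _ _ jh w (toCoord z₀ z X) = N
  generalize covEnd _ _ jh w (toCoord z₀ z Y) = N'
  have h3 : (-(1 / 2 : ℝ)) • (N * jh w) * (jh w * (-(1 / 2 : ℝ)) • (N' * jh w)) =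
      (-(1 / 4 : ℝ)) • (N * N' * jh w) := by
    have hj2 (u) : jh w (jh w u) = -u := congrArg (fun f : Model n →L[ℝ] Model n ↦ f u) hjj
    ext1 u
    simp only [mul_apply_eq_comp, smul_apply, map_smul, hj2, map_neg]
    module
  rw [h3, map_smul, smul_eq_mul]
  ring

lemma inChart_Omega (t : ℝ) {w : TModel n} (hw : w ∈ (chartAt (TModel n) z₀).target) (u v : TModel n) :
    inChart (TwistorSpace.Omega (σ := σ) cov t) z₀ w u v =
      coordForm t (inChart σ z₀.proj) (connForm cov z₀.proj) (baseMap n) (jCoord (h.frame z₀))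
        w u v := by
  have hw' : w ∈ (extChartAt 𝓘(ℝ, TModel n) z₀).target := by simpa using hw
  have hz := symm_mem_source hw'
  have hr : chartAt (TModel n) z₀ ((extChartAt 𝓘(ℝ, TModel n) z₀).symm w) = w :=
    (chartAt (TModel n) z₀).right_inv hw
  rw [inChart_apply _ hw', h.Omega_apply hz, toCoord_ofCoord hz, toCoord_ofCoord hz, hr]

include h in
lemma isTwoForm_Omega [T2Space M] (hσ : IsSymplecticForm σ) (hcov : IsSymplecticConnection σ cov)
    (t : ℝ) : IsTwoForm (TwistorSpace.Omega (σ := σ) cov t) := by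
  constructor
  · refine contMDiff_bilinField fun z₀ ↦ ?_
    refine ContDiffOn.contDiffAt (s := (chartAt (TModel n) z₀).target) ?_
      ((chartAt (TModel n) z₀).open_target.mem_nhds (mem_chart_target _ z₀))
    exact contDiffOn_of_eq_coordForm (chartAt (TModel n) z₀).open_target h.mapsTo_baseMap
      (contDiffOn_inChart hσ.isTwoForm.smooth z₀.proj) (contDiffOn_connForm hcov.smooth z₀.proj)
      h.contDiffOn_jCoord (fun w hw u v ↦ h.inChart_Omega t hw u v)
  · intro z X
    have hz := mem_chart_source (TModel n) z
    have hw := (chartAt (TModel n) z).map_source hz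
    have hN := covEnd_mul_self_eq (A := connForm cov z.proj) (b := baseMap n)
      (chartAt (TModel n) z).open_target h.contDiffOn_jCoord (fun w hw ↦ h.jCoord_mul_self hw)
      hw (toCoord z z X)
    rw [h.Omega_apply hz, coordForm, inChart_self hσ.isTwoForm (h.baseMap_mem_target hz)]
    generalize covEnd (connForm cov z.proj) (baseMap n) (jCoord (h.frame z))
      (chartAt (TModel n) z z) (toCoord z z X) = N at *
    generalize jCoord (h.frame z) (chartAt (TModel n) z z) = j at *
    -- Cyclicity of the trace and Nj = -jN make the trace equal to its own negative.
    have h1 : trE (Model n) (N * N * j) = -trE (Model n) (N * N * j) := by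
      calc trE (Model n) (N * N * j) = trE (Model n) (N * j * N) := by
            rw [mul_assoc, trE_mul_comm]
        _ = -trE (Model n) (j * N * N) := by rw [hN, neg_mul, map_neg]
        _ = _ := by rw [mul_assoc, trE_mul_comm]
    have h2 : trE (Model n) (N * N * j) = 0 := by linarith
    rw [h2]
    simp

/-- Since dσ = 0, the parameter t disappears: closedness is a condition on the curvature alone. -/
lemma isClosedForm_Omega_iff_forall [T2Space M] (hσ : IsSymplecticForm σ)
    (hcov : IsSymplecticConnection σ cov) (t : ℝ) :
    IsClosedForm (TwistorSpace.Omega (σ := σ) cov t) ↔ ∀ z₀ : TwistorSpace σ,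
      ∀ w ∈ (chartAt (TModel n) z₀).target, ∀ u v x,
      trE (Model n) (curvForm (connForm cov z₀.proj) (baseMap n w) (baseMap n u) (baseMap n v) *
          covEnd (connForm cov z₀.proj) (baseMap n) (jCoord (h.frame z₀)) w x) +
        trE (Model n) (curvForm (connForm cov z₀.proj) (baseMap n w) (baseMap n v) (baseMap n x) *
          covEnd (connForm cov z₀.proj) (baseMap n) (jCoord (h.frame z₀)) w u) +
        trE (Model n) (curvForm (connForm cov z₀.proj) (baseMap n w) (baseMap n x) (baseMap n u) *
          covEnd (connForm cov z₀.proj) (baseMap n) (jCoord (h.frame z₀)) w v) = 0 := by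
  refine forall_congr' fun z₀ ↦ ?_
  have h1 : (extChartAt 𝓘(ℝ, TModel n) z₀).target = (chartAt (TModel n) z₀).target := by simp
  rw [h1]
  refine forall₂_congr fun w hw ↦ forall₃_congr fun u v x ↦ ?_
  rw [fderiv_coordForm_cyclic (chartAt (TModel n) z₀).open_target (isOpen_extChartAt_target z₀.proj)
    h.mapsTo_baseMap (contDiffOn_inChart hσ.isTwoForm.smooth z₀.proj)
    (contDiffOn_connForm hcov.smooth z₀.proj) h.contDiffOn_jCoord
    (fun w hw ↦ h.jCoord_mul_self hw) (hσ.closed z₀.proj)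
    (fun w hw u v ↦ h.inChart_Omega t hw u v) hw]
  simp

include h in
lemma isClosedForm_Omega_of_isFlat [T2Space M] (hσ : IsSymplecticForm σ)
    (hcov : IsSymplecticConnection σ cov) (t : ℝ) (hf : IsFlat cov) :
    IsClosedForm (TwistorSpace.Omega (σ := σ) cov t) := by
  rw [h.isClosedForm_Omega_iff_forall hσ hcov]
  intro z₀ w hw u v x
  have h1 := fun u v ↦ (isFlat_iff hcov.smooth hcov.torsionFree).1 hf z₀.proj _ (h.mapsTo_baseMap hw) u v
  simp [h1]

end AdaptedCharts

end TwistorForm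

/-! ### Tangent vectors of the fibre and the differential of the Cayley transform. -/

section TangentVectors

variable {V : Type*} [NormedAddCommGroup V] [InnerProductSpace ℝ V] {j c X D B : V →L[ℝ] V}

/-- `D` belongs to the Lie algebra of the symplectic group of `⟪j ·, ·⟫`. -/
def IsInfSymplectic (j D : V →L[ℝ] V) : Prop :=
  ∀ p q, inner ℝ (j (D p)) q + inner ℝ (j p) (D q) = 0

/-- `D` is tangent at `c` to the space of compatible complex structures. -/
structure IsTangentTo (j c D : V →L[ℝ] V) : Prop where
  anti : D * c = -(c * D)
  symplectic : IsInfSymplectic j D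

/-- The differential at `c` of the Cayley transform. -/
def cayleyDeriv (j X D : V →L[ℝ] V) : V →L[ℝ] V := (1 / 2 : ℝ) • ((1 + X) * (j * D) * (1 + X))

lemma cayleyDeriv_add (D D' : V →L[ℝ] V) :
    cayleyDeriv j X (D + D') = cayleyDeriv j X D + cayleyDeriv j X D' := by
  simp only [cayleyDeriv, mul_add, add_mul, smul_add]
  abel

lemma inner_symm_iff (hj : IsOrthComplex j) :
    IsInfSymplectic j D ↔ ∀ p q, inner ℝ ((j * D) p) q = inner ℝ p ((j * D) q) := by
  refine forall₂_congr fun p q ↦ ?_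
  rw [hj.skew p, mul_apply_eq_comp, mul_apply_eq_comp, ← sub_eq_add_neg, sub_eq_zero]

lemma IsInfSymplectic.neg (h : IsInfSymplectic j D) : IsInfSymplectic j (-D) := fun p q ↦ by
  have := h p q
  simp only [neg_apply, map_neg, inner_neg_left, inner_neg_right]
  linarith

lemma IsInfSymplectic.add (h : IsInfSymplectic j D) (h' : IsInfSymplectic j B) :
    IsInfSymplectic j (D + B) := fun p q ↦ by
  have := h p q
  have := h' p q
  simp only [add_apply, map_add, inner_add_left, inner_add_right]
  linarith

lemma IsInfSymplectic.commutator (h : IsInfSymplectic j D) (h' : IsInfSymplectic j B) :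
    IsInfSymplectic j (D * B - B * D) := fun p q ↦ by
  have h1 := h (B p) q
  have h2 := h' (D p) q
  have h3 := h p (B q)
  have h4 := h' p (D q)
  simp only [sub_apply, mul_apply_eq_comp, map_sub, inner_sub_left, inner_sub_right]
  linarith

variable [FiniteDimensional ℝ V]

lemma IsStdCompatible.isInfSymplectic (hj : IsOrthComplex j) (hc : IsStdCompatible j c) :
    IsInfSymplectic j c :=
  (inner_symm_iff hj).2 fun p q ↦ hc.inner_symm hj p q

lemma IsTangentTo.mul_left (hj : IsOrthComplex j) (hc : IsStdCompatible j c)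
    (h : IsTangentTo j c D) : IsTangentTo j c (c * D) := by
  refine ⟨by rw [mul_assoc, h.anti, mul_neg], fun p q ↦ ?_⟩
  have hDc (q) : D (c q) = -c (D q) := congrArg (fun f : V →L[ℝ] V ↦ f q) h.anti
  have h1 := hc.isInfSymplectic hj (D p) q
  have h2 := h.symplectic p (c q)
  simp only [mul_apply_eq_comp]
  rw [hDc, inner_neg_right] at h2
  linarith

lemma IsTangentTo.add (h : IsTangentTo j c D) (h' : IsTangentTo j c B) :
    IsTangentTo j c (D + B) :=
  ⟨by rw [add_mul, mul_add, h.anti, h'.anti, neg_add], h.symplectic.add h'.symplectic⟩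

lemma IsTangentTo.neg (h : IsTangentTo j c D) : IsTangentTo j c (-D) :=
  ⟨by rw [neg_mul, mul_neg, h.anti], h.symplectic.neg⟩

lemma isTangentTo_commutator (hj : IsOrthComplex j) (hc : IsStdCompatible j c)
    (hB : IsInfSymplectic j B) : IsTangentTo j c (B * c - c * B) := by
  refine ⟨?_, hB.commutator (hc.isInfSymplectic hj)⟩
  rw [sub_mul, mul_sub, mul_assoc B, hc.sq, ← mul_assoc c c, hc.sq, mul_assoc c B c]
  ext1 u
  simp [sub_eq_add_neg]

lemma eq_of_isUnit_mul {R : Type*} [Ring R] {a x y b : R} (ha : IsUnit a) (hb : IsUnit b)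
    (h : a * x * b = a * y * b) : x = y := by
  exact ha.mul_left_cancel (hb.mul_right_cancel h)

lemma one_add_mul_mul_cayleyInv (hj : j * j = -1) (hX : IsUnit (1 + X)) :
    (1 + X) * (j * cayleyInv j X) = j * cayleyInv j X * (1 + X) := by
  refine hX.mul_right_cancel ?_
  have h1 := mul_cayleyInv_mul hj hX
  rw [h1, mul_assoc, h1]
  noncomm_ring

/-- Holomorphy of the Cayley transform. It follows because jc commutes with 1 + X and c(1 + X) = (1
+ X)j, where c is the inverse transform of X. -/
lemma cayleyDeriv_mul_left (hj : j * j = -1) (hX : IsUnit (1 + X)) (ha : X * j = -(j * X))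
    (D : V →L[ℝ] V) : cayleyDeriv j X (cayleyInv j X * D) = j * cayleyDeriv j X D := by
  have h1 := one_add_mul_mul_cayleyInv hj hX
  have h2 := cayleyInv_mul_of_anti hX ha
  have h3 : (1 + X) * (j * (cayleyInv j X * D)) * (1 + X) = j * ((1 + X) * (j * D) * (1 + X)) := by
    calc (1 + X) * (j * (cayleyInv j X * D)) * (1 + X)
        = (1 + X) * (j * cayleyInv j X) * D * (1 + X) := by noncomm_ring
      _ = j * (cayleyInv j X * (1 + X)) * D * (1 + X) := by rw [h1]; noncomm_ring
      _ = _ := by rw [h2]; noncomm_ring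
  rw [cayleyDeriv, cayleyDeriv, h3]
  ext1 u
  simp

lemma cayleyDeriv_mul_right (hX : IsUnit (1 + X)) (ha : X * j = -(j * X))
    (D : V →L[ℝ] V) : cayleyDeriv j X (D * cayleyInv j X) = cayleyDeriv j X D * j := by
  have h2 := cayleyInv_mul_of_anti hX ha
  have h3 : (1 + X) * (j * (D * cayleyInv j X)) * (1 + X) = ((1 + X) * (j * D) * (1 + X)) * j := by
    calc (1 + X) * (j * (D * cayleyInv j X)) * (1 + X)
        = (1 + X) * (j * D) * (cayleyInv j X * (1 + X)) := by noncomm_ring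
      _ = _ := by rw [h2]; noncomm_ring
  rw [cayleyDeriv, cayleyDeriv, h3]
  ext1 u
  simp

lemma cayleyDeriv_injective (hj : j * j = -1) (hX : IsUnit (1 + X)) {D D' : V →L[ℝ] V}
    (h : cayleyDeriv j X D = cayleyDeriv j X D') : D = D' := by
  have h1 : (1 + X) * (j * D) * (1 + X) = (1 + X) * (j * D') * (1 + X) :=
    smul_right_injective _ (by norm_num : (1 / 2 : ℝ) ≠ 0) h
  have h2 := congrArg (fun f ↦ -(j * f)) (eq_of_isUnit_mul hX hX h1)
  simp only [← mul_assoc, hj] at h2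
  simpa using h2

/-- The differential is a congruence by the symmetric operator 1 + X, so it preserves the symmetry
of jD; by the multiplication rules, anticommuting with c becomes anticommuting with j. -/
lemma cayleyDeriv_mem_symAnti_iff (hj : IsOrthComplex j)
    (hX : X ∈ symAnti j) (hu : IsUnit (1 + X)) :
    cayleyDeriv j X D ∈ symAnti j ↔ IsTangentTo j (cayleyInv j X) D := by
  have hs (p q : V) : inner ℝ (cayleyDeriv j X D p) q =
      1 / 2 * inner ℝ ((j * D) ((1 + X) p)) ((1 + X) q) := by
    have := hX.2 ((j * D) ((1 + X) p)) q
    simp only [cayleyDeriv, smul_apply, mul_apply_eq_comp, add_apply, one_apply_eq_self,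
      inner_smul_left, inner_add_left, inner_add_right] at this ⊢
    rw [this]
    simp
  have hs' (p q : V) : inner ℝ p (cayleyDeriv j X D q) =
      1 / 2 * inner ℝ ((1 + X) p) ((j * D) ((1 + X) q)) := by
    rw [real_inner_comm, hs, real_inner_comm]
  constructor
  · intro h
    refine ⟨cayleyDeriv_injective hj.sq hu ?_, (inner_symm_iff hj).2 fun p q ↦ ?_⟩
    · have h1 : cayleyDeriv j X (-(cayleyInv j X * D)) = -cayleyDeriv j X (cayleyInv j X * D) := by
        ext1 u; simp [cayleyDeriv]
      rw [h1, cayleyDeriv_mul_left hj.sq hu hX.1, cayleyDeriv_mul_right hu hX.1, h.1]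
    · obtain ⟨p, rfl⟩ := exists_apply_eq hu p
      obtain ⟨q, rfl⟩ := exists_apply_eq hu q
      have h2 := h.2 p q
      rw [hs, hs'] at h2
      linarith
  · intro h
    refine ⟨?_, fun p q ↦ ?_⟩
    · rw [← cayleyDeriv_mul_left hj.sq hu hX.1, ← cayleyDeriv_mul_right hu hX.1, h.anti]
      ext1 u; simp [cayleyDeriv]
    · rw [hs, hs', (inner_symm_iff hj).1 h.symplectic]

end TangentVectors

/-- Differentiating c(1 + X) = j(1 - X) gives c'(1 + X) = -(j + c)X'. Multiplying on the left by (1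
+ X)j leaves (1 + X)(1 - jc)X' = 2X'. -/
lemma cayleyDeriv_fderiv_cayleyInv_comp {V W : Type*} [NormedAddCommGroup V]
    [InnerProductSpace ℝ V] [FiniteDimensional ℝ V] [NormedAddCommGroup W] [NormedSpace ℝ W]
    {j : V →L[ℝ] V} (hj : j * j = -1) {L : W → V →L[ℝ] V} {t : W} (hL : ContDiffAt ℝ ∞ L t)
    (hX : IsUnit (1 + L t)) (u : W) :
    cayleyDeriv j (L t) (fderiv ℝ (fun t ↦ cayleyInv j (L t)) t u) = fderiv ℝ L t u := by
  have hd : DifferentiableAt ℝ (fun t ↦ cayleyInv j (L t)) t :=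
    (contDiffAt_cayleyInv hL hX).differentiableAt (by simp)
  have hL' : HasLineDerivAt ℝ L (fderiv ℝ L t u) t u :=
    (hL.differentiableAt (by simp)).hasFDerivAt.hasLineDerivAt u
  have h1 : HasLineDerivAt ℝ (fun t ↦ cayleyInv j (L t)) _ t u := hd.hasFDerivAt.hasLineDerivAt u
  have h2 := HasDerivAt.mul h1 (HasDerivAt.const_add (1 : V →L[ℝ] V) hL')
  have h3 := HasDerivAt.mul (hasDerivAt_const (0 : ℝ) j) (HasDerivAt.const_sub (1 : V →L[ℝ] V) hL')
  have hc : ContinuousAt (fun s : ℝ ↦ t + s • u) 0 := by fun_prop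
  have hnear : ∀ᶠ t' in 𝓝 t, IsUnit (1 + L t') :=
    (continuousAt_const.add hL.continuousAt).eventually (Units.isOpen.mem_nhds hX)
  have h4 := h2.unique (h3.congr_of_eventuallyEq (by
    filter_upwards [hc.eventually (p := fun t' ↦ IsUnit (1 + L t')) (by simpa using hnear)]
      with s hs using cayleyInv_mul hs))
  simp only [zero_smul, add_zero, zero_mul, zero_add] at h4
  generalize fderiv ℝ (fun t ↦ cayleyInv j (L t)) t u = c' at *
  generalize fderiv ℝ L t u = X' at *
  generalize L t = X at *
  have h5 : (1 + X) * (j * c') * (1 + X) = X' + X' := by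
    calc (1 + X) * (j * c') * (1 + X) = (1 + X) * j * (c' * (1 + X)) := by noncomm_ring
      _ = (1 + X) * j * (j * -X' - cayleyInv j X * X') := by rw [← h4, add_sub_cancel_right]
      _ = -((1 + X) * (j * j) * X') - (1 + X) * (j * cayleyInv j X) * X' := by noncomm_ring
      _ = _ := by
        rw [one_add_mul_mul_cayleyInv hj hX, mul_cayleyInv_mul hj hX, hj]
        noncomm_ring
  rw [cayleyDeriv, h5, ← two_smul ℝ X', smul_smul]
  norm_num

lemma cayleyDeriv_fderiv_cayleyInv {V W : Type*} [NormedAddCommGroup V] [InnerProductSpace ℝ V]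
    [FiniteDimensional ℝ V] [NormedAddCommGroup W] [NormedSpace ℝ W] {j : V →L[ℝ] V}
    (hj : j * j = -1) (L : W →L[ℝ] V →L[ℝ] V) {t : W} (ht : ‖L t‖ < 1) (u : W) :
    cayleyDeriv j (L t) (fderiv ℝ (fun t ↦ cayleyInv j (L t)) t u) = L u := by
  rw [cayleyDeriv_fderiv_cayleyInv_comp hj L.contDiff.contDiffAt (isUnit_one_add_of_norm_lt_one ht),
    ContinuousLinearMap.fderiv]

lemma conj_commutator_add {R : Type*} [Ring R] {g gi g' A c c' : R} (h : g * gi = 1) :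
    c' + c * (g' * gi) - g' * gi * c + g * (A * (gi * c * g) - gi * c * g * A) * gi =
      c' + ((g * A * gi - g' * gi) * c - c * (g * A * gi - g' * gi)) := by
  have h6 : g * (A * (gi * c * g) - gi * c * g * A) * gi = g * A * gi * c - c * (g * A * gi) := by
    calc _ = g * A * gi * c * (g * gi) - (g * gi) * c * (g * A * gi) := by noncomm_ring
      _ = _ := by rw [h, mul_one, one_mul]
  rw [h6]
  noncomm_ring

/-! ### Tangent vectors of the twistor space in a symplectic frame. -/

section Frame

variable {n : ℕ} {M : Type*} [TopologicalSpace M]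
  [ChartedSpace (EuclideanSpace ℝ (Fin (2 * n))) M] [IsManifold 𝓘(ℝ, Model n) ∞ M]
  {σ : BilinField (Model n) M} {x₀ : M}

/-- The connection form in a symplectic frame. -/
def frameForm (cov : LinearConnection n M) (f : SympFrame σ x₀) (y v : Model n) :
    Model n →L[ℝ] Model n :=
  f.g y * connForm cov x₀ y v * Ring.inverse (f.g y) - fderiv ℝ f.g y v * Ring.inverse (f.g y)

/-- The covariant derivative of the canonical section in a symplectic frame. -/
def vertCoord (cov : LinearConnection n M) (f : SympFrame σ x₀) (t u : TModel n) :
    Model n →L[ℝ] Model n :=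
  f.g (baseMap n t) * covEnd (connForm cov x₀) (baseMap n) (jCoord f) t u *
    Ring.inverse (f.g (baseMap n t))

/-- The commutator of the connection form with the canonical section in a symplectic frame. -/
def frameCommutator (cov : LinearConnection n M) (f : SympFrame σ x₀) (t : TModel n) (v : Model n) :
    Model n →L[ℝ] Model n :=
  frameForm cov f (baseMap n t) v * cayleyInv (stdJ n) (fibreMap n t) -
    cayleyInv (stdJ n) (fibreMap n t) * frameForm cov f (baseMap n t) v

/-- The components of the tangent vector of the twistor space with given projection to `M` and
given covariant derivative of the canonical section. -/
def twistorVec (cov : LinearConnection n M) (f : SympFrame σ x₀) (t : TModel n) (v : Model n)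
    (Y : Model n →L[ℝ] Model n) : TModel n :=
  sliceMap n (v, cayleyDeriv (stdJ n) (fibreMap n t) (Y - frameCommutator cov f t v))

variable {cov : LinearConnection n M} {f : SympFrame σ x₀}

-- In a symplectic frame ∇σ = 0 says that the connection form takes values in the symplectic Lie
-- algebra: differentiate σ = ⟪j g·, g·⟫ and compare with `fderiv_inChart_eq`.
set_option synthInstance.maxHeartbeats 200000 in
set_option maxHeartbeats 1000000 in
lemma isInfSymplectic_frameForm (hσ : IsTwoForm σ) (hcov : IsSymplecticConnection σ cov)
    {y : Model n} (hy : y ∈ f.dom) (v : Model n) :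
    IsInfSymplectic (stdJ n) (frameForm cov f y v) := by
  have hu := f.isUnit_g y hy
  have hg : DifferentiableAt ℝ f.g y :=
    (f.contDiffOn_g.contDiffAt (f.isOpen_dom.mem_nhds hy)).differentiableAt (by simp)
  have ht := f.dom_subset hy
  have hω : DifferentiableAt ℝ (inChart σ x₀) y :=
    ((contDiffOn_inChart hσ.smooth x₀).contDiffAt
      ((isOpen_extChartAt_target x₀).mem_nhds ht)).differentiableAt (by simp)
  have key (a b : Model n) : inner ℝ (stdJ n (fderiv ℝ f.g y v a)) (f.g y b) +
      inner ℝ (stdJ n (f.g y a)) (fderiv ℝ f.g y v b) =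
      inner ℝ (stdJ n (f.g y (connForm cov x₀ y v a))) (f.g y b) +
      inner ℝ (stdJ n (f.g y a)) (f.g y (connForm cov x₀ y v b)) := by
    have h1 := fderiv_inChart_eq hσ hcov ht v a b
    rw [f.inChart_eq y hy, f.inChart_eq y hy] at h1
    rw [← h1]
    have hl (a : Model n) : HasLineDerivAt ℝ (fun y ↦ f.g y a) (fderiv ℝ f.g y v a) y v :=
      HasLineDerivAt.clm_apply_const (hg.hasFDerivAt.hasLineDerivAt v) a
    have hl2 : HasLineDerivAt ℝ (fun y ↦ inChart σ x₀ y a b) (fderiv ℝ (inChart σ x₀) y v a b) y v :=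
      HasLineDerivAt.clm_apply_const
        (HasLineDerivAt.clm_apply_const (hω.hasFDerivAt.hasLineDerivAt v) a) b
    have hl3 : HasDerivAt (fun s : ℝ ↦ stdJ n (f.g (y + s • v) a)) (stdJ n (fderiv ℝ f.g y v a)) 0 :=
      (stdJ n).hasFDerivAt.comp_hasDerivAt 0 (hl a)
    have hl4 := hl3.inner ℝ (hl b)
    have hc : ContinuousAt (fun s : ℝ ↦ y + s • v) 0 := by fun_prop
    have hnear : ∀ᶠ s : ℝ in 𝓝 0, y + s • v ∈ f.dom :=
      hc.eventually (f.isOpen_dom.mem_nhds (by simpa using hy))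
    have h5 := HasDerivAt.unique (hl4.congr_of_eventuallyEq (f₁ := fun s : ℝ ↦ inChart σ x₀ (y + s • v) a b) (by
      filter_upwards [hnear] with s hs using f.inChart_eq _ hs a b)) hl2
    simp only [zero_smul, add_zero] at h5
    rw [← h5, add_comm]
  intro p q
  have := key (Ring.inverse (f.g y) p) (Ring.inverse (f.g y) q)
  have hi (p) : f.g y (Ring.inverse (f.g y) p) = p :=
    congrArg (fun f : Model n →L[ℝ] Model n ↦ f p) (Ring.mul_inverse_cancel _ hu)
  rw [hi, hi] at this
  simp only [frameForm, sub_apply, mul_apply_eq_comp, map_sub, inner_sub_left, inner_sub_right]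
  linarith

lemma vertCoord_eq {t : TModel n} (h1 : baseMap n t ∈ f.dom) (h2 : ‖fibreMap n t‖ < 1)
    (u : TModel n) :
    vertCoord cov f t u = fderiv ℝ (fun t ↦ cayleyInv (stdJ n) (fibreMap n t)) t u +
      frameCommutator cov f t (baseMap n u) := by
  have hu := f.isUnit_g _ h1
  have hg := f.contDiffOn_g.contDiffAt (f.isOpen_dom.mem_nhds h1)
  have hX := isUnit_one_add_of_norm_lt_one h2
  have hd : DifferentiableAt ℝ (fun t ↦ cayleyInv (stdJ n) (fibreMap n t)) t :=
    (contDiffAt_cayleyInv (fibreMap n).contDiff.contDiffAt hX).differentiableAt (by simp)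
  have h3 := (fderiv_conj (b := baseMap n) (C := f.g) (Ci := fun y ↦ Ring.inverse (f.g y))
    (hg.differentiableAt (by simp))
    ((contDiffAt_ringInverse_comp hg hu).differentiableAt (by simp)) hd
    (by filter_upwards [f.isOpen_dom.mem_nhds h1] with y hy using
      Ring.mul_inverse_cancel _ (f.isUnit_g y hy)) (Ring.inverse_mul_cancel _ hu)).2 u
  rw [vertCoord, covEnd, mul_add, add_mul]
  have h4 : jCoord f = fun w ↦ Ring.inverse (f.g (baseMap n w)) *
    cayleyInv (stdJ n) (fibreMap n w) * f.g (baseMap n w) := rfl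
  rw [h4, h3]
  simp only [frameCommutator, frameForm]
  exact conj_commutator_add (Ring.mul_inverse_cancel _ hu)

/-- Solves for the fibre coordinates of u in terms of its covariant derivative and its projection to
the base; `twistorVec` is built from this formula. -/
lemma cayleyDeriv_vertCoord {t : TModel n} (h1 : baseMap n t ∈ f.dom) (h2 : ‖fibreMap n t‖ < 1)
    (u : TModel n) :
    cayleyDeriv (stdJ n) (fibreMap n t) (vertCoord cov f t u) =
      fibreMap n u + cayleyDeriv (stdJ n) (fibreMap n t) (frameCommutator cov f t (baseMap n u)) := by
  rw [vertCoord_eq h1 h2, cayleyDeriv_add,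
    cayleyDeriv_fderiv_cayleyInv (isOrthComplex_stdJ n).sq _ h2]

lemma isTangentTo_frameCommutator (hσ : IsTwoForm σ) (hcov : IsSymplecticConnection σ cov)
    {t : TModel n} (h1 : baseMap n t ∈ f.dom) (h2 : ‖fibreMap n t‖ < 1) (v : Model n) :
    IsTangentTo (stdJ n) (cayleyInv (stdJ n) (fibreMap n t)) (frameCommutator cov f t v) :=
  isTangentTo_commutator (isOrthComplex_stdJ n) (isStdCompatible_cayleyInv_fibreMap h2)
    (isInfSymplectic_frameForm hσ hcov h1 v)

lemma isTangentTo_vertCoord (hσ : IsTwoForm σ) (hcov : IsSymplecticConnection σ cov)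
    {t : TModel n} (h1 : baseMap n t ∈ f.dom) (h2 : ‖fibreMap n t‖ < 1) (u : TModel n) :
    IsTangentTo (stdJ n) (cayleyInv (stdJ n) (fibreMap n t)) (vertCoord cov f t u) := by
  have hX := isUnit_one_add_of_norm_lt_one h2
  rw [← cayleyDeriv_mem_symAnti_iff (isOrthComplex_stdJ n) (fibreMap_mem t) hX,
    cayleyDeriv_vertCoord h1 h2]
  exact add_mem (fibreMap_mem u) ((cayleyDeriv_mem_symAnti_iff (isOrthComplex_stdJ n)
    (fibreMap_mem t) hX).2 (isTangentTo_frameCommutator hσ hcov h1 h2 _))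

lemma cayleyDeriv_sub_frameCommutator_mem (hσ : IsTwoForm σ) (hcov : IsSymplecticConnection σ cov)
    {t : TModel n} (h1 : baseMap n t ∈ f.dom) (h2 : ‖fibreMap n t‖ < 1) (v : Model n)
    {Y : Model n →L[ℝ] Model n}
    (hY : IsTangentTo (stdJ n) (cayleyInv (stdJ n) (fibreMap n t)) Y) :
    cayleyDeriv (stdJ n) (fibreMap n t) (Y - frameCommutator cov f t v) ∈ symAnti (stdJ n) := by
  rw [cayleyDeriv_mem_symAnti_iff (isOrthComplex_stdJ n) (fibreMap_mem t)
    (isUnit_one_add_of_norm_lt_one h2), sub_eq_add_neg]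
  exact hY.add (isTangentTo_frameCommutator hσ hcov h1 h2 v).neg

lemma baseMap_twistorVec (hσ : IsTwoForm σ) (hcov : IsSymplecticConnection σ cov)
    {t : TModel n} (h1 : baseMap n t ∈ f.dom) (h2 : ‖fibreMap n t‖ < 1) (v : Model n)
    {Y : Model n →L[ℝ] Model n}
    (hY : IsTangentTo (stdJ n) (cayleyInv (stdJ n) (fibreMap n t)) Y) :
    baseMap n (twistorVec cov f t v Y) = v :=
  baseMap_sliceMap (cayleyDeriv_sub_frameCommutator_mem hσ hcov h1 h2 v hY)

/-- With `baseMap_twistorVec` and `twistorVec_vertCoord` this identifies the tangent vectors at a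
point with the pairs of a vector of the base and a tangent vector of the fibre. -/
lemma vertCoord_twistorVec (hσ : IsTwoForm σ) (hcov : IsSymplecticConnection σ cov)
    {t : TModel n} (h1 : baseMap n t ∈ f.dom) (h2 : ‖fibreMap n t‖ < 1) (v : Model n)
    {Y : Model n →L[ℝ] Model n}
    (hY : IsTangentTo (stdJ n) (cayleyInv (stdJ n) (fibreMap n t)) Y) :
    vertCoord cov f t (twistorVec cov f t v Y) = Y := by
  refine cayleyDeriv_injective (isOrthComplex_stdJ n).sq (isUnit_one_add_of_norm_lt_one h2) ?_
  rw [cayleyDeriv_vertCoord h1 h2, baseMap_twistorVec hσ hcov h1 h2 v hY, twistorVec,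
    fibreMap_sliceMap (cayleyDeriv_sub_frameCommutator_mem hσ hcov h1 h2 v hY), ← cayleyDeriv_add,
    sub_add_cancel]

lemma twistorVec_vertCoord {t : TModel n} (h1 : baseMap n t ∈ f.dom) (h2 : ‖fibreMap n t‖ < 1)
    (u : TModel n) : twistorVec cov f t (baseMap n u) (vertCoord cov f t u) = u := by
  rw [twistorVec, vertCoord_eq h1 h2, add_sub_cancel_right,
    cayleyDeriv_fderiv_cayleyInv (isOrthComplex_stdJ n).sq _ h2, sliceMap_ambientEquiv]

end Frame

/-- Uniqueness forces linearity: the sum of the chosen solutions for X and Y solves the problem for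
X + Y. -/
lemma exists_clm_of_existsUnique {U V W : Type*} [AddCommGroup U] [Module ℝ U] [TopologicalSpace U]
    [IsTopologicalAddGroup U] [ContinuousSMul ℝ U] [T2Space U] [FiniteDimensional ℝ U]
    [AddCommGroup V] [Module ℝ V] [TopologicalSpace V]
    [AddCommGroup W] [Module ℝ W] [TopologicalSpace W] (D : U →L[ℝ] V) (K : V →L[ℝ] V)
    (D' : U →L[ℝ] W) (K' : W →L[ℝ] W)
    (h : ∀ X, ∃! X', D X' = K (D X) ∧ D' X' = K' (D' X)) :
    ∃ J : U →L[ℝ] U, ∀ X, D (J X) = K (D X) ∧ D' (J X) = K' (D' X) := by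
  choose J hJ hu using h
  refine ⟨LinearMap.toContinuousLinearMap
    { toFun := J
      map_add' := fun X Y ↦ (hu _ _ ⟨?_, ?_⟩).symm
      map_smul' := fun c X ↦ (hu _ _ ⟨?_, ?_⟩).symm }, hJ⟩
  all_goals simp [(hJ _).1, (hJ _).2]

/-! ### Existence, uniqueness and smoothness of the twistor almost complex structure. -/

section AlmostComplex

variable {n : ℕ} {M : Type*} [TopologicalSpace M]
  [ChartedSpace (EuclideanSpace ℝ (Fin (2 * n))) M] [IsManifold 𝓘(ℝ, Model n) ∞ M]
  {σ : BilinField (Model n) M} {cov : LinearConnection n M} {x₀ : M} {f : SympFrame σ x₀}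

lemma frame_mul_jCoord {t : TModel n} (h1 : baseMap n t ∈ f.dom) :
    f.g (baseMap n t) * jCoord f t = cayleyInv (stdJ n) (fibreMap n t) * f.g (baseMap n t) := by
  rw [jCoord, ← mul_assoc, ← mul_assoc, Ring.mul_inverse_cancel _ (f.isUnit_g _ h1), one_mul]

lemma vertCoord_eq_mul_iff {t : TModel n} (h1 : baseMap n t ∈ f.dom) (u u' : TModel n) :
    vertCoord cov f t u' = cayleyInv (stdJ n) (fibreMap n t) * vertCoord cov f t u ↔
      covEnd (connForm cov x₀) (baseMap n) (jCoord f) t u' =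
        jCoord f t * covEnd (connForm cov x₀) (baseMap n) (jCoord f) t u := by
  have hu := f.isUnit_g _ h1
  have hi : IsUnit (Ring.inverse (f.g (baseMap n t))) := by
    obtain ⟨g, hg⟩ := hu
    rw [← hg, Ring.inverse_unit]
    exact g⁻¹.isUnit
  rw [vertCoord, vertCoord, ← mul_assoc, ← mul_assoc, ← frame_mul_jCoord h1, mul_assoc (f.g _) (jCoord f t)]
  exact ⟨fun h ↦ eq_of_isUnit_mul hu hi h, fun h ↦ by rw [h]⟩

lemma endCoord_injective {x : M} (hx : x ∈ (chartAt (Model n) x₀).source)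
    {A B : TangentSpace 𝓘(ℝ, Model n) x →L[ℝ] TangentSpace 𝓘(ℝ, Model n) x}
    (h : endCoord x₀ x A = endCoord x₀ x B) : A = B := by
  ext1 u
  have := congrArg (fun f : Model n →L[ℝ] Model n ↦ ofCoord x₀ x (f (toCoord x₀ x u))) h
  simpa only [endCoord_apply, ofCoord_toCoord hx] using this

namespace AdaptedCharts

variable [ChartedSpace (TModel n) (TwistorSpace σ)] (h : AdaptedCharts σ)
  {z₀ z : TwistorSpace σ} [IsManifold 𝓘(ℝ, TModel n) ∞ (TwistorSpace σ)]

lemma toCoord_Phi (hz : z ∈ (chartAt (TModel n) z₀).source)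
    (v : TangentSpace 𝓘(ℝ, Model n) z.proj) :
    toCoord z₀.proj z.proj (z.Phi v) =
      jCoord (h.frame z₀) (chartAt (TModel n) z₀ z) (toCoord z₀.proj z.proj v) := by
  rw [← h.endCoord_Phi hz, endCoord_apply, ofCoord_toCoord (h.proj_mem_source hz)]

lemma dproj_eq_Phi_iff (hz : z ∈ (chartAt (TModel n) z₀).source)
    (X X' : TangentSpace 𝓘(ℝ, TModel n) z) :
    z.dproj X' = z.Phi (z.dproj X) ↔ baseMap n (toCoord z₀ z X') =
      jCoord (h.frame z₀) (chartAt (TModel n) z₀ z) (baseMap n (toCoord z₀ z X)) := by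
  have hs := h.proj_mem_source hz
  rw [← (h.dproj_apply hz).2, ← (h.dproj_apply hz).2, ← h.toCoord_Phi hz]
  refine ⟨fun h ↦ by rw [h], fun h ↦ ?_⟩
  rw [← ofCoord_toCoord hs (z.dproj X'), h, ofCoord_toCoord hs]

lemma P_eq_Phi_iff (hz : z ∈ (chartAt (TModel n) z₀).source)
    (X X' : TangentSpace 𝓘(ℝ, TModel n) z) :
    TwistorSpace.P cov z X' = z.Phi.comp (TwistorSpace.P cov z X) ↔
      vertCoord cov (h.frame z₀) (chartAt (TModel n) z₀ z) (toCoord z₀ z X') =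
      cayleyInv (stdJ n) (fibreMap n (chartAt (TModel n) z₀ z)) *
        vertCoord cov (h.frame z₀) (chartAt (TModel n) z₀ z) (toCoord z₀ z X) := by
  have hs := h.proj_mem_source hz
  rw [vertCoord_eq_mul_iff (h.baseMap_mem hz)]
  have h1 : TwistorSpace.P cov z X' = z.Phi.comp (TwistorSpace.P cov z X) ↔
      endCoord z₀.proj z.proj (TwistorSpace.P cov z X') =
        endCoord z₀.proj z.proj (z.Phi.comp (TwistorSpace.P cov z X)) :=
    ⟨fun h ↦ by rw [h], fun h ↦ endCoord_injective hs h⟩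
  rw [h1, endCoord_mul hs, h.endCoord_P hz, h.endCoord_P hz, h.endCoord_Phi hz]
  have hjj := h.jCoord_mul_self ((chartAt (TModel n) z₀).map_source hz)
  generalize covEnd (connForm cov z₀.proj) (baseMap n) (jCoord (h.frame z₀))
    (chartAt (TModel n) z₀ z) (toCoord z₀ z X) = N
  generalize covEnd (connForm cov z₀.proj) (baseMap n) (jCoord (h.frame z₀))
    (chartAt (TModel n) z₀ z) (toCoord z₀ z X') = N'
  generalize jCoord (h.frame z₀) (chartAt (TModel n) z₀ z) = j at *
  have h2 : j * (-(1 / 2 : ℝ)) • (N * j) = (-(1 / 2 : ℝ)) • (j * N * j) := by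
    ext1 u
    simp only [mul_apply_eq_comp, smul_apply, map_smul]
  rw [h2]
  refine ⟨fun h ↦ ?_, fun h ↦ by rw [h]⟩
  have h3 : N' * j = j * N * j := smul_right_injective _ (by norm_num : (-(1 / 2 : ℝ)) ≠ 0) h
  have h4 := congrArg (· * j) h3
  simp only [mul_assoc, hjj] at h4
  ext1 u
  have h5 := congrArg (fun f : Model n →L[ℝ] Model n ↦ -f u) h4
  simpa using h5

/-- The two conditions prescribe the base part and the vertical part of X'. The prescribed vertical
part is admissible because tangent spaces of the fibre are stable under left multiplication
(`IsTangentTo.mul_left`), so exactly one vector fits. -/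
lemma twistor_iff (hσ : IsTwoForm σ) (hcov : IsSymplecticConnection σ cov)
    (hz : z ∈ (chartAt (TModel n) z₀).source) (X X' : TangentSpace 𝓘(ℝ, TModel n) z) :
    (z.dproj X' = z.Phi (z.dproj X) ∧
      TwistorSpace.P cov z X' = z.Phi.comp (TwistorSpace.P cov z X)) ↔
    toCoord z₀ z X' = twistorVec cov (h.frame z₀) (chartAt (TModel n) z₀ z)
      (jCoord (h.frame z₀) (chartAt (TModel n) z₀ z) (baseMap n (toCoord z₀ z X)))
      (cayleyInv (stdJ n) (fibreMap n (chartAt (TModel n) z₀ z)) *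
        vertCoord cov (h.frame z₀) (chartAt (TModel n) z₀ z) (toCoord z₀ z X)) := by
  have h1 := h.baseMap_mem hz
  have h2 := h.norm_fibreMap_lt hz
  rw [h.dproj_eq_Phi_iff hz, h.P_eq_Phi_iff hz]
  constructor
  · rintro ⟨h3, h4⟩
    rw [← h3, ← h4, twistorVec_vertCoord h1 h2]
  · intro h3
    have hY := (isTangentTo_vertCoord (f := h.frame z₀) hσ hcov h1 h2 (toCoord z₀ z X)).mul_left
      (isOrthComplex_stdJ n) (isStdCompatible_cayleyInv_fibreMap h2)
    rw [h3]
    exact ⟨baseMap_twistorVec hσ hcov h1 h2 _ hY, vertCoord_twistorVec hσ hcov h1 h2 _ hY⟩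

include h in
lemma existsUnique_twistor (hσ : IsTwoForm σ) (hcov : IsSymplecticConnection σ cov)
    (X : TangentSpace 𝓘(ℝ, TModel n) z) :
    ∃! X' : TangentSpace 𝓘(ℝ, TModel n) z, z.dproj X' = z.Phi (z.dproj X) ∧
      TwistorSpace.P cov z X' = z.Phi.comp (TwistorSpace.P cov z X) := by
  have hz := mem_chart_source (TModel n) z
  simp only [h.twistor_iff hσ hcov hz]
  refine ⟨ofCoord z z _, toCoord_ofCoord hz _, fun X' hX' ↦ ?_⟩
  rw [← hX', ofCoord_toCoord hz]

include h in
lemma exists_twistor (hσ : IsTwoForm σ) (hcov : IsSymplecticConnection σ cov)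
    (z : TwistorSpace σ) : ∃ J : TangentSpace 𝓘(ℝ, TModel n) z →L[ℝ] TangentSpace 𝓘(ℝ, TModel n) z,
      ∀ X, z.dproj (J X) = z.Phi (z.dproj X) ∧
        TwistorSpace.P cov z (J X) = z.Phi.comp (TwistorSpace.P cov z X) :=
  exists_clm_of_existsUnique z.dproj z.Phi (TwistorSpace.P cov z)
    (ContinuousLinearMap.postcomp _ z.Phi) fun _ ↦ h.existsUnique_twistor hσ hcov _

/-- The twistor almost complex structure. -/
def twistorJ (hσ : IsTwoForm σ) (hcov : IsSymplecticConnection σ cov) :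
    EndField (TModel n) (TwistorSpace σ) := fun z ↦ (h.exists_twistor hσ hcov z).choose

lemma twistorJ_spec (hσ : IsTwoForm σ) (hcov : IsSymplecticConnection σ cov)
    (X : TangentSpace 𝓘(ℝ, TModel n) z) :
    z.dproj (h.twistorJ hσ hcov z X) = z.Phi (z.dproj X) ∧
      TwistorSpace.P cov z (h.twistorJ hσ hcov z X) = z.Phi.comp (TwistorSpace.P cov z X) :=
  (h.exists_twistor hσ hcov z).choose_spec X

lemma isTwistorStructure_iff (hσ : IsTwoForm σ) (hcov : IsSymplecticConnection σ cov)
    (J' : EndField (TModel n) (TwistorSpace σ)) :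
    TwistorSpace.IsTwistorStructure cov J' ↔ J' = h.twistorJ hσ hcov := by
  constructor
  · intro h1
    funext z
    ext1 X
    exact (h.existsUnique_twistor hσ hcov X).unique (h1 z X) (h.twistorJ_spec hσ hcov X)
  · rintro rfl z X
    exact h.twistorJ_spec hσ hcov X

lemma contDiffAt_connTerms [T2Space M] (hcov : IsSymplecticConnection σ cov) {t : TModel n}
    (ht : t ∈ (chartAt (TModel n) z₀).target) (u : TModel n) :
    ContDiffAt ℝ ∞ (fun t ↦ vertCoord cov (h.frame z₀) t u) t ∧
    ContDiffAt ℝ ∞ (fun t ↦ frameCommutator cov (h.frame z₀) t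
      (jCoord (h.frame z₀) t (baseMap n u))) t := by
  have ht' := (h.mem_target z₀ t).1 ht
  have hb : ContDiffAt ℝ ∞ (baseMap n) t := (baseMap n).contDiff.contDiffAt
  have hg0 := (h.frame z₀).contDiffOn_g.contDiffAt ((h.frame z₀).isOpen_dom.mem_nhds ht'.1)
  have hg : ContDiffAt ℝ ∞ (fun t ↦ (h.frame z₀).g (baseMap n t)) t := hg0.comp t hb
  have hgi := contDiffAt_ringInverse_comp hg ((h.frame z₀).isUnit_g _ ht'.1)
  have hDg : ContDiffAt ℝ ∞ (fun t ↦ fderiv ℝ (h.frame z₀).g (baseMap n t)) t :=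
    (hg0.fderiv_right (m := ∞) (by simp)).comp t hb
  have hj := contDiffAt_jCoord (h.frame z₀) ht'.1 ht'.2
  have hDj : ContDiffAt ℝ ∞ (fderiv ℝ (jCoord (h.frame z₀))) t :=
    hj.fderiv_right (m := ∞) (by simp)
  have hA : ContDiffAt ℝ ∞ (fun t ↦ connForm cov z₀.proj (baseMap n t)) t :=
    ((contDiffOn_connForm hcov.smooth z₀.proj).contDiffAt
      ((isOpen_extChartAt_target z₀.proj).mem_nhds (h.mapsTo_baseMap ht))).comp t hb
  have hc : ContDiffAt ℝ ∞ (fun t ↦ cayleyInv (stdJ n) (fibreMap n t)) t :=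
    contDiffAt_cayleyInv (fibreMap n).contDiff.contDiffAt (isUnit_one_add_of_norm_lt_one ht'.2)
  have hv : ContDiffAt ℝ ∞ (fun t ↦ jCoord (h.frame z₀) t (baseMap n u)) t :=
    hj.clm_apply contDiffAt_const
  have hAu : ContDiffAt ℝ ∞ (fun t ↦ connForm cov z₀.proj (baseMap n t) (baseMap n u)) t :=
    hA.clm_apply contDiffAt_const
  have hAv : ContDiffAt ℝ ∞ (fun t ↦ connForm cov z₀.proj (baseMap n t)
      (jCoord (h.frame z₀) t (baseMap n u))) t := hA.clm_apply hv
  have hDgv : ContDiffAt ℝ ∞ (fun t ↦ fderiv ℝ (h.frame z₀).g (baseMap n t)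
      (jCoord (h.frame z₀) t (baseMap n u))) t := hDg.clm_apply hv
  have hm {f g : TModel n → Model n →L[ℝ] Model n} (hf : ContDiffAt ℝ ∞ f t)
      (hg : ContDiffAt ℝ ∞ g t) : ContDiffAt ℝ ∞ (fun t ↦ f t * g t) t := hf.clm_comp hg
  have hB := (hm (hm hg hAv) hgi).sub (hm hDgv hgi)
  exact ⟨hm (hm hg ((hDj.clm_apply contDiffAt_const).add ((hm hAu hj).sub (hm hj hAu)))) hgi,
    (hm hB hc).sub (hm hc hB)⟩

lemma endInChart_twistorJ (hσ : IsTwoForm σ) (hcov : IsSymplecticConnection σ cov) {t : TModel n}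
    (ht : t ∈ (chartAt (TModel n) z₀).target) (u : TModel n) :
    endInChart (h.twistorJ hσ hcov) z₀ t u = twistorVec cov (h.frame z₀) t
      (jCoord (h.frame z₀) t (baseMap n u))
      (cayleyInv (stdJ n) (fibreMap n t) * vertCoord cov (h.frame z₀) t u) := by
  have hz : (extChartAt 𝓘(ℝ, TModel n) z₀).symm t ∈ (chartAt (TModel n) z₀).source :=
    (chartAt (TModel n) z₀).map_target ht
  have hr : chartAt (TModel n) z₀ ((extChartAt 𝓘(ℝ, TModel n) z₀).symm t) = t :=
    (chartAt (TModel n) z₀).right_inv ht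
  have := (h.twistor_iff hσ hcov hz _ _).1 (h.twistorJ_spec hσ hcov
    (ofCoord z₀ ((extChartAt 𝓘(ℝ, TModel n) z₀).symm t) u))
  rw [hr, toCoord_ofCoord hz] at this
  exact this

lemma isAlmostComplex_twistorJ [T2Space M] (hσ : IsTwoForm σ)
    (hcov : IsSymplecticConnection σ cov) : IsAlmostComplex (h.twistorJ hσ hcov) := by
  constructor
  · refine contMDiff_endField fun z₀ ↦ contDiffAt_clm_of_apply fun u ↦ ?_
    have ht := mem_chart_target (TModel n) z₀
    have ht' := (h.mem_target z₀ _).1 ht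
    obtain ⟨h1, h2⟩ := h.contDiffAt_connTerms hcov ht u
    have hj := contDiffAt_jCoord (h.frame z₀) ht'.1 ht'.2
    have hc : ContDiffAt ℝ ∞ (fun t ↦ cayleyInv (stdJ n) (fibreMap n t)) (chartAt (TModel n) z₀ z₀) :=
      contDiffAt_cayleyInv (fibreMap n).contDiff.contDiffAt (isUnit_one_add_of_norm_lt_one ht'.2)
    have hm {f g : TModel n → Model n →L[ℝ] Model n}
        (hf : ContDiffAt ℝ ∞ f (chartAt (TModel n) z₀ z₀))
        (hg : ContDiffAt ℝ ∞ g (chartAt (TModel n) z₀ z₀)) :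
        ContDiffAt ℝ ∞ (fun t ↦ f t * g t) (chartAt (TModel n) z₀ z₀) := hf.clm_comp hg
    have hZ : ContDiffAt ℝ ∞ (fun t ↦ 1 + fibreMap n t) (chartAt (TModel n) z₀ z₀) :=
      contDiffAt_const.add (fibreMap n).contDiff.contDiffAt
    have h3 : ContDiffAt ℝ ∞ (fun t ↦ cayleyDeriv (stdJ n) (fibreMap n t)
        (cayleyInv (stdJ n) (fibreMap n t) * vertCoord cov (h.frame z₀) t u -
          frameCommutator cov (h.frame z₀) t (jCoord (h.frame z₀) t (baseMap n u))))
        (chartAt (TModel n) z₀ z₀) :=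
      ContDiffAt.const_smul (1 / 2 : ℝ)
        (hm (hm hZ (hm (contDiffAt_const (c := stdJ n)) ((hm hc h1).sub h2))) hZ)
    have h4 := (sliceMap n).contDiff.contDiffAt.comp _
      ((hj.clm_apply (contDiffAt_const (c := baseMap n u))).prodMk h3)
    refine h4.congr_of_eventuallyEq ?_
    filter_upwards [(chartAt (TModel n) z₀).open_target.mem_nhds ht] with t ht
      using h.endInChart_twistorJ hσ hcov ht u
  · intro z X
    -- Both J(JX) and -X satisfy the equations that determine J at the vector JX.
    refine (h.existsUnique_twistor hσ hcov (h.twistorJ hσ hcov z X)).unique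
      (h.twistorJ_spec hσ hcov _) ⟨?_, ?_⟩
    · rw [(h.twistorJ_spec hσ hcov X).1, map_neg]
      exact (z.2.sq _).symm
    · rw [(h.twistorJ_spec hσ hcov X).2, map_neg]
      ext1 u
      exact (z.2.sq _).symm

end AdaptedCharts

end AlmostComplex

/-! ### Tangent vectors of the fibres detect the symplectic Lie algebra. -/

section Span

variable {V : Type*} [NormedAddCommGroup V] [InnerProductSpace ℝ V] [FiniteDimensional ℝ V]
  {j c R : V →L[ℝ] V}

/-- The rank one infinitesimal symplectic transformation `p ↦ ⟪j v, p⟫ v`. -/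
def transvection (j : V →L[ℝ] V) (v : V) : V →L[ℝ] V := (innerSL ℝ (j v)).smulRight v

lemma transvection_apply (v p : V) : transvection j v p = (inner ℝ (j v) p : ℝ) • v := by
  simp [transvection]

lemma trE_mul_transvection (v : V) :
    trE V (R * transvection j v) = inner ℝ (j v) (R v) := by
  have h : (R * transvection j v : V →L[ℝ] V).toLinearMap =
      (innerSL ℝ (j v)).toLinearMap.smulRight (R v) := by
    ext1 p
    change R (transvection j v p) = _
    rw [transvection_apply, map_smul]
    simp
  rw [trE_apply, h, LinearMap.trace_smulRight]
  simp

lemma isInfSymplectic_transvection (hj : IsOrthComplex j) (v : V) :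
    IsInfSymplectic j (transvection j v) := fun p q ↦ by
  have h1 : inner ℝ (j p) v = -inner ℝ (j v) p := by
    rw [hj.skew, real_inner_comm]
  simp only [transvection_apply, map_smul, inner_smul_left, inner_smul_right, h1]
  simp
  ring

/-- Writing T for the transvection of v, one has c T c = -`transvection j (c v)`; the difference is
thus T + c T c, twice the part of T anticommuting with c. -/
lemma isTangentTo_transvection (hj : IsOrthComplex j) (hc : IsStdCompatible j c) (v : V) :
    IsTangentTo j c (transvection j v - transvection j (c v)) := by
  have hcc (u) : c (c u) = -u := congrArg (fun f : V →L[ℝ] V ↦ f u) hc.sq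
  refine ⟨?_, ?_⟩
  · ext1 p
    have h1 := hc.isInfSymplectic hj v p
    have h2 := hc.invariant v p
    simp only [mul_apply_eq_comp, sub_apply, neg_apply, transvection_apply, map_sub, map_smul, hcc]
    rw [h2, show inner ℝ (j v) (c p) = -inner ℝ (j (c v)) p by linarith]
    module
  · rw [sub_eq_add_neg]
    exact (isInfSymplectic_transvection hj v).add (isInfSymplectic_transvection hj _).neg

lemma isStdCompatible_self (hj : IsOrthComplex j) : IsStdCompatible j j :=
  ⟨hj.sq, fun u v ↦ hj.inner_apply_apply _ _, fun u hu ↦ by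
    rw [hj.inner_apply_apply]; exact real_inner_self_pos.2 hu⟩

/-- Testing on differences of transvections shows that q(v) = ⟪jv, Rv⟫ satisfies q(cv) = q(v) for
every compatible c. With c = j this is q(jv) = q(v); with cv = ½jv it is q(v) = ¼q(jv). So q = 0,
and since R is infinitesimally symplectic, polarisation gives R = 0. -/
lemma eq_zero_of_trE_mul_eq_zero (hj : IsOrthComplex j) (hR : IsInfSymplectic j R)
    (h : ∀ c, IsStdCompatible j c → ∀ Y, IsTangentTo j c Y → trE V (R * Y) = 0) : R = 0 := by
  have hq (c) (hc : IsStdCompatible j c) (v : V) :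
      inner ℝ (j v) (R v) = inner ℝ (j (c v)) (R (c v)) := by
    have := h c hc _ (isTangentTo_transvection hj hc v)
    rw [mul_sub, map_sub, trE_mul_transvection, trE_mul_transvection] at this
    linarith
  have hq0 (v : V) : inner ℝ (j v) (R v) = 0 := by
    obtain ⟨c, hc, hcv⟩ := exists_isStdCompatible_apply hj v
    have h1 := hq c hc v
    have h2 := hq j (isStdCompatible_self hj) v
    rw [hcv] at h1
    simp only [map_smul, inner_smul_left, inner_smul_right] at h1
    rw [← h2] at h1
    simp at h1
    linarith
  have hs (v w : V) : inner ℝ (j v) (R w) = inner ℝ (j w) (R v) := by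
    have := hR v w
    have h1 : inner ℝ (j (R v)) w = -inner ℝ (j w) (R v) := by rw [hj.skew, real_inner_comm]
    linarith
  ext1 w
  have h1 (v : V) : inner ℝ (j v) (R w) = 0 := by
    have h2 := hq0 (v + w)
    simp only [map_add, inner_add_left, inner_add_right, hq0] at h2
    have := hs v w
    linarith
  have h2 := h1 (-(j (R w)))
  rw [map_neg, hj.apply_apply, neg_neg, inner_self_eq_zero] at h2
  exact h2

end Span

/-! ### Algebraic properties of the curvature of a symplectic connection. -/

section CurvForm

variable {E : Type*} [NormedAddCommGroup E] [NormedSpace ℝ E] {ϖ : E → E →L[ℝ] E →L[ℝ] ℝ}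
  {A : E → E →L[ℝ] E →L[ℝ] E} {U : Set E} {y : E}

set_option synthInstance.maxHeartbeats 200000 in
lemma curvForm_zero_left (u : E) : curvForm A y 0 u = 0 := by
  have h1 : fderiv ℝ A y 0 = 0 := (fderiv ℝ A y).map_zero
  have h2 : fderiv ℝ A y u 0 = 0 := (fderiv ℝ A y u).map_zero
  have h3 : A y 0 = 0 := (A y).map_zero
  rw [curvForm, h1, h2, h3, zero_mul, mul_zero, zero_apply]
  abel

set_option synthInstance.maxHeartbeats 200000 in
lemma curvForm_zero_right (u : E) : curvForm A y u 0 = 0 := by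
  have h1 : fderiv ℝ A y 0 = 0 := (fderiv ℝ A y).map_zero
  have h2 : fderiv ℝ A y u 0 = 0 := (fderiv ℝ A y u).map_zero
  have h3 : A y 0 = 0 := (A y).map_zero
  rw [curvForm, h1, h2, h3, zero_mul, mul_zero, zero_apply]
  abel

-- Differentiate the condition ∇ϖ = 0 once more: antisymmetrising, the second derivatives of ϖ(a, b)
-- drop out, and what is left says that the curvature lies in the symplectic Lie algebra.
set_option synthInstance.maxHeartbeats 200000 in
set_option maxHeartbeats 1000000 in
lemma curvForm_skew (hU : IsOpen U) (hy : y ∈ U) (hω : ContDiffOn ℝ ∞ ϖ U)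
    (hA : DifferentiableAt ℝ A y)
    (h : ∀ y ∈ U, ∀ v a b, fderiv ℝ ϖ y v a b = ϖ y (A y v a) b + ϖ y a (A y v b)) (u v a b : E) :
    ϖ y (curvForm A y u v a) b + ϖ y a (curvForm A y u v b) = 0 := by
  have hd (y) (hy : y ∈ U) : DifferentiableAt ℝ ϖ y :=
    (hω.contDiffAt (hU.mem_nhds hy)).differentiableAt (by simp)
  have hφ : ContDiffAt ℝ ∞ (fun y ↦ ϖ y a b) y :=
    ((hω.contDiffAt (hU.mem_nhds hy)).clm_apply contDiffAt_const).clm_apply contDiffAt_const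
  have hφ' (y) (hy : y ∈ U) (v : E) : fderiv ℝ (fun y ↦ ϖ y a b) y v =
      ϖ y (A y v a) b + ϖ y a (A y v b) := by
    have h1 : HasLineDerivAt ℝ (fun y ↦ ϖ y a b) (fderiv ℝ ϖ y v a b) y v :=
      HasLineDerivAt.clm_apply_const
        (HasLineDerivAt.clm_apply_const (hasLineDerivAt_fderiv (hd y hy) v) a) b
    have h2 : DifferentiableAt ℝ (fun y ↦ ϖ y a b) y :=
      ((hd y hy).clm_apply (differentiableAt_const a)).clm_apply (differentiableAt_const b)
    rw [← h y hy, ← h1.unique (h2.hasFDerivAt.hasLineDerivAt v)]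
  have hD : DifferentiableAt ℝ (fderiv ℝ (fun y ↦ ϖ y a b)) y :=
    (hφ.fderiv_right (m := ∞) (by simp)).differentiableAt (by simp)
  have hsymm : fderiv ℝ (fderiv ℝ (fun y ↦ ϖ y a b)) y u v =
      fderiv ℝ (fderiv ℝ (fun y ↦ ϖ y a b)) y v u :=
    (hφ.isSymmSndFDerivAt (by simpa using WithTop.coe_le_coe.2 (le_top : (2 : ℕ∞) ≤ ⊤))).eq u v
  have key (u v : E) : fderiv ℝ (fderiv ℝ (fun y ↦ ϖ y a b)) y u v =
      ϖ y (A y u (A y v a)) b + ϖ y (A y v a) (A y u b) + ϖ y (fderiv ℝ A y u v a) b +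
      (ϖ y (A y u a) (A y v b) + ϖ y a (A y u (A y v b)) + ϖ y a (fderiv ℝ A y u v b)) := by
    have h1 : HasLineDerivAt ℝ (fun y' ↦ fderiv ℝ (fun y ↦ ϖ y a b) y' v)
        (fderiv ℝ (fderiv ℝ (fun y ↦ ϖ y a b)) y u v) y u :=
      HasLineDerivAt.clm_apply_const (hasLineDerivAt_fderiv hD u) v
    have hAl (a : E) : HasLineDerivAt ℝ (fun y ↦ A y v a) (fderiv ℝ A y u v a) y u :=
      HasLineDerivAt.clm_apply_const (HasLineDerivAt.clm_apply_const
        (hasLineDerivAt_fderiv hA u) v) a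
    have hωl : HasLineDerivAt ℝ ϖ (fderiv ℝ ϖ y u) y u := hasLineDerivAt_fderiv (hd y hy) u
    have hl := HasDerivAt.clm_apply hωl (hAl a)
    have hr := HasDerivAt.clm_apply hωl (hasDerivAt_const (0 : ℝ) a)
    have h2 := HasDerivAt.clm_apply hl (hasDerivAt_const (0 : ℝ) b)
    have h3 := HasDerivAt.clm_apply hr (hAl b)
    have hc : ContinuousAt (fun s : ℝ ↦ y + s • u) 0 := by fun_prop
    have hnear : ∀ᶠ s : ℝ in 𝓝 0, y + s • u ∈ U :=
      hc.eventually (hU.mem_nhds (by simpa using hy))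
    have h4 := HasDerivAt.unique h1 ((h2.add h3).congr_of_eventuallyEq (by
      filter_upwards [hnear] with s hs using hφ' _ hs v))
    rw [h4]
    simp only [zero_smul, add_zero, add_apply, map_zero, h y hy]
  have h1 := key u v
  have h2 := key v u
  rw [hsymm, h2] at h1
  simp only [curvForm, add_apply, sub_apply, mul_apply_eq_comp, map_add, map_sub]
  linarith

end CurvForm

/-! ### Closedness of Ω forces flatness. -/

section Curvature

variable {n : ℕ} {M : Type*} [TopologicalSpace M]
  [ChartedSpace (EuclideanSpace ℝ (Fin (2 * n))) M] [IsManifold 𝓘(ℝ, Model n) ∞ M]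
  {σ : BilinField (Model n) M} {cov : LinearConnection n M}

lemma isFlat_of_curvForm_center [T2Space M] (hcov : IsSymplecticConnection σ cov)
    (h : ∀ x : M, ∀ u v, curvForm (connForm cov x) (extChartAt 𝓘(ℝ, Model n) x x) u v = 0) :
    IsFlat cov := by
  intro X Y Z hX hY hZ x
  have ht := mem_extChartAt_target (I := 𝓘(ℝ, Model n)) x
  have h1 := toCoord_curvature hcov.smooth hcov.torsionFree hX hY hZ ht
  rw [h, zero_apply] at h1
  have h2 : curvature cov X Y Z ((extChartAt 𝓘(ℝ, Model n) x).symm (extChartAt 𝓘(ℝ, Model n) x x)) = 0 := by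
    rw [← ofCoord_toCoord (symm_mem_source ht) (curvature cov X Y Z _), h1, map_zero]
  rwa [extChartAt_to_inv] at h2

lemma inChart_curvForm [T2Space M] (hσ : IsTwoForm σ) (hcov : IsSymplecticConnection σ cov) {x₀ : M}
    {y : Model n} (hy : y ∈ (extChartAt 𝓘(ℝ, Model n) x₀).target) (u v a b : Model n) :
    inChart σ x₀ y (curvForm (connForm cov x₀) y u v a) b +
      inChart σ x₀ y a (curvForm (connForm cov x₀) y u v b) = 0 := by
  have hU := isOpen_extChartAt_target (I := 𝓘(ℝ, Model n)) x₀
  exact curvForm_skew hU hy (contDiffOn_inChart hσ.smooth x₀)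
    (((contDiffOn_connForm hcov.smooth x₀).contDiffAt (hU.mem_nhds hy)).differentiableAt (by simp))
    (fun y hy v a b ↦ fderiv_inChart_eq hσ hcov hy v a b) u v a b

/-- The standard structure is pulled back by a symplectic frame. Surjectivity of π is what lets
information on the twistor space reach every point of M. -/
lemma exists_twistorSpace_proj_eq (hσ : IsSymplecticForm σ) (x : M) :
    ∃ z : TwistorSpace σ, z.proj = x := by
  obtain ⟨f⟩ := nonempty_sympFrame hσ x
  have hx := mem_chart_source (Model n) x
  have hu := f.isUnit_g _ f.mem_dom
  set g := f.g (extChartAt 𝓘(ℝ, Model n) x x) with hg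
  let p : TangentSpace 𝓘(ℝ, Model n) x →L[ℝ] TangentSpace 𝓘(ℝ, Model n) x :=
    (ofCoord x x).comp ((Ring.inverse g * stdJ n * g).comp (toCoord x x))
  have hp : endCoord x x p = Ring.inverse g * stdJ n * g := by
    ext1 u
    change toCoord x x (ofCoord x x ((Ring.inverse g * stdJ n * g) (toCoord x x (ofCoord x x u)))) = _
    rw [toCoord_ofCoord hx, toCoord_ofCoord hx]
  refine ⟨⟨⟨x, p⟩, (isCompatible_iff f hx f.mem_dom p).2 ?_⟩, rfl⟩
  rw [hp, ← hg, mul_assoc, mul_assoc, mul_assoc, Ring.mul_inverse_cancel _ hu, mul_one, ← mul_assoc,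
    Ring.mul_inverse_cancel _ hu, one_mul]
  exact isStdCompatible_self (isOrthComplex_stdJ n)

namespace AdaptedCharts

variable [ChartedSpace (TModel n) (TwistorSpace σ)] (h : AdaptedCharts σ)
  {z₀ z : TwistorSpace σ} [IsManifold 𝓘(ℝ, TModel n) ∞ (TwistorSpace σ)]

-- Insert lifts of u and v and a vertical vector into the formula for dΩ: two of the three traces
-- contain the curvature on a zero vector. As the chart contains the whole fibre over its centre,
-- every compatible c and every tangent Y at c occur, and `eq_zero_of_trE_mul_eq_zero` applies.
include h in
lemma curvForm_center_eq_zero [T2Space M] (hσ : IsSymplecticForm σ)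
    (hcov : IsSymplecticConnection σ cov) {t : ℝ}
    (hcl : IsClosedForm (TwistorSpace.Omega (σ := σ) cov t)) (z₀ : TwistorSpace σ) (u v : Model n) :
    curvForm (connForm cov z₀.proj) (extChartAt 𝓘(ℝ, Model n) z₀.proj z₀.proj) u v = 0 := by
  have hcl' := (h.isClosedForm_Omega_iff_forall hσ hcov t).1 hcl z₀
  set f := h.frame z₀ with hf
  set y := extChartAt 𝓘(ℝ, Model n) z₀.proj z₀.proj
  have hy : y ∈ f.dom := f.mem_dom
  have hu := f.isUnit_g y hy
  set g := f.g y with hg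
  set R := curvForm (connForm cov z₀.proj) y u v with hR
  have hgi (p) : g (Ring.inverse g p) = p :=
    congrArg (fun f : Model n →L[ℝ] Model n ↦ f p) (Ring.mul_inverse_cancel _ hu)
  have hgi' (p) : Ring.inverse g (g p) = p :=
    congrArg (fun f : Model n →L[ℝ] Model n ↦ f p) (Ring.inverse_mul_cancel _ hu)
  have hz : g * R * Ring.inverse g = 0 := by
    refine eq_zero_of_trE_mul_eq_zero (isOrthComplex_stdJ n) (fun p q ↦ ?_) fun c hc Y hY ↦ ?_
    · have h1 := inChart_curvForm hσ.isTwoForm hcov (f.dom_subset hy) u v (Ring.inverse g p) (Ring.inverse g q)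
      rw [f.inChart_eq y hy, f.inChart_eq y hy, ← hg, hgi, hgi] at h1
      exact h1
    · obtain ⟨h1, h2⟩ := cayley_mem_of_isStdCompatible (isOrthComplex_stdJ n) hc
      set w := sliceMap n (y, cayley (stdJ n) c) with hw
      have hb : baseMap n w = y := baseMap_sliceMap h1
      have hX : fibreMap n w = cayley (stdJ n) c := fibreMap_sliceMap h1
      have hwd : baseMap n w ∈ f.dom := by rw [hb]; exact hy
      have hwn : ‖fibreMap n w‖ < 1 := by rw [hX]; exact h2
      have hwt := (h.mem_target z₀ w).2 ⟨hwd, hwn⟩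
      have hcX : cayleyInv (stdJ n) (fibreMap n w) = c := by
        rw [hX, cayleyInv_cayley (isOrthComplex_stdJ n).sq
          (isUnit_one_sub_of_isStdCompatible (isOrthComplex_stdJ n) hc)]
      have hY' := hcX.symm ▸ hY
      -- Any lifts of u and v would do; the last vector is vertical with covariant derivative of Φ
      -- equal to Y in the frame.
      have h3 := hcl' w hwt (sliceMap n (u, 0)) (sliceMap n (v, 0)) (twistorVec cov f w 0 Y)
      rw [baseMap_twistorVec hσ.isTwoForm hcov hwd hwn 0 hY', baseMap_sliceMap (zero_mem _),
        baseMap_sliceMap (zero_mem _), hb] at h3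
      have h4 := vertCoord_twistorVec hσ.isTwoForm hcov hwd hwn 0 hY'
      rw [vertCoord, hb, ← hg] at h4
      rw [curvForm_zero_left, curvForm_zero_right, zero_mul, zero_mul, map_zero, add_zero, add_zero, ← hR] at h3
      rw [← h4, ← h3, trE_mul_comm R]
      set N := covEnd (connForm cov z₀.proj) (baseMap n) (jCoord f) w (twistorVec cov f w 0 Y)
      calc trE (Model n) (g * R * Ring.inverse g * (g * N * Ring.inverse g))
          = trE (Model n) (g * R * ((Ring.inverse g * g) * N * Ring.inverse g)) := by
            simp only [mul_assoc]
        _ = trE (Model n) (N * Ring.inverse g * (g * R)) := by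
            rw [Ring.inverse_mul_cancel _ hu, one_mul, trE_mul_comm]
        _ = trE (Model n) (N * ((Ring.inverse g * g) * R)) := by simp only [mul_assoc]
        _ = trE (Model n) (N * R) := by rw [Ring.inverse_mul_cancel _ hu, one_mul]
  ext1 p
  have h1 := congrArg (fun f : Model n →L[ℝ] Model n ↦ Ring.inverse g (f (g p))) hz
  simpa [hgi'] using h1

include h in
lemma isClosedForm_Omega_iff [T2Space M] (hσ : IsSymplecticForm σ)
    (hcov : IsSymplecticConnection σ cov) (t : ℝ) :
    IsClosedForm (TwistorSpace.Omega (σ := σ) cov t) ↔ IsFlat cov := by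
  refine ⟨fun hcl ↦ isFlat_of_curvForm_center hcov fun x ↦ ?_,
    h.isClosedForm_Omega_of_isFlat hσ hcov t⟩
  obtain ⟨z, rfl⟩ := exists_twistorSpace_proj_eq hσ x
  exact h.curvForm_center_eq_zero hσ hcov hcl z

end AdaptedCharts

end Curvature

/-! ### Parallel frames preserve the symplectic form. -/

section FlatFrame

variable {E : Type*} [NormedAddCommGroup E] [InnerProductSpace ℝ E] [FiniteDimensional ℝ E]
  {ϖ : E → E →L[ℝ] E →L[ℝ] ℝ} {A : E → E →L[ℝ] E →L[ℝ] E} {U : Set E} {F : E → E →L[ℝ] E}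

lemma hasLineDerivAt_ringInverse {y v : E} {F' : E →L[ℝ] E} (hF : ContDiffAt ℝ ∞ F y)
    (hu : IsUnit (F y)) (h : fderiv ℝ F y v = F') :
    HasLineDerivAt ℝ (fun y ↦ Ring.inverse (F y))
      (-(Ring.inverse (F y) * F' * Ring.inverse (F y))) y v := by
  have h1 := (contDiffAt_ringInverse_comp hF hu).differentiableAt (by simp)
  have h2 : HasLineDerivAt ℝ (fun y ↦ Ring.inverse (F y)) _ y v := h1.hasFDerivAt.hasLineDerivAt v
  have h3 : HasLineDerivAt ℝ F F' y v := h ▸ (hF.differentiableAt (by simp)).hasFDerivAt.hasLineDerivAt v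
  have h4 := HasDerivAt.mul h3 h2
  have hc : ContinuousAt (fun s : ℝ ↦ y + s • v) 0 := by fun_prop
  have hnear : ∀ᶠ y' in 𝓝 y, IsUnit (F y') := hF.continuousAt.eventually (Units.isOpen.mem_nhds hu)
  have h5 := h4.unique ((hasDerivAt_const (0 : ℝ) (1 : E →L[ℝ] E)).congr_of_eventuallyEq (by
    filter_upwards [hc.eventually (p := fun y' ↦ IsUnit (F y')) (by simpa using hnear)] with s hs
    exact Ring.mul_inverse_cancel _ hs))
  simp only [zero_smul, add_zero] at h5
  generalize fderiv ℝ (fun y ↦ Ring.inverse (F y)) y v = D at *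
  have h6 : F y * D = -(F' * Ring.inverse (F y)) := eq_neg_of_add_eq_zero_right h5
  have h7 : D = -(Ring.inverse (F y) * F' * Ring.inverse (F y)) := by
    calc D = Ring.inverse (F y) * (F y * D) := by
          rw [← mul_assoc, Ring.inverse_mul_cancel _ hu, one_mul]
      _ = _ := by rw [h6, mul_assoc]; ext1 u; simp
  rwa [h7] at h2

-- For fixed vectors P, Q the fields F⁻¹P and F⁻¹Q are parallel, so ϖ(F⁻¹P, F⁻¹Q) is constant on the
-- ball; compare its values at y and at the centre, where F = 1.
set_option synthInstance.maxHeartbeats 200000 in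
set_option maxHeartbeats 1000000 in
lemma parallel_frame_eq {y₀ : E} {r : ℝ} (hr : 0 < r)
    (hϖ : ∀ y ∈ Metric.ball y₀ r, DifferentiableAt ℝ ϖ y)
    (hF : ContDiffOn ℝ ∞ F (Metric.ball y₀ r)) (hu : ∀ y ∈ Metric.ball y₀ r, IsUnit (F y))
    (hFA : ∀ y ∈ Metric.ball y₀ r, ∀ v, fderiv ℝ F y v = F y * A y v)
    (h : ∀ y ∈ Metric.ball y₀ r, ∀ v a b,
      fderiv ℝ ϖ y v a b = ϖ y (A y v a) b + ϖ y a (A y v b)) (h0 : F y₀ = 1) {y : E}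
    (hy : y ∈ Metric.ball y₀ r) (p q : E) : ϖ y p q = ϖ y₀ (F y p) (F y q) := by
  have hgi {y} (hy : y ∈ Metric.ball y₀ r) (p) : Ring.inverse (F y) (F y p) = p :=
    congrArg (fun f : E →L[ℝ] E ↦ f p) (Ring.inverse_mul_cancel _ (hu y hy))
  set P := F y p
  set Q := F y q
  have hFy {y} (hy : y ∈ Metric.ball y₀ r) := hF.contDiffAt (Metric.isOpen_ball.mem_nhds hy)
  have hd {y} (hy : y ∈ Metric.ball y₀ r) : DifferentiableAt ℝ (fun y ↦ Ring.inverse (F y)) y :=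
    (contDiffAt_ringInverse_comp (hFy hy) (hu y hy)).differentiableAt (by simp)
  have hφd {y} (hy : y ∈ Metric.ball y₀ r) :
      DifferentiableAt ℝ (fun y ↦ ϖ y (Ring.inverse (F y) P) (Ring.inverse (F y) Q)) y :=
    ((hϖ y hy).clm_apply ((hd hy).clm_apply (differentiableAt_const P))).clm_apply
      ((hd hy).clm_apply (differentiableAt_const Q))
  have key : ∀ y ∈ Metric.ball y₀ r,
      fderiv ℝ (fun y ↦ ϖ y (Ring.inverse (F y) P) (Ring.inverse (F y) Q)) y = 0 := by
    intro y hy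
    ext1 v
    have h1 : HasLineDerivAt ℝ (fun y ↦ ϖ y (Ring.inverse (F y) P) (Ring.inverse (F y) Q)) _ y v :=
      (hφd hy).hasFDerivAt.hasLineDerivAt v
    have h2 (P : E) : HasLineDerivAt ℝ (fun y ↦ Ring.inverse (F y) P)
        (-(A y v (Ring.inverse (F y) P))) y v := by
      have h3 := HasLineDerivAt.clm_apply_const
        (hasLineDerivAt_ringInverse (hFy hy) (hu y hy) (hFA y hy v)) P
      simpa only [neg_apply, mul_apply_eq_comp, hgi hy] using h3
    have h4 : HasLineDerivAt ℝ ϖ (fderiv ℝ ϖ y v) y v := (hϖ y hy).hasFDerivAt.hasLineDerivAt v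
    have h5 := h1.unique (HasDerivAt.clm_apply (HasDerivAt.clm_apply h4 (h2 P)) (h2 Q))
    rw [h5]
    simp only [zero_smul, add_zero, add_apply, map_neg, neg_apply, h y hy, zero_apply]
    ring
  have h1 := Metric.isOpen_ball.is_const_of_fderiv_eq_zero (𝕜 := ℝ)
    (convex_ball y₀ r).isPreconnected (fun y hy ↦ (hφd hy).differentiableWithinAt) key hy
    (Metric.mem_ball_self hr)
  have h2 := hgi hy p
  have h3 := hgi hy q
  change Ring.inverse (F y) P = p at h2
  change Ring.inverse (F y) Q = q at h3
  simp only [h2, h3, h0, Ring.inverse_one, one_apply_eq_self] at h1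
  exact h1

end FlatFrame

/-! ### Affine symplectic coordinates. -/

section FlatCoordinates

variable {n : ℕ} {M : Type*} [TopologicalSpace M]
  [ChartedSpace (EuclideanSpace ℝ (Fin (2 * n))) M] [IsManifold 𝓘(ℝ, Model n) ∞ M]
  {σ : BilinField (Model n) M} {cov : LinearConnection n M}

/-- A symplectic frame is the differential of affine coordinates and is parallel. -/
structure SympFrame.IsAffine {x₀ : M} (f : SympFrame σ x₀) (cov : LinearConnection n M)
    (ψ : Model n → Model n) : Prop where
  contDiffOn : ContDiffOn ℝ ∞ ψ f.dom
  hasFDerivAt : ∀ y ∈ f.dom, HasFDerivAt ψ (f.g y) y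
  fderiv_g : ∀ y ∈ f.dom, ∀ v, fderiv ℝ f.g y v = f.g y * connForm cov x₀ y v

-- The parallel frame dψ is composed with the value `g₀` of some symplectic frame at the centre. It
-- is then symplectic there, hence nearby by parallelism, and g₀ ∘ ψ is still affine.
set_option maxHeartbeats 1000000 in
lemma exists_affine_frame [T2Space M] (hσ : IsSymplecticForm σ)
    (hcov : IsSymplecticConnection σ cov) (hflat : IsFlat cov) (x₀ : M) :
    ∃ (f : SympFrame σ x₀) (ψ : Model n → Model n), f.IsAffine cov ψ := by
  obtain ⟨f⟩ := nonempty_sympFrame hσ x₀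
  set y₀ := extChartAt 𝓘(ℝ, Model n) x₀ x₀ with hy₀
  obtain ⟨r, hr, F, ψ, hrU, hF0, hF, hψ, hFA, hψF⟩ := exists_affine_coordinates
    (isOpen_extChartAt_target (I := 𝓘(ℝ, Model n)) x₀) (contDiffOn_connForm hcov.smooth x₀)
    (mem_extChartAt_target x₀) (fun y hy u v ↦ connForm_symm hcov.torsionFree hy u v)
    (fun y hy u v ↦ (isFlat_iff hcov.smooth hcov.torsionFree).1 hflat x₀ y hy u v)
  have hb : y₀ ∈ Metric.ball y₀ r := Metric.mem_ball_self hr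
  have hFc : ContinuousAt F y₀ := (hF.contDiffAt (Metric.isOpen_ball.mem_nhds hb)).continuousAt
  have hnear : ∀ᶠ y in 𝓝 y₀, IsUnit (F y) :=
    hFc.eventually (Units.isOpen.mem_nhds (by rw [hF0]; exact isUnit_one))
  obtain ⟨s, hs, hsU⟩ := Metric.eventually_nhds_iff_ball.1 hnear
  set ρ := min r s
  have hρ : 0 < ρ := lt_min hr hs
  have hρr : Metric.ball y₀ ρ ⊆ Metric.ball y₀ r := Metric.ball_subset_ball (min_le_left _ _)
  have hρs : Metric.ball y₀ ρ ⊆ Metric.ball y₀ s := Metric.ball_subset_ball (min_le_right _ _)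
  set g₀ := f.g y₀
  have hg₀ : IsUnit g₀ := f.isUnit_g _ f.mem_dom
  have hd {y} (hy : y ∈ Metric.ball y₀ ρ) : DifferentiableAt ℝ F y :=
    (hF.contDiffAt (Metric.isOpen_ball.mem_nhds (hρr hy))).differentiableAt (by simp)
  refine ⟨⟨Metric.ball y₀ ρ, fun y ↦ g₀ * F y, Metric.isOpen_ball, Metric.mem_ball_self hρ,
    hρr.trans hrU, contDiffOn_const.clm_comp (hF.mono hρr), fun y hy ↦ hg₀.mul (hsU y (hρs hy)),
    fun y hy u v ↦ ?_⟩, fun y ↦ g₀ (ψ y), ?_, ?_, ?_⟩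
  · have hω {y} (hy : y ∈ Metric.ball y₀ ρ) : DifferentiableAt ℝ (inChart σ x₀) y :=
      ((contDiffOn_inChart hσ.isTwoForm.smooth x₀).contDiffAt ((isOpen_extChartAt_target
        (I := 𝓘(ℝ, Model n)) x₀).mem_nhds (hrU (hρr hy)))).differentiableAt (by simp)
    rw [parallel_frame_eq hρ (fun y hy ↦ hω hy) (hF.mono hρr) (fun y hy ↦ hsU y (hρs hy))
      (fun y hy v ↦ hFA y (hρr hy) v)
      (fun y hy v a b ↦ fderiv_inChart_eq hσ.isTwoForm hcov (hrU (hρr hy)) v a b) hF0 hy,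
      f.inChart_eq y₀ f.mem_dom]
    rfl
  · exact g₀.contDiff.comp_contDiffOn (hψ.mono hρr)
  · intro y hy
    exact g₀.hasFDerivAt.comp y (hψF y (hρr hy))
  · intro y hy v
    have h1 : HasLineDerivAt ℝ (fun y ↦ g₀ * F y) (g₀ * fderiv ℝ F y v) y v := by
      have := HasDerivAt.mul (hasDerivAt_const (0 : ℝ) g₀) ((hd hy).hasFDerivAt.hasLineDerivAt v)
      simp only [zero_mul, zero_add] at this
      exact this
    have h2 : DifferentiableAt ℝ (fun y ↦ g₀ * F y) y := (differentiableAt_const g₀).mul (hd hy)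
    have h3 : fderiv ℝ (fun y ↦ g₀ * F y) y v = g₀ * fderiv ℝ F y v :=
      HasDerivAt.unique (h2.hasFDerivAt.hasLineDerivAt v) h1
    change fderiv ℝ (fun y ↦ g₀ * F y) y v = g₀ * F y * _
    rw [h3, hFA y (hρr hy), mul_assoc]

end FlatCoordinates

/-- K turns V into a complex vector space in which i acts as K; a complex basis supplies the
coordinates. -/
lemma exists_complex_coordinates {V : Type*} [NormedAddCommGroup V] [NormedSpace ℝ V]
    [FiniteDimensional ℝ V] {K : V →L[ℝ] V} (hK : ∀ v, K (K v) = -v) :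
    ∃ (m : ℕ) (κ : V ≃L[ℝ] EuclideanSpace ℂ (Fin m)), ∀ v, κ (K v) = Complex.I • κ v := by
  have hKK : K.toLinearMap * K.toLinearMap = (-1 : Module.End ℝ V) := by
    ext1 v
    exact hK v
  let φ : ℂ →ₐ[ℝ] Module.End ℝ V := Complex.lift ⟨K.toLinearMap, hKK⟩
  have hφ (r : ℝ) (v : V) : φ (r : ℂ) v = r • v := by
    have : φ (r : ℂ) = algebraMap ℝ _ r := φ.commutes r
    rw [this]
    rfl
  have hφI (v : V) : φ Complex.I v = K v := by
    have : φ Complex.I = K.toLinearMap := Complex.liftAux_apply_I _ hKK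
    rw [this]
    rfl
  letI : Module ℂ V := Module.compHom V φ.toRingHom
  have hsmul (c : ℂ) (v : V) : c • v = φ c v := rfl
  haveI : IsScalarTower ℝ ℂ V := ⟨fun r c v ↦ by
    rw [hsmul, hsmul, map_smul]
    rfl⟩
  haveI : Module.Finite ℂ V := Module.Finite.of_restrictScalars_finite ℝ ℂ V
  let b := Module.finBasis ℂ V
  let κ := b.equivFun.trans (WithLp.linearEquiv 2 ℂ (Fin (Module.finrank ℂ V) → ℂ)).symm
  refine ⟨Module.finrank ℂ V, (κ.restrictScalars ℝ).toContinuousLinearEquiv, fun v ↦ ?_⟩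
  rw [← hφI, ← hsmul]
  exact κ.map_smul Complex.I v

/-! ### A criterion for integrability. -/

section Integrability

variable {F : Type*} [NormedAddCommGroup F] [NormedSpace ℝ F] [FiniteDimensional ℝ F]
  {N : Type*} [TopologicalSpace N] [ChartedSpace F N] [IsManifold 𝓘(ℝ, F) ∞ N]

/-- A map of the model space to itself with injective differential is a local diffeomorphism. If it
carries J to a constant complex structure K, then composing it with a complex linear isomorphism
from the model with K to ℂᵐ yields holomorphic charts. -/
lemma isIntegrable_of_exists_map {J : EndField F N}
    (h : ∀ z₀ : N, ∃ (O : Set F) (φ : F → F) (K : F →L[ℝ] F), IsOpen O ∧ chartAt F z₀ z₀ ∈ O ∧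
      ContDiffOn ℝ ∞ φ O ∧ (∀ t ∈ O, ∀ u, fderiv ℝ φ t u = 0 → u = 0) ∧ (∀ v, K (K v) = -v) ∧
      ∀ z ∈ (chartAt F z₀).source, chartAt F z₀ z ∈ O → ∀ X : TangentSpace 𝓘(ℝ, F) z,
        fderiv ℝ φ (chartAt F z₀ z) (toCoord z₀ z (J z X)) =
          K (fderiv ℝ φ (chartAt F z₀ z) (toCoord z₀ z X))) : IsIntegrable J := by
  intro z₀
  obtain ⟨O, φ, K, hO, hz₀, hφ, hinj, hK, hJ⟩ := h z₀
  obtain ⟨m, κ, hκ⟩ := exists_complex_coordinates hK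
  have hφd {t : F} (ht : t ∈ O) : ContDiffAt ℝ ∞ φ t := hφ.contDiffAt (hO.mem_nhds ht)
  let D (t : F) (ht : t ∈ O) : F ≃L[ℝ] F := (LinearEquiv.ofInjectiveEndo (fderiv ℝ φ t).toLinearMap
    (by rw [← LinearMap.ker_eq_bot, LinearMap.ker_eq_bot']; exact hinj t ht)).toContinuousLinearEquiv
  have hD (t : F) (ht : t ∈ O) : HasFDerivAt φ (D t ht : F →L[ℝ] F) t := by
    have : (D t ht : F →L[ℝ] F) = fderiv ℝ φ t := by ext1 u; rfl
    rw [this]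
    exact ((hφd ht).differentiableAt (by simp)).hasFDerivAt
  let ℓ := ((hφd hz₀).toOpenPartialHomeomorph φ (hD _ hz₀) (by simp)).restrOpen O hO
  have hℓ (t : F) : ℓ t = φ t := rfl
  have hℓs {t : F} (ht : t ∈ ℓ.source) : t ∈ O := ht.2
  let e₂ := ℓ ≫ₕ κ.toHomeomorph.toOpenPartialHomeomorph
  let e := chartAt F z₀ ≫ₕ e₂
  have he (z : N) : e z = κ (φ (chartAt F z₀ z)) := rfl
  have hes {z : N} (hz : z ∈ e.source) : z ∈ (chartAt F z₀).source ∧ chartAt F z₀ z ∈ ℓ.source :=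
    ⟨hz.1, hz.2.1⟩
  refine ⟨m, e, ?_, ?_, ?_, ?_⟩
  · refine ⟨mem_chart_source F z₀, ⟨?_, hz₀⟩, trivial⟩
    exact (hφd hz₀).mem_toOpenPartialHomeomorph_source (hD _ hz₀) (by simp)
  · intro z hz
    have h1 : ContMDiffAt 𝓘(ℝ, F) 𝓘(ℝ, F) ∞ (chartAt F z₀) z :=
      contMDiffAt_of_mem_maximalAtlas (IsManifold.chart_mem_maximalAtlas z₀) (hes hz).1
    have h2 : ContDiffAt ℝ ∞ (fun t ↦ κ (φ t)) (chartAt F z₀ z) :=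
      κ.contDiff.contDiffAt.comp _ (hφd (hℓs (hes hz).2))
    exact (h2.contMDiffAt.comp z h1).contMDiffWithinAt
  · intro w hw
    have hw1 : κ.symm w ∈ ℓ.target := hw.1.2
    have hw2 : ℓ.symm (κ.symm w) ∈ (chartAt F z₀).target := hw.2
    have h1 : ContMDiffAt 𝓘(ℝ, F) 𝓘(ℝ, F) ∞ (chartAt F z₀).symm (ℓ.symm (κ.symm w)) :=
      contMDiffAt_symm_of_mem_maximalAtlas (IsManifold.chart_mem_maximalAtlas z₀) hw2
    have hw3 : ℓ.symm (κ.symm w) ∈ O := hℓs (ℓ.map_target hw1)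
    have h2 : ContDiffAt ℝ ∞ ℓ.symm (κ.symm w) :=
      ℓ.contDiffAt_symm hw1 (hD _ hw3) (hφd hw3)
    have h3 : ContDiffAt ℝ ∞ (fun w ↦ ℓ.symm (κ.symm w)) w :=
      h2.comp w κ.symm.contDiff.contDiffAt
    exact (h1.comp w h3.contMDiffAt).contMDiffWithinAt
  · intro z hz X
    have hzO := hℓs (hes hz).2
    have h1 : HasFDerivAt (fun t ↦ κ (φ t))
        ((κ : F →L[ℝ] EuclideanSpace ℂ (Fin m)).comp (fderiv ℝ φ (chartAt F z₀ z))) (chartAt F z₀ z) :=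
      κ.hasFDerivAt.comp _ ((hφd hzO).differentiableAt (by simp)).hasFDerivAt
    have h2 (X : TangentSpace 𝓘(ℝ, F) z) :=
      (mfderiv_eq_fderiv_chart (hes hz).1 (f := e) (g := fun t ↦ κ (φ t))
        (Filter.Eventually.of_forall fun z ↦ rfl) h1.differentiableAt X).2
    have h3 (X : TangentSpace 𝓘(ℝ, F) z) : (mfderiv 𝓘(ℝ, F) 𝓘(ℝ, EuclideanSpace ℂ (Fin m)) e z X :
        EuclideanSpace ℂ (Fin m)) = κ (fderiv ℝ φ (chartAt F z₀ z) (toCoord z₀ z X)) := by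
      rw [h2]
      exact congrArg (fun f : F →L[ℝ] EuclideanSpace ℂ (Fin m) ↦ f (toCoord z₀ z X)) h1.fderiv
    refine (h3 _).trans ?_
    rw [hJ z (hes hz).1 hzO X, hκ]
    exact congrArg (Complex.I • ·) (h3 X).symm

end Integrability

/-- 1 - X intertwines the inverse transform of X with j, because (1 - X)j = j(1 + X). This is what
makes the factor 1 - W in `holMap` the right one. -/
lemma one_sub_mul_cayleyInv {V : Type*} [NormedAddCommGroup V] [InnerProductSpace ℝ V]
    [FiniteDimensional ℝ V] {j X : V →L[ℝ] V} (hX : IsUnit (1 + X)) (ha : X * j = -(j * X)) :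
    (1 - X) * cayleyInv j X = j * (1 - X) := by
  refine hX.mul_right_cancel ?_
  rw [mul_assoc, cayleyInv_mul hX, mul_assoc j, ← mul_assoc,
    show (1 - X) * j = j * (1 + X) by rw [sub_mul, mul_add, ha]; simp, mul_assoc]
  congr 1
  noncomm_ring

lemma fderiv_mem_of_eventually_mem {V W : Type*} [NormedAddCommGroup V] [NormedSpace ℝ V]
    [NormedAddCommGroup W] [NormedSpace ℝ W] [FiniteDimensional ℝ W] (S : Submodule ℝ W)
    {f : V → W} {t : V} (hf : DifferentiableAt ℝ f t) (h : ∀ᶠ t' in 𝓝 t, f t' ∈ S) (u : V) :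
    fderiv ℝ f t u ∈ S := by
  by_contra hu
  obtain ⟨φ, hφ, hS⟩ := S.exists_le_ker_of_notMem hu
  let φ' : W →L[ℝ] ℝ := LinearMap.toContinuousLinearMap φ
  have h1 : HasFDerivAt (fun t ↦ φ' (f t)) (φ'.comp (fderiv ℝ f t)) t :=
    φ'.hasFDerivAt.comp t hf.hasFDerivAt
  have h2 : HasFDerivAt (fun t ↦ φ' (f t)) (0 : V →L[ℝ] ℝ) t := by
    refine (hasFDerivAt_const (0 : ℝ) t).congr_of_eventuallyEq ?_
    filter_upwards [h] with t ht using hS ht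
  exact hφ (congrArg (fun f : V →L[ℝ] ℝ ↦ f u) (h1.unique h2))

/-! ### Holomorphic coordinates when the connection is flat. -/

section FlatTwistor

variable {n : ℕ} {M : Type*} [TopologicalSpace M]
  [ChartedSpace (EuclideanSpace ℝ (Fin (2 * n))) M] [IsManifold 𝓘(ℝ, Model n) ∞ M]
  {σ : BilinField (Model n) M} {cov : LinearConnection n M} {x₀ : M}

/-- The complex structure on the model space. -/
def modelJ (n : ℕ) : TModel n →L[ℝ] TModel n :=
  (sliceMap n).comp (((stdJ n).comp (baseMap n)).prod
    ((ContinuousLinearMap.compL ℝ _ _ _ (stdJ n)).comp (fibreMap n)))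

lemma modelJ_apply (t : TModel n) :
    modelJ n t = sliceMap n (stdJ n (baseMap n t), stdJ n * fibreMap n t) := rfl

lemma stdJ_mul_mem {X : Model n →L[ℝ] Model n} (hX : X ∈ symAnti (stdJ n)) :
    stdJ n * X ∈ symAnti (stdJ n) := by
  refine ⟨by rw [mul_assoc, hX.1, mul_neg], fun u v ↦ ?_⟩
  have h1 (v) : X (stdJ n v) = -stdJ n (X v) :=
    congrArg (fun f : Model n →L[ℝ] Model n ↦ f v) hX.1
  rw [mul_apply_eq_comp, mul_apply_eq_comp, (isOrthComplex_stdJ n).skew, hX.2, h1, inner_neg_right,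
    neg_neg]

lemma modelJ_modelJ (t : TModel n) : modelJ n (modelJ n t) = -t := by
  have h := stdJ_mul_mem (fibreMap_mem t)
  rw [modelJ_apply (modelJ n t), modelJ_apply t, baseMap_sliceMap h, fibreMap_sliceMap h,
    ← mul_assoc, (isOrthComplex_stdJ n).sq, (isOrthComplex_stdJ n).apply_apply]
  have h1 : (-1 : Model n →L[ℝ] Model n) * fibreMap n t = -fibreMap n t := by
    ext1 u
    simp only [mul_apply_eq_comp, neg_apply, one_apply_eq_self]
  rw [h1]
  conv_rhs => rw [← sliceMap_ambientEquiv t]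
  exact map_neg (sliceMap n) (baseMap n t, fibreMap n t)

/-- The canonical section in a frame `g`. -/
def frameJ (f : SympFrame σ x₀) (j : TModel n → Model n →L[ℝ] Model n) (t : TModel n) :
    Model n →L[ℝ] Model n :=
  f.g (baseMap n t) * j t * Ring.inverse (f.g (baseMap n t))

/-- The Cayley transform of the canonical section in a frame `g`. -/
def frameW (f : SympFrame σ x₀) (j : TModel n → Model n →L[ℝ] Model n) (t : TModel n) :
    Model n →L[ℝ] Model n :=
  cayley (stdJ n) (frameJ f j t)

/-- Holomorphic coordinates on the twistor space of a flat connection. -/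
def holMap (f : SympFrame σ x₀) (ψ : Model n → Model n) (j : TModel n → Model n →L[ℝ] Model n)
    (t : TModel n) : TModel n :=
  sliceMap n ((1 - frameW f j t) (ψ (baseMap n t)), frameW f j t)

variable {f : SympFrame σ x₀} {ψ : Model n → Model n} {j : TModel n → Model n →L[ℝ] Model n}
  {O : Set (TModel n)} {t : TModel n}

lemma contDiffAt_frameJ (hj : ContDiffAt ℝ ∞ j t) (ht : baseMap n t ∈ f.dom) :
    ContDiffAt ℝ ∞ (frameJ f j) t := by
  have hg : ContDiffAt ℝ ∞ (fun t ↦ f.g (baseMap n t)) t :=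
    (f.contDiffOn_g.contDiffAt (f.isOpen_dom.mem_nhds ht)).comp t (baseMap n).contDiff.contDiffAt
  exact (hg.clm_comp hj).clm_comp (contDiffAt_ringInverse_comp hg (f.isUnit_g _ ht))

lemma contDiffAt_frameW (hj : ContDiffAt ℝ ∞ j t) (ht : baseMap n t ∈ f.dom)
    (hc : IsStdCompatible (stdJ n) (frameJ f j t)) : ContDiffAt ℝ ∞ (frameW f j) t := by
  have h1 : ContDiffAt ℝ ∞ (fun t ↦ stdJ n * frameJ f j t) t :=
    contDiffAt_const.clm_comp (contDiffAt_frameJ hj ht)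
  exact (contDiffAt_const.add h1).clm_comp (contDiffAt_ringInverse_comp (contDiffAt_const.sub h1)
    (isUnit_one_sub_of_isStdCompatible (isOrthComplex_stdJ n) hc))

lemma contDiffAt_holMap (hψ : f.IsAffine cov ψ) (hj : ContDiffAt ℝ ∞ j t) (ht : baseMap n t ∈ f.dom)
    (hc : IsStdCompatible (stdJ n) (frameJ f j t)) : ContDiffAt ℝ ∞ (holMap f ψ j) t := by
  have h1 := contDiffAt_frameW hj ht hc
  have h2 : ContDiffAt ℝ ∞ (fun t ↦ ψ (baseMap n t)) t :=
    (hψ.contDiffOn.contDiffAt (f.isOpen_dom.mem_nhds ht)).comp t (baseMap n).contDiff.contDiffAt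
  exact (sliceMap n).contDiff.contDiffAt.comp t
    (((contDiffAt_const.sub h1).clm_apply h2).prodMk h1)

/-- In a parallel frame the connection form vanishes, so the ordinary derivative of Φ is its
covariant derivative. -/
lemma fderiv_frameJ (hψ : f.IsAffine cov ψ) (hj : ContDiffAt ℝ ∞ j t) (ht : baseMap n t ∈ f.dom)
    (u : TModel n) : fderiv ℝ (frameJ f j) t u =
      f.g (baseMap n t) * covEnd (connForm cov x₀) (baseMap n) j t u *
        Ring.inverse (f.g (baseMap n t)) := by
  have hu := f.isUnit_g _ ht
  have hg := f.contDiffOn_g.contDiffAt (f.isOpen_dom.mem_nhds ht)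
  have hgi := contDiffAt_ringInverse_comp hg hu
  have h1 := (fderiv_conj (b := baseMap n) (C := fun y ↦ Ring.inverse (f.g y)) (Ci := f.g)
    (hgi.differentiableAt (by simp)) (hg.differentiableAt (by simp)) (hj.differentiableAt (by simp))
    (by filter_upwards [f.isOpen_dom.mem_nhds ht] with y hy using
      Ring.inverse_mul_cancel _ (f.isUnit_g y hy)) (Ring.mul_inverse_cancel _ hu)).2 u
  have h2 : HasLineDerivAt ℝ (fun y ↦ Ring.inverse (f.g y)) _ (baseMap n t) (baseMap n u) :=
    (hgi.differentiableAt (by simp)).hasFDerivAt.hasLineDerivAt _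
  have h3 := h2.unique (hasLineDerivAt_ringInverse hg hu (hψ.fderiv_g _ ht (baseMap n u)))
  have h4 : fderiv ℝ (fun y ↦ Ring.inverse (f.g y)) (baseMap n t) (baseMap n u) *
      f.g (baseMap n t) = -connForm cov x₀ (baseMap n t) (baseMap n u) := by
    rw [h3]
    ext1 p
    have h5 (p) : Ring.inverse (f.g (baseMap n t)) (f.g (baseMap n t) p) = p :=
      congrArg (fun f : Model n →L[ℝ] Model n ↦ f p) (Ring.inverse_mul_cancel _ hu)
    simp only [mul_apply_eq_comp, neg_apply, h5]
  rw [h4] at h1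
  have h6 : (fun w ↦ f.g (baseMap n w) * j w * Ring.inverse (f.g (baseMap n w))) = frameJ f j := rfl
  rw [h6] at h1
  have h7 : covEnd (connForm cov x₀) (baseMap n) j t u = Ring.inverse (f.g (baseMap n t)) *
      fderiv ℝ (frameJ f j) t u * f.g (baseMap n t) := by
    rw [h1, covEnd]
    ext1 p
    simp only [add_apply, sub_apply, mul_apply_eq_comp, neg_apply, map_neg]
    abel
  rw [h7]
  calc fderiv ℝ (frameJ f j) t u = 1 * fderiv ℝ (frameJ f j) t u * 1 := by rw [one_mul, mul_one]
    _ = _ := by rw [← Ring.mul_inverse_cancel _ hu]; simp only [mul_assoc]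

lemma fderiv_frameW (hψ : f.IsAffine cov ψ) (hO : IsOpen O) (hj : ContDiffOn ℝ ∞ j O)
    (hOd : ∀ t ∈ O, baseMap n t ∈ f.dom) (hc : ∀ t ∈ O, IsStdCompatible (stdJ n) (frameJ f j t))
    (ht : t ∈ O) (u : TModel n) :
    fderiv ℝ (frameW f j) t u = cayleyDeriv (stdJ n) (frameW f j t)
      (f.g (baseMap n t) * covEnd (connForm cov x₀) (baseMap n) j t u *
        Ring.inverse (f.g (baseMap n t))) := by
  have hjt := hj.contDiffAt (hO.mem_nhds ht)
  have hW := contDiffAt_frameW hjt (hOd t ht) (hc t ht)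
  have hn := (cayley_mem_of_isStdCompatible (isOrthComplex_stdJ n) (hc t ht)).2
  rw [← fderiv_frameJ hψ hjt (hOd t ht), ← cayleyDeriv_fderiv_cayleyInv_comp
    (isOrthComplex_stdJ n).sq hW (isUnit_one_add_of_norm_lt_one hn)]
  have h1 : (fun t ↦ cayleyInv (stdJ n) (frameW f j t)) =ᶠ[𝓝 t] frameJ f j := by
    filter_upwards [hO.mem_nhds ht] with t ht
    exact cayleyInv_cayley (isOrthComplex_stdJ n).sq
      (isUnit_one_sub_of_isStdCompatible (isOrthComplex_stdJ n) (hc t ht))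
  rw [h1.fderiv_eq]

lemma fderiv_frameW_mem (hO : IsOpen O) (hj : ContDiffOn ℝ ∞ j O)
    (hOd : ∀ t ∈ O, baseMap n t ∈ f.dom) (hc : ∀ t ∈ O, IsStdCompatible (stdJ n) (frameJ f j t))
    (ht : t ∈ O) (u : TModel n) : fderiv ℝ (frameW f j) t u ∈ symAnti (stdJ n) := by
  have hW := (contDiffAt_frameW (hj.contDiffAt (hO.mem_nhds ht)) (hOd t ht)
    (hc t ht)).differentiableAt (by simp)
  refine fderiv_mem_of_eventually_mem (symAnti (stdJ n)) hW ?_ u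
  filter_upwards [hO.mem_nhds ht] with t ht
  exact (cayley_mem_of_isStdCompatible (isOrthComplex_stdJ n) (hc t ht)).1

lemma fderiv_holMap (hψ : f.IsAffine cov ψ) (hj : ContDiffAt ℝ ∞ j t) (ht : baseMap n t ∈ f.dom)
    (hc : IsStdCompatible (stdJ n) (frameJ f j t)) (u : TModel n) :
    fderiv ℝ (holMap f ψ j) t u = sliceMap n ((1 - frameW f j t) (f.g (baseMap n t) (baseMap n u)) -
      fderiv ℝ (frameW f j) t u (ψ (baseMap n t)), fderiv ℝ (frameW f j) t u) := by
  have hW := (contDiffAt_frameW hj ht hc).differentiableAt (by simp)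
  have hH := (contDiffAt_holMap hψ hj ht hc).differentiableAt (by simp)
  have h1 : HasLineDerivAt ℝ (frameW f j) (fderiv ℝ (frameW f j) t u) t u :=
    hW.hasFDerivAt.hasLineDerivAt u
  have h2 : HasLineDerivAt ℝ (fun t ↦ ψ (baseMap n t)) (f.g (baseMap n t) (baseMap n u)) t u :=
    HasFDerivAt.hasLineDerivAt_comp (hψ.hasFDerivAt _ ht) u
  have h3 := HasDerivAt.clm_apply (HasDerivAt.const_sub (1 : Model n →L[ℝ] Model n) h1) h2
  have h4 := (sliceMap n).hasFDerivAt.comp_hasDerivAt (0 : ℝ) (HasDerivAt.prodMk h3 h1)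
  have h5 : HasLineDerivAt ℝ (holMap f ψ j) _ t u := hH.hasFDerivAt.hasLineDerivAt u
  rw [h5.unique h4]
  simp only [zero_smul, add_zero, neg_apply]
  congr 2
  abel

/-- The differential is triangular: its fibre component gives dW(u) = 0 and hence a vanishing
covariant derivative, after which the base component involves only the invertible operators 1 - W
and g. -/
lemma fderiv_holMap_injective (hψ : f.IsAffine cov ψ) (hO : IsOpen O) (hj : ContDiffOn ℝ ∞ j O)
    (hOd : ∀ t ∈ O, baseMap n t ∈ f.dom) (hc : ∀ t ∈ O, IsStdCompatible (stdJ n) (frameJ f j t))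
    (ht : t ∈ O) {u : TModel n} (h : fderiv ℝ (holMap f ψ j) t u = 0) :
    baseMap n u = 0 ∧ covEnd (connForm cov x₀) (baseMap n) j t u = 0 := by
  have hjt := hj.contDiffAt (hO.mem_nhds ht)
  have hm := fderiv_frameW_mem hO hj hOd hc ht u
  have hn := (cayley_mem_of_isStdCompatible (isOrthComplex_stdJ n) (hc t ht)).2
  have hu := f.isUnit_g _ (hOd t ht)
  rw [fderiv_holMap hψ hjt (hOd t ht) (hc t ht)] at h
  have h1 := baseMap_sliceMap (y := (1 - frameW f j t) (f.g (baseMap n t) (baseMap n u)) -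
      fderiv ℝ (frameW f j) t u (ψ (baseMap n t))) hm
  have h2 := fibreMap_sliceMap (y := (1 - frameW f j t) (f.g (baseMap n t) (baseMap n u)) -
      fderiv ℝ (frameW f j) t u (ψ (baseMap n t))) hm
  rw [h, map_zero] at h1 h2
  rw [← h2, zero_apply, sub_zero] at h1
  have hinj {g : Model n →L[ℝ] Model n} (hg : IsUnit g) {v : Model n} (h : g v = 0) : v = 0 := by
    have := congrArg (fun f : Model n →L[ℝ] Model n ↦ f v) (Ring.inverse_mul_cancel _ hg)
    simp only [mul_apply_eq_comp, h, map_zero, one_apply_eq_self] at this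
    exact this.symm
  constructor
  · refine hinj hu (hinj ?_ h1.symm)
    have := isUnit_one_add_of_norm_lt_one (X := -frameW f j t) (by rw [norm_neg]; exact hn)
    rwa [← sub_eq_add_neg] at this
  · rw [fderiv_frameW hψ hO hj hOd hc ht] at h2
    have h3 : cayleyDeriv (stdJ n) (frameW f j t) 0 = 0 := by simp [cayleyDeriv]
    have h4 := cayleyDeriv_injective (isOrthComplex_stdJ n).sq (isUnit_one_add_of_norm_lt_one hn)
      (h3.trans h2)
    have hi : IsUnit (Ring.inverse (f.g (baseMap n t))) := by
      obtain ⟨g, hg⟩ := hu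
      rw [← hg, Ring.inverse_unit]
      exact g⁻¹.isUnit
    refine (eq_of_isUnit_mul hu hi ?_).symm
    rw [← h4, mul_zero, zero_mul]

/-- The Cayley transform is holomorphic, so dW(u') = j dW(u). The base component is (1 - W)dψ -
dW(ψ): the first term is complex linear by `one_sub_mul_cayleyInv`, the second because j multiplies
dW on the left. -/
lemma fderiv_holMap_complex_linear (hψ : f.IsAffine cov ψ) (hO : IsOpen O) (hj : ContDiffOn ℝ ∞ j O)
    (hOd : ∀ t ∈ O, baseMap n t ∈ f.dom) (hc : ∀ t ∈ O, IsStdCompatible (stdJ n) (frameJ f j t))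
    (ht : t ∈ O) {u u' : TModel n} (h1 : baseMap n u' = j t (baseMap n u))
    (h2 : covEnd (connForm cov x₀) (baseMap n) j t u' =
      j t * covEnd (connForm cov x₀) (baseMap n) j t u) :
    fderiv ℝ (holMap f ψ j) t u' = modelJ n (fderiv ℝ (holMap f ψ j) t u) := by
  have hjt := hj.contDiffAt (hO.mem_nhds ht)
  have hm := fderiv_frameW_mem hO hj hOd hc ht u
  have hs : frameW f j t ∈ symAnti (stdJ n) :=
    (cayley_mem_of_isStdCompatible (isOrthComplex_stdJ n) (hc t ht)).1
  have hn : ‖frameW f j t‖ < 1 := (cayley_mem_of_isStdCompatible (isOrthComplex_stdJ n) (hc t ht)).2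
  have hX := isUnit_one_add_of_norm_lt_one hn
  have hu := f.isUnit_g _ (hOd t ht)
  have hcW : cayleyInv (stdJ n) (frameW f j t) = frameJ f j t :=
    cayleyInv_cayley (isOrthComplex_stdJ n).sq
      (isUnit_one_sub_of_isStdCompatible (isOrthComplex_stdJ n) (hc t ht))
  have hgj : f.g (baseMap n t) * j t = frameJ f j t * f.g (baseMap n t) := by
    rw [frameJ, mul_assoc, mul_assoc, Ring.inverse_mul_cancel _ hu, mul_one]
  have hW : fderiv ℝ (frameW f j) t u' = stdJ n * fderiv ℝ (frameW f j) t u := by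
    rw [fderiv_frameW hψ hO hj hOd hc ht, fderiv_frameW hψ hO hj hOd hc ht, h2, ← mul_assoc, hgj,
      ← hcW, mul_assoc, mul_assoc, cayleyDeriv_mul_left (isOrthComplex_stdJ n).sq hX hs.1, mul_assoc]
  have hv : (1 - frameW f j t) (f.g (baseMap n t) (baseMap n u')) =
      stdJ n ((1 - frameW f j t) (f.g (baseMap n t) (baseMap n u))) := by
    have h3 : f.g (baseMap n t) (j t (baseMap n u)) =
        frameJ f j t (f.g (baseMap n t) (baseMap n u)) :=
      congrArg (fun f : Model n →L[ℝ] Model n ↦ f (baseMap n u)) hgj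
    rw [h1, h3, ← hcW]
    exact congrArg (fun g : Model n →L[ℝ] Model n ↦ g (f.g (baseMap n t) (baseMap n u)))
      (one_sub_mul_cayleyInv hX hs.1)
  rw [fderiv_holMap hψ hjt (hOd t ht) (hc t ht), fderiv_holMap hψ hjt (hOd t ht) (hc t ht),
    modelJ_apply, baseMap_sliceMap hm, fibreMap_sliceMap hm, hW, hv, map_sub]
  rfl

namespace AdaptedCharts

variable [ChartedSpace (TModel n) (TwistorSpace σ)] (h : AdaptedCharts σ)
  [IsManifold 𝓘(ℝ, TModel n) ∞ (TwistorSpace σ)]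

lemma isIntegrable_twistorJ [T2Space M] (hσ : IsSymplecticForm σ)
    (hcov : IsSymplecticConnection σ cov) (hflat : IsFlat cov) :
    IsIntegrable (h.twistorJ hσ.isTwoForm hcov) := by
  refine isIntegrable_of_exists_map fun z₀ ↦ ?_
  obtain ⟨f, ψ, hψ⟩ := exists_affine_frame hσ hcov hflat z₀.proj
  -- The chart is built from the frame `h.frame z₀`, the holomorphic coordinates from the parallel
  -- frame f; `O` is where both are defined.
  set jh := jCoord (h.frame z₀) with hjh
  set O := (chartAt (TModel n) z₀).target ∩ baseMap n ⁻¹' f.dom with hOdef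
  have hO : IsOpen O := (chartAt (TModel n) z₀).open_target.inter
    (f.isOpen_dom.preimage (baseMap n).continuous)
  have hj : ContDiffOn ℝ ∞ jh O := h.contDiffOn_jCoord.mono Set.inter_subset_left
  have hc : ∀ t ∈ O, IsStdCompatible (stdJ n) (frameJ f jh t) := by
    rintro t ⟨ht, hb⟩
    have hz := (chartAt (TModel n) z₀).map_target ht
    have hr := (chartAt (TModel n) z₀).right_inv ht
    have h1 := h.extChartAt_proj hz
    have h2 := h.endCoord_Phi hz
    rw [hr] at h1 h2
    have h3 := (isCompatible_iff f (h.proj_mem_source hz) (by rw [h1]; exact hb) _).1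
      ((chartAt (TModel n) z₀).symm t).2
    rw [h1] at h3
    change IsStdCompatible (stdJ n) (f.g (baseMap n t) * endCoord z₀.proj
      ((chartAt (TModel n) z₀).symm t).proj ((chartAt (TModel n) z₀).symm t).Phi *
      Ring.inverse (f.g (baseMap n t))) at h3
    rwa [h2] at h3
  have hOd : ∀ t ∈ O, baseMap n t ∈ f.dom := fun t ht ↦ ht.2
  have hz₀ := mem_chart_source (TModel n) z₀
  refine ⟨O, holMap f ψ jh, modelJ n, hO, ⟨mem_chart_target _ _, ?_⟩,
    fun t ht ↦ (contDiffAt_holMap hψ (hj.contDiffAt (hO.mem_nhds ht)) (hOd t ht)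
      (hc t ht)).contDiffWithinAt, fun t ht u hu ↦ ?_, modelJ_modelJ, fun z hz hzO X ↦ ?_⟩
  · change baseMap n (chartAt (TModel n) z₀ z₀) ∈ f.dom
    rw [← h.extChartAt_proj hz₀]
    exact f.mem_dom
  · obtain ⟨h1, h2⟩ := fderiv_holMap_injective hψ hO hj hOd hc ht hu
    have h3 := (h.mem_target z₀ t).1 ht.1
    have h4 : vertCoord cov (h.frame z₀) t u = vertCoord cov (h.frame z₀) t 0 := by
      rw [vertCoord, vertCoord, h2]
      simp [covEnd]
    have h5 := twistorVec_vertCoord (cov := cov) (f := h.frame z₀) h3.1 h3.2 u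
    have h6 := twistorVec_vertCoord (cov := cov) (f := h.frame z₀) h3.1 h3.2 0
    rw [h1, h4] at h5
    rw [map_zero] at h6
    exact h5.symm.trans h6
  · obtain ⟨h1, h2⟩ := h.twistorJ_spec hσ.isTwoForm hcov X
    exact fderiv_holMap_complex_linear hψ hO hj hOd hc hzO ((h.dproj_eq_Phi_iff hz _ _).1 h1)
      ((vertCoord_eq_mul_iff (h.baseMap_mem hz) _ _).1 ((h.P_eq_Phi_iff hz _ _).1 h2))

end AdaptedCharts

end FlatTwistor

/-! ### The Hermitian form at a point. -/

section HermitianForm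

variable {V : Type*} [NormedAddCommGroup V] [InnerProductSpace ℝ V] [FiniteDimensional ℝ V]
  {j c Y Y' : V →L[ℝ] V} {t : ℝ} {v v' : V}

variable (j c) in
/-- The Kähler form of the twistor space at `c` in a symplectic frame. -/
def hermForm (t : ℝ) (v : V) (Y : V →L[ℝ] V) (v' : V) (Y' : V →L[ℝ] V) : ℝ :=
  t * inner ℝ (j v) v' + 1 / 8 * trE V (Y * Y' * c)

/-- From cY'c = Y' it follows that cY · cY' · c = c · YY', whose trace is that of YY'c. -/
lemma hermForm_invariant (hc : IsStdCompatible j c) (hY' : IsTangentTo j c Y') :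
    hermForm j c t (c v) (c * Y) (c v') (c * Y') = hermForm j c t v Y v' Y' := by
  have h1 : c * Y * (c * Y') * c = c * (Y * (Y' * (c * c)) * -1) := by
    have h2 : c * Y' * c = -(Y' * (c * c)) := by rw [← mul_assoc, hY'.anti, neg_mul, neg_neg]
    rw [mul_assoc, h2]
    simp only [mul_assoc, mul_neg, mul_one]
  have h3 : Y * (Y' * (c * c)) * -1 = Y * Y' := by
    ext1 u
    simp only [hc.sq, mul_apply_eq_comp, neg_apply, one_apply_eq_self, map_neg, neg_neg]
  rw [hermForm, hermForm, hc.invariant, h1, h3, trE_mul_comm]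

/-- Here Y · cY · c = Y², and Y is symmetric for the positive definite form ⟪j·, c·⟫, so
`trace_comp_self_pos` handles the fibre part; the base part is t⟪jv, cv⟫. -/
lemma hermForm_pos (hj : IsOrthComplex j) (hc : IsStdCompatible j c) (hY : IsTangentTo j c Y)
    (ht : 0 < t) (h0 : v ≠ 0 ∨ Y ≠ 0) : 0 < hermForm j c t v Y (c v) (c * Y) := by
  have hcc (u : V) : c (c u) = -u := congrArg (fun f : V →L[ℝ] V ↦ f u) hc.sq
  have h1 : Y * (c * Y) * c = Y * Y := by
    ext1 u
    have h2 : Y (c u) = -c (Y u) := congrArg (fun f : V →L[ℝ] V ↦ f u) hY.anti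
    simp only [mul_apply_eq_comp, h2, map_neg, hcc, neg_neg]
  have htr (h : Y ≠ 0) : 0 < trE V (Y * Y) := by
    let B : LinearMap.BilinForm ℝ V := (innerₗ V).compl₁₂ j.toLinearMap c.toLinearMap
    refine trace_comp_self_pos (B := B) (P := Y.toLinearMap) (fun u v ↦ ?_)
      (fun u hu ↦ hc.positive u hu) (fun u v ↦ ?_) fun h' ↦ h (ContinuousLinearMap.coe_injective h')
    · change inner ℝ (j u) (c v) = inner ℝ (j v) (c u)
      have h2 := hc.invariant u (c v)
      rw [hcc, inner_neg_right, hj.skew, neg_neg] at h2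
      rw [← h2, real_inner_comm]
    · change inner ℝ (j (Y u)) (c v) = inner ℝ (j u) (c (Y v))
      have h2 := hY.symplectic u (c v)
      have h3 : Y (c v) = -c (Y v) := congrArg (fun f : V →L[ℝ] V ↦ f v) hY.anti
      rw [h3, inner_neg_right] at h2
      linarith
  have htr' : 0 ≤ trE V (Y * Y) := by
    by_cases h : Y = 0
    · simp [h]
    · exact (htr h).le
  rw [hermForm, h1]
  by_cases hv : v = 0
  · subst hv
    have := htr (h0.resolve_left fun h ↦ h rfl)
    simp only [map_zero, inner_zero_right, mul_zero, zero_add]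
    positivity
  · have := hc.positive v hv
    positivity

end HermitianForm

/-! ### The Kähler structure and the main theorem. -/

section Kaehler

variable {n : ℕ} {M : Type*} [TopologicalSpace M]
  [ChartedSpace (EuclideanSpace ℝ (Fin (2 * n))) M] [IsManifold 𝓘(ℝ, Model n) ∞ M]
  {σ : BilinField (Model n) M} {cov : LinearConnection n M}

/-- The frame carries σ to the standard form, and the trace does not change under conjugation by the
frame. -/
lemma coordForm_eq_hermForm {x₀ : M} {f : SympFrame σ x₀} {w : TModel n} (hw : baseMap n w ∈ f.dom)
    (t : ℝ) (u u' : TModel n) :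
    coordForm t (inChart σ x₀) (connForm cov x₀) (baseMap n) (jCoord f) w u u' =
      hermForm (stdJ n) (cayleyInv (stdJ n) (fibreMap n w)) t
        (f.g (baseMap n w) (baseMap n u)) (vertCoord cov f w u)
        (f.g (baseMap n w) (baseMap n u')) (vertCoord cov f w u') := by
  have hu := f.isUnit_g _ hw
  rw [coordForm, hermForm, f.inChart_eq _ hw, vertCoord, vertCoord]
  congr 2
  have h1 : cayleyInv (stdJ n) (fibreMap n w) =
      f.g (baseMap n w) * jCoord f w * Ring.inverse (f.g (baseMap n w)) := by
    rw [frame_mul_jCoord hw, mul_assoc, Ring.mul_inverse_cancel _ hu, mul_one]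
  have h2 (a b c g gi : Model n →L[ℝ] Model n) (h : gi * g = 1) :
      g * a * gi * (g * b * gi) * (g * c * gi) = g * (a * b * c * gi) := by
    calc _ = g * (a * ((gi * g) * (b * ((gi * g) * (c * gi))))) := by simp only [mul_assoc]
      _ = _ := by rw [h, one_mul, one_mul]; simp only [mul_assoc]
  rw [h1, h2 _ _ _ _ _ (Ring.inverse_mul_cancel _ hu), trE_mul_comm (f.g _),
    mul_assoc _ _ (f.g (baseMap n w)), Ring.inverse_mul_cancel _ hu, mul_one]

namespace AdaptedCharts

variable [ChartedSpace (TModel n) (TwistorSpace σ)] (h : AdaptedCharts σ)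
  [IsManifold 𝓘(ℝ, TModel n) ∞ (TwistorSpace σ)]

lemma Omega_eq_hermForm (t : ℝ) {z : TwistorSpace σ} (X X' : TangentSpace 𝓘(ℝ, TModel n) z) :
    TwistorSpace.Omega cov t z X X' =
      hermForm (stdJ n) (cayleyInv (stdJ n) (fibreMap n (chartAt (TModel n) z z))) t
        ((h.frame z).g (baseMap n (chartAt (TModel n) z z)) (baseMap n (toCoord z z X)))
        (vertCoord cov (h.frame z) (chartAt (TModel n) z z) (toCoord z z X))
        ((h.frame z).g (baseMap n (chartAt (TModel n) z z)) (baseMap n (toCoord z z X')))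
        (vertCoord cov (h.frame z) (chartAt (TModel n) z z) (toCoord z z X')) := by
  have hz := mem_chart_source (TModel n) z
  rw [h.Omega_apply hz, coordForm_eq_hermForm (h.baseMap_mem hz)]

lemma twistorJ_coord (hσ : IsTwoForm σ) (hcov : IsSymplecticConnection σ cov)
    {z : TwistorSpace σ} (X : TangentSpace 𝓘(ℝ, TModel n) z) :
    (h.frame z).g (baseMap n (chartAt (TModel n) z z))
        (baseMap n (toCoord z z (h.twistorJ hσ hcov z X))) =
      cayleyInv (stdJ n) (fibreMap n (chartAt (TModel n) z z))
        ((h.frame z).g (baseMap n (chartAt (TModel n) z z)) (baseMap n (toCoord z z X))) ∧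
    vertCoord cov (h.frame z) (chartAt (TModel n) z z) (toCoord z z (h.twistorJ hσ hcov z X)) =
      cayleyInv (stdJ n) (fibreMap n (chartAt (TModel n) z z)) *
        vertCoord cov (h.frame z) (chartAt (TModel n) z z) (toCoord z z X) := by
  have hz := mem_chart_source (TModel n) z
  obtain ⟨h1, h2⟩ := h.twistorJ_spec hσ hcov X
  refine ⟨?_, (h.P_eq_Phi_iff hz _ _).1 h2⟩
  rw [(h.dproj_eq_Phi_iff hz _ _).1 h1]
  exact congrArg (fun g : Model n →L[ℝ] Model n ↦ g (baseMap n (toCoord z z X)))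
    (frame_mul_jCoord (h.baseMap_mem hz))

lemma Omega_invariant (hσ : IsTwoForm σ) (hcov : IsSymplecticConnection σ cov) (t : ℝ)
    (z : TwistorSpace σ) (X X' : TangentSpace 𝓘(ℝ, TModel n) z) :
    TwistorSpace.Omega cov t z (h.twistorJ hσ hcov z X) (h.twistorJ hσ hcov z X') =
      TwistorSpace.Omega cov t z X X' := by
  have hz := mem_chart_source (TModel n) z
  rw [h.Omega_eq_hermForm, h.Omega_eq_hermForm, (h.twistorJ_coord hσ hcov X).1,
    (h.twistorJ_coord hσ hcov X).2, (h.twistorJ_coord hσ hcov X').1,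
    (h.twistorJ_coord hσ hcov X').2,
    hermForm_invariant (isStdCompatible_cayleyInv_fibreMap (h.norm_fibreMap_lt hz))
      (isTangentTo_vertCoord hσ hcov (h.baseMap_mem hz) (h.norm_fibreMap_lt hz) _)]

lemma Omega_pos (hσ : IsTwoForm σ) (hcov : IsSymplecticConnection σ cov) {t : ℝ} (ht : 0 < t)
    (z : TwistorSpace σ) (X : TangentSpace 𝓘(ℝ, TModel n) z) (hX : X ≠ 0) :
    0 < TwistorSpace.Omega cov t z X (h.twistorJ hσ hcov z X) := by
  have hz := mem_chart_source (TModel n) z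
  rw [h.Omega_eq_hermForm, (h.twistorJ_coord hσ hcov X).1, (h.twistorJ_coord hσ hcov X).2]
  refine hermForm_pos (isOrthComplex_stdJ n)
    (isStdCompatible_cayleyInv_fibreMap (h.norm_fibreMap_lt hz))
    (isTangentTo_vertCoord hσ hcov (h.baseMap_mem hz) (h.norm_fibreMap_lt hz) _) ht ?_
  by_contra! h0
  have hu := (h.frame z).isUnit_g _ (h.baseMap_mem hz)
  have h1 : baseMap n (toCoord z z X) = 0 := by
    have := congrArg (fun f : Model n →L[ℝ] Model n ↦ f (baseMap n (toCoord z z X)))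
      (Ring.inverse_mul_cancel _ hu)
    simp only [mul_apply_eq_comp, h0.1, map_zero, one_apply_eq_self] at this
    exact this.symm
  have h2 := twistorVec_vertCoord (cov := cov) (h.baseMap_mem hz) (h.norm_fibreMap_lt hz)
    (toCoord z z X)
  have h3 := twistorVec_vertCoord (cov := cov) (h.baseMap_mem hz) (h.norm_fibreMap_lt hz) 0
  have h4 : vertCoord cov (h.frame z) (chartAt (TModel n) z z) 0 = 0 := by simp [vertCoord, covEnd]
  rw [h1, h0.2] at h2
  rw [map_zero, h4, h2] at h3
  refine hX ?_
  rw [← ofCoord_toCoord hz X, h3, map_zero]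

lemma isKahler [T2Space M] (hσ : IsSymplecticForm σ) (hcov : IsSymplecticConnection σ cov)
    (hflat : IsFlat cov) {t : ℝ} (ht : 0 < t) :
    IsKahler (h.twistorJ hσ.isTwoForm hcov) (TwistorSpace.Omega (σ := σ) cov t) where
  isAlmostComplex := h.isAlmostComplex_twistorJ hσ.isTwoForm hcov
  isIntegrable := h.isIntegrable_twistorJ hσ hcov hflat
  isTwoForm := h.isTwoForm_Omega hσ hcov t
  closed := h.isClosedForm_Omega_of_isFlat hσ hcov t hflat
  compatible := h.Omega_invariant hσ.isTwoForm hcov t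
  positive := h.Omega_pos hσ.isTwoForm hcov ht

end AdaptedCharts

end Kaehler

end SympTwistor

end

theorem theorem5p2 (n : ℕ) {M : Type*} [TopologicalSpace M] [T2Space M] [SecondCountableTopology M]
    [ChartedSpace (EuclideanSpace ℝ (Fin (2 * n))) M]
    [IsManifold 𝓘(ℝ, SympTwistor.Model n) ∞ M]
    (σ : SympTwistor.BilinField (SympTwistor.Model n) M) (hσ : SympTwistor.IsSymplecticForm σ)
    (cov : SympTwistor.LinearConnection n M) (hcov : SympTwistor.IsSymplecticConnection σ cov)
    (t : ℝ) (ht : 0 < t) :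
    ∃ (_ : ChartedSpace (SympTwistor.TModel n) (SympTwistor.TwistorSpace σ))
      (_ : IsManifold 𝓘(ℝ, SympTwistor.TModel n) ∞ (SympTwistor.TwistorSpace σ)),
      IsSmoothEmbedding 𝓘(ℝ, SympTwistor.TModel n)
        (𝓘(ℝ, SympTwistor.Model n).prod 𝓘(ℝ, SympTwistor.Model n →L[ℝ] SympTwistor.Model n)) ∞
        (Subtype.val : SympTwistor.TwistorSpace σ → SympTwistor.EndTM n M) ∧
      ∃ J : SympTwistor.EndField (SympTwistor.TModel n) (SympTwistor.TwistorSpace σ),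
        (∀ J', SympTwistor.TwistorSpace.IsTwistorStructure cov J' ↔ J' = J) ∧
        SympTwistor.IsTwoForm (SympTwistor.TwistorSpace.Omega (σ := σ) cov t) ∧
        (SympTwistor.IsClosedForm (SympTwistor.TwistorSpace.Omega (σ := σ) cov t) ↔
          SympTwistor.IsFlat cov) ∧
        (SympTwistor.IsFlat cov →
          SympTwistor.IsKahler J (SympTwistor.TwistorSpace.Omega (σ := σ) cov t)) := by
  let _ := SympTwistor.twistorChartedSpace hσ
  have hM : IsManifold 𝓘(ℝ, SympTwistor.TModel n) ∞ (SympTwistor.TwistorSpace σ) :=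
    SympTwistor.isManifold_subChartedSpace (SympTwistor.twistorSlices hσ)
      (SympTwistor.mem_twistorSlices hσ)
  -- From here on the charts enter only through the properties recorded in `AdaptedCharts`, except
  -- in the smooth embedding.
  have h := SympTwistor.adaptedCharts hσ
  exact ⟨inferInstance, hM, SympTwistor.isSmoothEmbedding_subtypeVal (SympTwistor.twistorSlices hσ)
      (SympTwistor.mem_twistorSlices hσ), h.twistorJ hσ.isTwoForm hcov,
    h.isTwistorStructure_iff hσ.isTwoForm hcov, h.isTwoForm_Omega hσ hcov t,
    h.isClosedForm_Omega_iff hσ hcov t, fun hflat ↦ h.isKahler hσ hcov hflat ht⟩
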